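/- **Setting.** Let $(M,\tau)$ be a tracial von Neumann algebra (with $\tau$ a faithful normal tracial state) generated by a self-adjoint, algebraically free $n$-tuple $X=(X_1,\dots,X_n)$, $n\ge 1$; $M$ acts on $L^2(M)=L^2(M,\tau)$ by left multiplication, $1\in M\subset L^2(M)$ is the canonical vector, and $J$ is the conjugate-linear isometric extension of $x\mapsto x^*$ to $L^2(M)$. For $1\le i\le n$ let $\partial_i:\mathbb C\langle X_1,\dots,X_n\rangle\to L^2(M)\bar\otimes L^2(M^{op})$ be the partial free difference quotient, i.e. the derivation with $\partial_iX_j=\delta_{ij}\,1\otimes1$ (for the bimodule structure $a(b\otimes c)d=ab\otimes cd$), regarded as a densely defined operator on $L^2(M)$. Assume that $X$ has *Lipschitz conjugate variables*: every $\partial_i$ is closable, with closure $\bar\partial_i$; $\xi_i:=\partial_i^*(1\otimes1)$ exists in $L^2(M)$ and belongs to $\mathrm{Dom}(\bar\partial):=\bigcap_j\mathrm{Dom}(\bar\partial_j)$; and $\bar\partial_j\xi_i\in M\bar\otimes M^{op}\subset L^2(M)\bar\otimes L^2(M^{op})$ for all $i,j$. Assume moreover the curvature-dimension bound $CD(1,\infty)$: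 the Jacobian $\mathscr J\xi=(\bar\partial_j\xi_i)_{i,j}$ satisfies $\mathscr J\xi\ge(1\otimes1)\otimes I_n$ in $M_n(M\bar\otimes M^{op})$. **Theorem (free Obata rigidity).** Let $f\in \mathrm{Dom}(\bar\partial)$ (the form domain $\mathrm{Dom}(\Delta^{1/2})$ of $\Delta=\partial^*\bar\partial$) be non-zero, centered ($\langle f,1\rangle=0$) and self-adjoint ($Jf=f$), and suppose that $f$ saturates the free Poincaré inequality: $\|f\|_{L^2(M)}^2=\sum_{i=1}^n\|\bar\partial_if\|^2$. Then there is $U\in O(n)$ such that, with $X_j^\circ:=X_j-\tau(X_j)1$ and $Y_i:=\sum_jU_{ij}X_j^\circ$: 1. $f=\|f\|_{L^2(M)}\,Y_1$; 2. $Y_1$ is a standard semicircular variable (centered, of variance $1$); 3. $Y_1$ is free from the family $(Y_2,\dots,Y_n)$ with respect to $\tau$; 4. $W^*(X_1,\dots,X_n)=W^*(Y_1,\dots,Y_n)$; 5. with $N=W^*(Y_2,\dots,Y_n)$ and $\tau_N=\tau|_N$, there are trace-preserving isomorphisms $$(M,\tau)\cong(W^*(Y_1),\tau|_{W^*(Y_1)})*(N,\tau_N)\cong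 \big(L^\infty([-2,2],\mu_{sc}),\textstyle\int\cdot\,d\mu_{sc}\big)*(N,\tau_N),$$ where $\mu_{sc}$ has density $\frac1{2\pi}\sqrt{4-t^2}$ on $[-2,2]$ and, for the second one, $(W^*(Y_1),\tau)\cong L^\infty([-2,2],\mu_{sc})$ by a trace-preserving $*$-isomorphism. Moreover $W^*(Y_1)$ is freely complemented in $M$, with free complement $N$: the two subalgebras are free and generate $M$. -/

import Mathlib

open scoped TensorProduct InnerProductSpace ENNReal

universe u w

noncomputable section

namespace FreeObata

/-! ### Tracial von Neumann algebras in standard form -/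

section VonNeumann

variable {H : Type u} [NormedAddCommGroup H] [InnerProductSpace ℂ H] [CompleteSpace H]

/-- `W*(S)`: the von Neumann algebra generated by a set `S` of bounded operators, i.e. the double
commutant of `S ∪ S*`. -/
def wStar (S : Set (H →L[ℂ] H)) : VonNeumannAlgebra H where
  toStarSubalgebra :=
    StarSubalgebra.centralizer ℂ (StarSubalgebra.centralizer ℂ S : Set (H →L[ℂ] H))
  centralizer_centralizer' := by
    change Set.centralizer (Set.centralizer
      ((StarSubalgebra.centralizer ℂ (StarSubalgebra.centralizer ℂ S : Set (H →L[ℂ] H)) :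
        StarSubalgebra ℂ (H →L[ℂ] H)) : Set (H →L[ℂ] H))) =
      ((StarSubalgebra.centralizer ℂ (StarSubalgebra.centralizer ℂ S : Set (H →L[ℂ] H)) :
        StarSubalgebra ℂ (H →L[ℂ] H)) : Set (H →L[ℂ] H))
    rw [StarSubalgebra.coe_centralizer_centralizer, Set.centralizer_centralizer_centralizer]

/-- The vector state `τ(x) = ⟨x Ω, Ω⟩` (Mathlib's inner product is conjugate-linear on the left). -/
def tr (Ω : H) (x : H →L[ℂ] H) : ℂ := ⟪Ω, x Ω⟫_ℂ

/-- `(M, τ)` with `τ = ⟨· Ω, Ω⟩` is a tracial von Neumann algebra acting on `H = L²(M, τ)`, with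
`Ω = 1 ∈ M ⊆ L²(M)`: the normal state `τ` is tracial and faithful on `M`, and `M Ω` is dense. -/
structure IsStandardForm (M : VonNeumannAlgebra H) (Ω : H) : Prop where
  norm_one : ‖Ω‖ = 1
  trace_comm : ∀ x ∈ M, ∀ y ∈ M, tr Ω (x * y) = tr Ω (y * x)
  faithful : ∀ x ∈ M, tr Ω (star x * x) = 0 → x = 0
  cyclic : Dense {v : H | ∃ x ∈ M, x Ω = v}

/-- A vector `f ∈ L²(M)` is self-adjoint: `J f = f`, where `J` is the conjugate-linear isometric
extension of `x ↦ x*` to `L²(M)`. -/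
def IsSelfAdjointVec (M : VonNeumannAlgebra H) (Ω f : H) : Prop :=
  ∃ J : H →ₗᵢ⋆[ℂ] H, (∀ x ∈ M, J (x Ω) = (star x) Ω) ∧ J f = f

/-! ### The coarse bimodule and the algebra `M ⊗ M^op` -/

variable (H) in
/-- The Hilbert space tensor product `L²(M) ⊗ L²(M^op)`, with `L²(M^op) = L²(M)`. -/
abbrev Coarse : Type u := UniformSpace.Completion (H ⊗[ℂ] H)

/-- The simple tensor `a ⊗ b` in `L²(M) ⊗ L²(M^op)`. -/
def tens (a b : H) : Coarse H := ((a ⊗ₜ[ℂ] b : H ⊗[ℂ] H) : Coarse H)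

/-- The bounded operator `x ⊗ y` on `L²(M) ⊗ L²(M^op)`. -/
def opTens (x y : H →L[ℂ] H) : Coarse H →L[ℂ] Coarse H :=
  (TensorProduct.mapL x y).completion

/-- `R` is the operator of right multiplication by `y` on `L²(M)`; this is the left action of
`y ∈ M^op` on `L²(M^op) = L²(M)`. -/
def IsRightMul (M : VonNeumannAlgebra H) (Ω : H) (y R : H →L[ℂ] H) : Prop :=
  ∀ x ∈ M, R (x Ω) = (x * y) Ω

/-- The von Neumann tensor product of `M` and `M^op`, acting on `L²(M) ⊗ L²(M^op)` by left
multiplication on each leg. -/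
def tensorOp (M : VonNeumannAlgebra H) (Ω : H) : VonNeumannAlgebra (Coarse H) :=
  wStar {T | ∃ x ∈ M, ∃ y ∈ M, ∃ R : H →L[ℂ] H, IsRightMul M Ω y R ∧ T = opTens x R}

/-! ### Free difference quotients -/

variable {n : ℕ}

/-- The formal free difference quotient `∂ᵢ : ℂ⟨t₁,…,tₙ⟩ → ℂ⟨t⟩ ⊗ ℂ⟨t⟩`, read off as the upper right
entry of the algebra morphism `t_j ↦ [[t_j ⊗ 1, δ_{ij} 1 ⊗ 1], [0, 1 ⊗ t_j]]`. -/
def freeDiffHom (i : Fin n) : FreeAlgebra ℂ (Fin n) →ₐ[ℂ]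
    Matrix (Fin 2) (Fin 2) (FreeAlgebra ℂ (Fin n) ⊗[ℂ] FreeAlgebra ℂ (Fin n)) :=
  FreeAlgebra.lift ℂ fun j =>
    !![FreeAlgebra.ι ℂ j ⊗ₜ[ℂ] 1, if i = j then 1 else 0; 0, 1 ⊗ₜ[ℂ] FreeAlgebra.ι ℂ j]

/-- The formal free difference quotient `∂ᵢ`, as a linear map. -/
def freeDiff (i : Fin n) :
    FreeAlgebra ℂ (Fin n) →ₗ[ℂ] FreeAlgebra ℂ (Fin n) ⊗[ℂ] FreeAlgebra ℂ (Fin n) where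
  toFun p := freeDiffHom i p 0 1
  map_add' p q := by simp
  map_smul' c p := by simp

/-- `∂ᵢ t_j = δ_{ij} 1 ⊗ 1`. -/
theorem freeDiff_ι (i j : Fin n) :
    freeDiff i (FreeAlgebra.ι ℂ j) = if i = j then 1 ⊗ₜ[ℂ] 1 else 0 := by
  simp [freeDiff, freeDiffHom, Algebra.TensorProduct.one_def]

theorem freeDiffHom_diag (i : Fin n) (p : FreeAlgebra ℂ (Fin n)) :
    freeDiffHom i p 0 0 = p ⊗ₜ[ℂ] 1 ∧ freeDiffHom i p 1 1 = 1 ⊗ₜ[ℂ] p ∧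
      freeDiffHom i p 1 0 = 0 := by
  induction p using FreeAlgebra.induction with
  | grade0 r =>
    simp [Matrix.algebraMap_matrix_apply, Algebra.TensorProduct.algebraMap_apply,
      Algebra.TensorProduct.tmul_one_eq_one_tmul]
  | grade1 j => simp [freeDiffHom]
  | mul a b ha hb =>
    obtain ⟨h1, h2, h3⟩ := ha
    obtain ⟨k1, k2, k3⟩ := hb
    simp [Matrix.mul_apply, Fin.sum_univ_two, h1, h2, h3, k1, k2, k3]
  | add a b ha hb =>
    obtain ⟨h1, h2, h3⟩ := ha
    obtain ⟨k1, k2, k3⟩ := hb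
    simp [h1, h2, h3, k1, k2, k3, TensorProduct.add_tmul, TensorProduct.tmul_add]

/-- The Leibniz rule `∂ᵢ(pq) = p · ∂ᵢ q + ∂ᵢ p · q`, with the outer bimodule structure
`p · (a ⊗ b) · q = p a ⊗ b q`. -/
theorem freeDiff_mul (i : Fin n) (p q : FreeAlgebra ℂ (Fin n)) :
    freeDiff i (p * q) = (p ⊗ₜ[ℂ] 1) * freeDiff i q + freeDiff i p * (1 ⊗ₜ[ℂ] q) := by
  simp [freeDiff, Matrix.mul_apply, Fin.sum_univ_two, freeDiffHom_diag]

/-- The vector `p(X) Ω`, i.e. the polynomial `p(X)` seen in `L²(M)`. -/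
def evalVec (X : Fin n → H →L[ℂ] H) (Ω : H) : FreeAlgebra ℂ (Fin n) →ₗ[ℂ] H where
  toFun p := FreeAlgebra.lift ℂ X p Ω
  map_add' p q := by simp
  map_smul' c p := by simp

/-- The image of `∂ᵢ p` in `L²(M) ⊗ L²(M^op)`, for a noncommutative polynomial `p`. -/
def evalDiff (X : Fin n → H →L[ℂ] H) (Ω : H) (i : Fin n) : FreeAlgebra ℂ (Fin n) →ₗ[ℂ] Coarse H :=
  (UniformSpace.Completion.toComplL (𝕜 := ℂ) (E := H ⊗[ℂ] H)).toLinearMap ∘ₗ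
    TensorProduct.map (evalVec X Ω) (evalVec X Ω) ∘ₗ freeDiff i

/-- The partial free difference quotient as an unbounded operator
`L²(M) → L²(M) ⊗ L²(M^op)` with domain `ℂ⟨X₁,…,Xₙ⟩`, mapping `p(X)` to `(∂ᵢ p)(X)`. -/
def diffQuot (X : Fin n → H →L[ℂ] H) (Ω : H) (i : Fin n) : H →ₗ.[ℂ] Coarse H :=
  (LinearMap.range ((evalVec X Ω).prod (evalDiff X Ω i))).toLinearPMap

/-- The tuple is algebraically free: no nonzero noncommutative polynomial vanishes at `X`. -/
def IsAlgFree (X : Fin n → H →L[ℂ] H) : Prop :=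
  Function.Injective (FreeAlgebra.lift ℂ X : FreeAlgebra ℂ (Fin n) →ₐ[ℂ] (H →L[ℂ] H))

open LinearPMap in
/-- `X` has Lipschitz conjugate variables `ξ` with noncommutative Jacobian `Jac i j = ∂̄ⱼ ξᵢ`:
the `∂ᵢ` are closable, `ξᵢ = ∂ᵢ*(1 ⊗ 1)` exists in `L²(M)`, lies in the domain of every closure `∂̄ⱼ`,
and `∂̄ⱼ ξᵢ` is (the vector in `L²` of) an element of `M ⊗ M^op`. -/
structure IsLipschitzConjugate (X : Fin n → H →L[ℂ] H) (Ω : H) (ξ : Fin n → H)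
    (Jac : Fin n → Fin n → Coarse H →L[ℂ] Coarse H) : Prop where
  closable : ∀ i, (diffQuot X Ω i).IsClosable
  conj : ∀ i, (tens Ω Ω, ξ i) ∈ (diffQuot X Ω i)†.graph
  jac_mem : ∀ i j, Jac i j ∈ tensorOp (wStar (Set.range X)) Ω
  jac_eq : ∀ i j, (ξ i, Jac i j (tens Ω Ω)) ∈ (diffQuot X Ω j).closure.graph

/-- The curvature-dimension bound `CD(c, ∞)`: `Jac ≥ c (1 ⊗ 1) ⊗ Iₙ` in `Mₙ(M ⊗ M^op)`, a matrix of
operators acting on the `n`-fold direct sum of `L²(M) ⊗ L²(M^op)`. -/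
def CurvatureDim (c : ℝ) (Jac : Fin n → Fin n → Coarse H →L[ℂ] Coarse H) : Prop :=
  (∀ i j, star (Jac i j) = Jac j i) ∧
    ∀ η : Fin n → Coarse H, c * ∑ i, ‖η i‖ ^ 2 ≤ (∑ i, ∑ j, ⟪η i, Jac i j (η j)⟫_ℂ).re

/-- The centered variable `X° = X - τ(X) 1`. -/
def centered (Ω : H) (x : H →L[ℂ] H) : H →L[ℂ] H := x - tr Ω x • 1

/-- The rotated centered tuple `Yᵢ = ∑ⱼ Uᵢⱼ Xⱼ°`. -/
def rotate (U : Matrix (Fin n) (Fin n) ℝ) (X : Fin n → H →L[ℂ] H) (Ω : H) (i : Fin n) :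
    H →L[ℂ] H :=
  ∑ j, (U i j : ℂ) • centered Ω (X j)

/-! ### Freeness -/

/-- The unital `*`-subalgebras `A` and `B` are free with respect to `τ = ⟨· Ω, Ω⟩`: `τ` vanishes on
alternating products of `τ`-centered elements of `A` and `B`. -/
def AreFree (Ω : H) (A B : StarSubalgebra ℂ (H →L[ℂ] H)) : Prop :=
  ∀ l : List (Bool × (H →L[ℂ] H)), l ≠ [] → l.IsChain (fun p q => p.1 ≠ q.1) →
    (∀ p ∈ l, p.2 ∈ (if p.1 then A else B) ∧ tr Ω p.2 = 0) →
      tr Ω (l.map Prod.snd).prod = 0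

/-- `N` is a free complement of `B` in `M`: both are von Neumann subalgebras of `M`, they are free
and together they generate `M`. -/
def IsFreeComplement (Ω : H) (B N M : VonNeumannAlgebra H) : Prop :=
  B ≤ M ∧ N ≤ M ∧ AreFree Ω B.toStarSubalgebra N.toStarSubalgebra ∧
    wStar ((B : Set (H →L[ℂ] H)) ∪ (N : Set (H →L[ℂ] H))) = M

/-! ### Free products of tracial von Neumann algebras -/

section FreeProduct

variable {A B : Type*} [Ring A] [StarRing A] [Algebra ℂ A] [StarModule ℂ A]
  [Ring B] [StarRing B] [Algebra ℂ B] [StarModule ℂ B]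

/-- The tracial von Neumann algebra `(P, ⟨· Ω, Ω⟩)` together with `φ : A → P` and `ψ : B → P` is the
free product of the tracial von Neumann algebras `(A, τA)` and `(B, τB)`: the unital
`*`-homomorphisms `φ` and `ψ` preserve the traces, their ranges are free, and generate `P`. -/
structure IsFreeProduct (τA : A → ℂ) (τB : B → ℂ) (P : VonNeumannAlgebra H) (Ω : H)
    (φ : A →⋆ₐ[ℂ] (H →L[ℂ] H)) (ψ : B →⋆ₐ[ℂ] (H →L[ℂ] H)) : Prop where
  standard : IsStandardForm P Ω
  trace_left : ∀ a, tr Ω (φ a) = τA a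
  trace_right : ∀ b, tr Ω (ψ b) = τB b
  free : AreFree Ω φ.range ψ.range
  generate : wStar (Set.range φ ∪ Set.range ψ) = P

/-- `(M, τ) ≅ (A, τA) * (B, τB)`: `M` is the free product along `φ` and `ψ`, and any realisation
`(P, φ', ψ')` of the free product is isomorphic to `M` by a trace-preserving `*`-isomorphism
that matches the embeddings of `A` and of `B`. -/
def IsoFreeProduct (τA : A → ℂ) (τB : B → ℂ) (M : VonNeumannAlgebra H) (Ω : H)
    (φ : A →⋆ₐ[ℂ] (H →L[ℂ] H)) (ψ : B →⋆ₐ[ℂ] (H →L[ℂ] H)) : Prop :=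
  IsFreeProduct τA τB M Ω φ ψ ∧
    ∀ (K : Type w) [NormedAddCommGroup K] [InnerProductSpace ℂ K] [CompleteSpace K]
      (P : VonNeumannAlgebra K) (ω : K)
      (φ' : A →⋆ₐ[ℂ] (K →L[ℂ] K)) (ψ' : B →⋆ₐ[ℂ] (K →L[ℂ] K)),
      IsFreeProduct τA τB P ω φ' ψ' →
        ∃ Φ : M.toStarSubalgebra ≃⋆ₐ[ℂ] P.toStarSubalgebra,
          (∀ x, tr ω (Φ x : K →L[ℂ] K) = tr Ω (x : H →L[ℂ] H)) ∧
          (∀ a (x : M.toStarSubalgebra), (x : H →L[ℂ] H) = φ a → (Φ x : K →L[ℂ] K) = φ' a) ∧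
          (∀ b (x : M.toStarSubalgebra), (x : H →L[ℂ] H) = ψ b → (Φ x : K →L[ℂ] K) = ψ' b)

end FreeProduct

end VonNeumann

/-! ### The semicircular law and `L^∞` -/

open MeasureTheory

/-- The standard semicircular law on `[-2, 2]`, of density `√(4 - t²) / (2π)`. -/
def semicircle : Measure (Set.Icc (-2 : ℝ) 2) :=
  (Measure.comap Subtype.val (volume : Measure ℝ)).withDensity
    fun t => ENNReal.ofReal (Real.sqrt (4 - (t : ℝ) ^ 2) / (2 * Real.pi))

/-- `Y` is a standard semicircular variable: it is self-adjoint, and its moments are those of the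
standard semicircular law. -/
def IsStandardSemicircular {H : Type*} [NormedAddCommGroup H] [InnerProductSpace ℂ H]
    [CompleteSpace H] (Ω : H) (Y : H →L[ℂ] H) : Prop :=
  IsSelfAdjoint Y ∧ ∀ k : ℕ, tr Ω (Y ^ k) = ∫ t, (((t : ℝ) : ℂ)) ^ k ∂semicircle

section LInf

variable {α : Type*} [MeasurableSpace α] (μ : Measure α)

instance instCommRingAEEqFun : CommRing (α →ₘ[μ] ℂ) where
  __ := AEEqFun.instAddCommGroup
  __ := AEEqFun.instCommMonoid
  left_distrib f g h := by
    refine AEEqFun.induction_on₃ f g h fun f hf g hg h hh => ?_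
    simp only [AEEqFun.mk_add_mk, AEEqFun.mk_mul_mk, mul_add]
  right_distrib f g h := by
    refine AEEqFun.induction_on₃ f g h fun f hf g hg h hh => ?_
    simp only [AEEqFun.mk_add_mk, AEEqFun.mk_mul_mk, add_mul]
  zero_mul f := by
    refine AEEqFun.induction_on f fun f hf => ?_
    simp only [AEEqFun.zero_def, AEEqFun.mk_mul_mk]
    congr 1; funext x; simp
  mul_zero f := by
    refine AEEqFun.induction_on f fun f hf => ?_
    simp only [AEEqFun.zero_def, AEEqFun.mk_mul_mk]
    congr 1; funext x; simp

instance instAlgebraAEEqFun : Algebra ℂ (α →ₘ[μ] ℂ) :=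
  Algebra.ofModule
    (fun c f g => by
      refine AEEqFun.induction_on₂ f g fun f hf g hg => ?_
      simp only [AEEqFun.mk_mul_mk, AEEqFun.smul_mk, smul_mul_assoc])
    (fun c f g => by
      refine AEEqFun.induction_on₂ f g fun f hf g hg => ?_
      simp only [AEEqFun.mk_mul_mk, AEEqFun.smul_mk, mul_smul_comm])

instance instStarRingAEEqFun : StarRing (α →ₘ[μ] ℂ) where
  star_mul f g := by
    refine AEEqFun.ext ?_
    filter_upwards [AEEqFun.coeFn_star (f * g), AEEqFun.coeFn_mul f g,
      AEEqFun.coeFn_mul (star g) (star f), AEEqFun.coeFn_star f, AEEqFun.coeFn_star g]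
      with x h1 h2 h3 h4 h5
    simp_all [mul_comm]
  star_add f g := by
    refine AEEqFun.ext ?_
    filter_upwards [AEEqFun.coeFn_star (f + g), AEEqFun.coeFn_add f g,
      AEEqFun.coeFn_add (star f) (star g), AEEqFun.coeFn_star f, AEEqFun.coeFn_star g]
      with x h1 h2 h3 h4 h5
    simp_all

instance instStarModuleAEEqFun : StarModule ℂ (α →ₘ[μ] ℂ) where
  star_smul c f := by
    refine AEEqFun.ext ?_
    filter_upwards [AEEqFun.coeFn_star (c • f), AEEqFun.coeFn_smul c f,
      AEEqFun.coeFn_smul (star c) (star f), AEEqFun.coeFn_star f]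
      with x h1 h2 h3 h4
    simp_all

/-- The `*`-algebra `L^∞(μ)` of essentially bounded complex functions modulo null sets. -/
def LInf : StarSubalgebra ℂ (α →ₘ[μ] ℂ) where
  carrier := {f | ∃ C : ℝ, ∀ᵐ x ∂μ, ‖f x‖ ≤ C}
  mul_mem' := by
    rintro f g ⟨C, hC⟩ ⟨D, hD⟩
    refine ⟨C * D, ?_⟩
    filter_upwards [hC, hD, AEEqFun.coeFn_mul f g] with x h1 h2 h3
    rw [h3, Pi.mul_apply, norm_mul]
    exact mul_le_mul h1 h2 (norm_nonneg _) ((norm_nonneg _).trans h1)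
  add_mem' := by
    rintro f g ⟨C, hC⟩ ⟨D, hD⟩
    refine ⟨C + D, ?_⟩
    filter_upwards [hC, hD, AEEqFun.coeFn_add f g] with x h1 h2 h3
    rw [h3, Pi.add_apply]
    exact (norm_add_le _ _).trans (add_le_add h1 h2)
  algebraMap_mem' c := by
    refine ⟨‖c‖, ?_⟩
    rw [Algebra.algebraMap_eq_smul_one]
    filter_upwards [AEEqFun.coeFn_smul c (1 : α →ₘ[μ] ℂ), AEEqFun.coeFn_one (μ := μ) (β := ℂ)]
      with x h1 h2
    simp [h1, h2]
  star_mem' := by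
    rintro f ⟨C, hC⟩
    refine ⟨C, ?_⟩
    filter_upwards [hC, AEEqFun.coeFn_star f] with x h1 h2
    simpa [h2] using h1

end LInf

end FreeObata

end

open FreeObata

set_option linter.unusedSectionVars false

noncomputable section

namespace FreeObata

open FreeObata Filter Topology

variable {H : Type u} [NormedAddCommGroup H] [InnerProductSpace ℂ H]

/-! ### The coarse Hilbert space -/

/-! The argument is a free Bakry–Émery argument with resolvents in place of the heat semigroup.
Write S_i = (id ⊗ τ)∂_i. Lipschitz conjugate variables make S_i bounded on L²
(`norm_coSlice_sq_le`), and S_i + S_i* is right multiplication by ξ_i. Coassociativity of the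
difference quotients says that ∂̄_j intertwines S_i with 1 ⊗ S_i (`S_mem`), and S_i* with 1 ⊗ S_i*
up to a Jacobian term (`star_S_mem`). Since ∂_i*(a ⊗ b) is expressed through S_i, S_i* and J, these
relations give the Bochner formula ∂_i Δ = (Δ ⊗ 1 + 1 ⊗ Δ)∂_i + ∑_j 𝒥_ij ∂_j (`commutation`), where
the Jacobian acts through its copy `jacR` in the commutant.

The formula is proved for bounded elements of the domain, and there are enough of them: (1 + εΔ)⁻¹g
minimises ‖z - g‖² + ε‖∂̄z‖², and truncation by 1-Lipschitz functions does not increase this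
quantity, so resolvents of polynomials are bounded (`resolvent_isBdd_of_sa`) and form a core
(`bddIsCore`).

Put R = (1 + Δ)⁻¹ and V = ∂̄R. The Bochner formula, the positivity of Δ ⊗ 1 + 1 ⊗ Δ and CD(1,∞) give
2‖Vg‖² ≤ Re⟨∂̄g, Vg⟩ (`gradient_bound`). Hence each application of R divides the energy by at least
4 without increasing the deficit ‖∂̄g‖² - ‖g‖² (`deficit_decay`). The commutator identity u ⊗ 1 - 1
⊗ u = ∑ ∂̄_i u # (X_i ⊗ 1 - 1 ⊗ X_i) yields a Poincaré inequality with some constant, and iterating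
R improves the constant to 1 (`poincare`). For a saturating f every term dropped on the way
vanishes: Δf = f, the Jacobian fixes ∂̄f, and ∂̄_i f = c_i 1 ⊗ 1 (`exists_grad_eq`). Therefore f = ∑
c_i X_i° = ∑ c_i ξ_i (`exists_coeff`).

After normalising c and completing it to an orthogonal matrix, the sum T of the c_j S_j satisfies T
+ T* = right multiplication by Y₁, and T ρ(b) T* = τ(b) for ρ(b) right multiplication by a
polynomial b in the other Y_i (`dirSlice_rt_star`). Conjugating by J, Y₁ = ℓ + ℓ* with ℓ*ℓ = 1, ℓ*bℓ
= τ(b) and ℓ*bΩ = 0, the relations of a creation operator (`exists_isFreeCreation`). Chebyshev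
polynomials then give S_k(Y₁)Ω = ℓ^kΩ, hence the semicircular law, and alternating words move
between the range of ℓ and the kernel of ℓ*, hence freeness. The rest is general theory: freeness
passes to generated von Neumann algebras, free products are unique, and W*(Y₁) is L^∞ of the law of
Y₁. -/

/-- `a ↦ a ⊗ c` as a bounded operator. -/
def tensR (c : H) : H →L[ℂ] Coarse H :=
  (UniformSpace.Completion.toComplL (𝕜 := ℂ) (E := H ⊗[ℂ] H)).comp
    ((TensorProduct.mkL ℂ H H).flip c)

/-- `a ↦ c ⊗ a` as a bounded operator. -/
def tensL (c : H) : H →L[ℂ] Coarse H :=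
  (UniformSpace.Completion.toComplL (𝕜 := ℂ) (E := H ⊗[ℂ] H)).comp (TensorProduct.mkL ℂ H H c)

@[simp] theorem tensR_apply (a c : H) : tensR c a = tens a c := rfl
@[simp] theorem tensL_apply (a c : H) : tensL c a = tens c a := rfl

theorem inner_tens (a b c d : H) : ⟪tens a b, tens c d⟫_ℂ = ⟪a, c⟫_ℂ * ⟪b, d⟫_ℂ := by
  simp [tens]

theorem norm_tens (a b : H) : ‖tens a b‖ = ‖a‖ * ‖b‖ := by simp [tens]

theorem tens_add_left (a b c : H) : tens (a + b) c = tens a c + tens b c := map_add (tensR c) a b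
theorem tens_add_right (a b c : H) : tens a (b + c) = tens a b + tens a c := map_add (tensL a) b c
theorem tens_sub_left (a b c : H) : tens (a - b) c = tens a c - tens b c := map_sub (tensR c) a b
theorem tens_sub_right (a b c : H) : tens a (b - c) = tens a b - tens a c := map_sub (tensL a) b c
theorem tens_smul_left (r : ℂ) (a c : H) : tens (r • a) c = r • tens a c := map_smul (tensR c) r a
theorem tens_smul_right (r : ℂ) (a c : H) : tens a (r • c) = r • tens a c := map_smul (tensL a) r c
-- Finite sums of simple tensors are dense. Scalars need no case of their own, being absorbed into a
-- simple tensor, so linear and conjugate-linear statements are treated alike.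
theorem tens_closure_induction {P : Coarse H → Prop} (hc : IsClosed {x | P x})
    (h0 : ∀ a b, P (tens a b)) (hadd : ∀ x y, P x → P y → P (x + y)) (x : Coarse H) : P x := by
  refine UniformSpace.Completion.induction_on x hc fun y => ?_
  induction y using TensorProduct.induction_on with
  | zero => simpa [tens] using h0 0 0
  | tmul a b => exact h0 a b
  | add a b ha hb =>
    rw [UniformSpace.Completion.coe_add]
    exact hadd _ _ ha hb

theorem coarse_clm_ext {E : Type*} [NormedAddCommGroup E] [NormedSpace ℂ E] {σ : ℂ →+* ℂ}
    {S T : Coarse H →SL[σ] E}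
    (h : ∀ a b, S (tens a b) = T (tens a b)) : S = T := by
  ext x
  induction x using tens_closure_induction with
  | hc => exact isClosed_eq S.continuous T.continuous
  | h0 a b => exact h a b
  | hadd x y hx hy => simp [hx, hy]

theorem coarse_inner_ext {x y : Coarse H} (h : ∀ a b, ⟪tens a b, x⟫_ℂ = ⟪tens a b, y⟫_ℂ) :
    x = y := by
  refine ext_inner_left ℂ fun z => ?_
  induction z using tens_closure_induction with
  | hc => exact isClosed_eq (by fun_prop) (by fun_prop)
  | h0 a b => exact h a b
  | hadd x y hx hy => simp [inner_add_left, hx, hy]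

variable [CompleteSpace H]

@[simp] theorem opTens_tens (x y : H →L[ℂ] H) (a b : H) :
    opTens x y (tens a b) = tens (x a) (y b) := by
  simp [opTens, tens]

theorem opTens_mul (x y x' y' : H →L[ℂ] H) :
    opTens (x * x') (y * y') = opTens x y * opTens x' y' :=
  coarse_clm_ext fun a b => by simp

theorem opTens_one : opTens (1 : H →L[ℂ] H) 1 = 1 := coarse_clm_ext fun a b => by simp

theorem opTens_add_left (x x' y : H →L[ℂ] H) : opTens (x + x') y = opTens x y + opTens x' y :=
  coarse_clm_ext fun a b => by simp [tens_add_left]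
theorem opTens_add_right (x y y' : H →L[ℂ] H) : opTens x (y + y') = opTens x y + opTens x y' :=
  coarse_clm_ext fun a b => by simp [tens_add_right]
theorem opTens_sub_left (x x' y : H →L[ℂ] H) : opTens (x - x') y = opTens x y - opTens x' y :=
  coarse_clm_ext fun a b => by simp [tens_sub_left]
theorem opTens_smul_right (c : ℂ) (x y : H →L[ℂ] H) : opTens x (c • y) = c • opTens x y :=
  coarse_clm_ext fun a b => by simp [tens_smul_right]

theorem star_opTens (x y : H →L[ℂ] H) : star (opTens x y) = opTens (star x) (star y) := by
  refine coarse_clm_ext fun a b => coarse_inner_ext fun c d => ?_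
  rw [ContinuousLinearMap.star_eq_adjoint, ContinuousLinearMap.adjoint_inner_right]
  simp [inner_tens, ContinuousLinearMap.star_eq_adjoint, ContinuousLinearMap.adjoint_inner_right]

theorem inner_opTens_left (x y : H →L[ℂ] H) (ζ η : Coarse H) :
    ⟪opTens x y ζ, η⟫_ℂ = ⟪ζ, opTens (star x) (star y) η⟫_ℂ := by
  rw [← star_opTens, ContinuousLinearMap.star_eq_adjoint, ContinuousLinearMap.adjoint_inner_right]

theorem inner_opTens_right (x y : H →L[ℂ] H) (ζ η : Coarse H) :
    ⟪ζ, opTens x y η⟫_ℂ = ⟪opTens (star x) (star y) ζ, η⟫_ℂ := by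
  rw [inner_opTens_left, star_star, star_star]

/-- `a ⊗ b ↦ ⟨c, b⟩ a`. -/
def sliceR (c : H) : Coarse H →L[ℂ] H := (tensR c).adjoint
/-- `a ⊗ b ↦ ⟨c, a⟩ b`. -/
def sliceL (c : H) : Coarse H →L[ℂ] H := (tensL c).adjoint

theorem inner_sliceR (a c : H) (ζ : Coarse H) : ⟪a, sliceR c ζ⟫_ℂ = ⟪tens a c, ζ⟫_ℂ := by
  simp [sliceR, ContinuousLinearMap.adjoint_inner_right]
theorem inner_sliceL (a c : H) (ζ : Coarse H) : ⟪a, sliceL c ζ⟫_ℂ = ⟪tens c a, ζ⟫_ℂ := by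
  simp [sliceL, ContinuousLinearMap.adjoint_inner_right]
theorem sliceR_tens (a b c : H) : sliceR c (tens a b) = ⟪c, b⟫_ℂ • a :=
  ext_inner_left ℂ fun z => by rw [inner_sliceR, inner_tens, inner_smul_right, mul_comm]
theorem sliceL_tens (a b c : H) : sliceL c (tens a b) = ⟪c, a⟫_ℂ • b :=
  ext_inner_left ℂ fun z => by rw [inner_sliceL, inner_tens, inner_smul_right]
theorem sliceR_opTens (x y : H →L[ℂ] H) (c : H) (ζ : Coarse H) :
    sliceR c (opTens x y ζ) = x (sliceR (star y c) ζ) :=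
  ext_inner_left ℂ fun z => by
    rw [inner_sliceR, inner_opTens_right, opTens_tens, ← inner_sliceR,
      ContinuousLinearMap.star_eq_adjoint x, ContinuousLinearMap.adjoint_inner_left]
theorem sliceL_opTens (x y : H →L[ℂ] H) (c : H) (ζ : Coarse H) :
    sliceL c (opTens x y ζ) = y (sliceL (star x c) ζ) :=
  ext_inner_left ℂ fun z => by
    rw [inner_sliceL, inner_opTens_right, opTens_tens, ← inner_sliceL,
      ContinuousLinearMap.star_eq_adjoint y, ContinuousLinearMap.adjoint_inner_left]

/-! ### Antiunitary involutions -/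

/-- Polarisation: a conjugate-linear isometry exchanges the two terms carrying ±i, which is what
swaps the arguments. -/
theorem antiunitary_inner (J : H →ₗᵢ⋆[ℂ] H) (x y : H) : ⟪J x, J y⟫_ℂ = ⟪y, x⟫_ℂ := by
  have h : ∀ c : ℂ, c • J y = J ((starRingEnd ℂ c) • y) := fun c => by
    rw [map_smulₛₗ, Complex.conj_conj]
  rw [inner_eq_sum_norm_sq_div_four, inner_eq_sum_norm_sq_div_four, h]
  simp only [← map_add, ← map_sub, J.norm_map]
  simp only [RCLike.I_to_complex, Complex.conj_I, neg_smul, ← sub_eq_add_neg, sub_neg_eq_add]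
  have h1 : ‖x - Complex.I • y‖ = ‖y + Complex.I • x‖ := by
    rw [show y + Complex.I • x = Complex.I • (x - Complex.I • y) by
      simp [smul_sub, smul_smul]; abel, norm_smul]; simp
  have h2 : ‖x + Complex.I • y‖ = ‖y - Complex.I • x‖ := by
    rw [show y - Complex.I • x = (-Complex.I) • (x + Complex.I • y) by
      simp [smul_add, smul_smul]; abel, norm_smul]; simp
  rw [h1, h2, add_comm y x, norm_sub_rev y x]

/-- `J T J`. -/
def cj (J : H →ₗᵢ⋆[ℂ] H) (T : H →L[ℂ] H) : H →L[ℂ] H :=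
  J.toContinuousLinearMap.comp (T.comp J.toContinuousLinearMap)

@[simp] theorem cj_apply (J : H →ₗᵢ⋆[ℂ] H) (T : H →L[ℂ] H) (x : H) : cj J T x = J (T (J x)) := rfl

theorem cj_mul {J : H →ₗᵢ⋆[ℂ] H} (hJ : ∀ x, J (J x) = x) (S T : H →L[ℂ] H) :
    cj J (S * T) = cj J S * cj J T := by ext x; simp [hJ]
theorem cj_cj {J : H →ₗᵢ⋆[ℂ] H} (hJ : ∀ x, J (J x) = x) (S : H →L[ℂ] H) :
    cj J (cj J S) = S := by ext x; simp [hJ]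
theorem cj_one {J : H →ₗᵢ⋆[ℂ] H} (hJ : ∀ x, J (J x) = x) : cj J 1 = 1 := by ext x; simp [hJ]
theorem cj_add (J : H →ₗᵢ⋆[ℂ] H) (S T : H →L[ℂ] H) : cj J (S + T) = cj J S + cj J T := by
  ext x; simp
theorem cj_smul (J : H →ₗᵢ⋆[ℂ] H) (c : ℂ) (T : H →L[ℂ] H) :
    cj J (c • T) = (starRingEnd ℂ c) • cj J T := by
  ext x; simp [map_smulₛₗ]

theorem antiunitary_inner_left {J : H →ₗᵢ⋆[ℂ] H} (hJ : ∀ x, J (J x) = x) (x y : H) :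
    ⟪J x, y⟫_ℂ = ⟪J y, x⟫_ℂ := by rw [← antiunitary_inner J x (J y), hJ]
theorem antiunitary_inner_right {J : H →ₗᵢ⋆[ℂ] H} (hJ : ∀ x, J (J x) = x) (x y : H) :
    ⟪x, J y⟫_ℂ = ⟪y, J x⟫_ℂ := by rw [← antiunitary_inner J (J x) y, hJ]

theorem star_cj {J : H →ₗᵢ⋆[ℂ] H} (hJ : ∀ x, J (J x) = x) (T : H →L[ℂ] H) :
    star (cj J T) = cj J (star T) := by
  ext x
  refine ext_inner_left ℂ fun z => ?_
  rw [ContinuousLinearMap.star_eq_adjoint, ContinuousLinearMap.adjoint_inner_right]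
  simp only [cj_apply]
  rw [antiunitary_inner_left hJ, antiunitary_inner_right hJ, ContinuousLinearMap.star_eq_adjoint,
    ContinuousLinearMap.adjoint_inner_left]

theorem norm_cj_le (J : H →ₗᵢ⋆[ℂ] H) (T : H →L[ℂ] H) : ‖cj J T‖ ≤ ‖T‖ :=
  ContinuousLinearMap.opNorm_le_bound _ (norm_nonneg _) fun x => by
    simpa using T.le_opNorm (J x)

theorem norm_eq_of_inner_self_eq {E F : Type*} [NormedAddCommGroup E] [InnerProductSpace ℂ E]
    [NormedAddCommGroup F] [InnerProductSpace ℂ F] {x : E} {y : F}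
    (h : ⟪x, x⟫_ℂ = ⟪y, y⟫_ℂ) : ‖x‖ = ‖y‖ := by
  refine (sq_eq_sq₀ (norm_nonneg _) (norm_nonneg _)).1 ?_
  rw [norm_sq_eq_re_inner (𝕜 := ℂ) x, norm_sq_eq_re_inner (𝕜 := ℂ) y, h]

theorem inner_map_antiunitary (J : H →ₗᵢ⋆[ℂ] H) (x y : H ⊗[ℂ] H) :
    ⟪TensorProduct.map J.toLinearMap J.toLinearMap x,
      TensorProduct.map J.toLinearMap J.toLinearMap y⟫_ℂ = ⟪y, x⟫_ℂ := by
  induction x using TensorProduct.induction_on with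
  | zero => simp
  | add a b ha hb => simp [inner_add_left, inner_add_right, ha, hb]
  | tmul a b =>
    induction y using TensorProduct.induction_on with
    | zero => simp
    | add a b ha hb => rw [map_add, inner_add_right, inner_add_left, ha, hb]
    | tmul c d => simp [antiunitary_inner]

/-- The antiunitary `a ⊗ b ↦ J a ⊗ J b`. -/
def tensConj (J : H →ₗᵢ⋆[ℂ] H) : Coarse H →L⋆[ℂ] Coarse H :=
  ((TensorProduct.map J.toLinearMap J.toLinearMap).mkContinuous 1 fun x => by
    have h := inner_map_antiunitary J x x
    rw [one_mul]
    exact le_of_eq (norm_eq_of_inner_self_eq h)).completion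

@[simp] theorem tensConj_tens (J : H →ₗᵢ⋆[ℂ] H) (a b : H) :
    tensConj J (tens a b) = tens (J a) (J b) := by simp [tensConj, tens]

/-- The flip `a ⊗ b ↦ b ⊗ a`. -/
def flip : Coarse H →L[ℂ] Coarse H :=
  (TensorProduct.commIsometry ℂ H H).toLinearIsometry.toContinuousLinearMap.completion

@[simp] theorem flip_tens (a b : H) : flip (tens a b) = tens b a := by simp [flip, tens]

theorem inner_flip_flip (x y : Coarse H) : ⟪flip x, flip y⟫_ℂ = ⟪x, y⟫_ℂ := by
  induction x using tens_closure_induction with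
  | hc => exact isClosed_eq (by fun_prop) (by fun_prop)
  | hadd x y hx hy => simp [inner_add_left, hx, hy]
  | h0 a b =>
    induction y using tens_closure_induction with
    | hc => exact isClosed_eq (by fun_prop) (by fun_prop)
    | hadd x y hx hy => rw [map_add, inner_add_right, inner_add_right, hx, hy]
    | h0 c d => simp [inner_tens, mul_comm]

theorem inner_tensConj (J : H →ₗᵢ⋆[ℂ] H) (x y : Coarse H) :
    ⟪tensConj J x, tensConj J y⟫_ℂ = ⟪y, x⟫_ℂ := by
  induction x using tens_closure_induction with
  | hc => exact isClosed_eq (by fun_prop) (by fun_prop)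
  | hadd x y hx hy => simp [inner_add_left, inner_add_right, hx, hy]
  | h0 a b =>
    induction y using tens_closure_induction with
    | hc => exact isClosed_eq (by fun_prop) (by fun_prop)
    | hadd x y hx hy => rw [map_add, inner_add_right, inner_add_left, hx, hy]
    | h0 c d => simp [inner_tens, antiunitary_inner]

theorem tensConj_tensConj {J : H →ₗᵢ⋆[ℂ] H} (hJ : ∀ x, J (J x) = x) (x : Coarse H) :
    tensConj J (tensConj J x) = x := by
  induction x using tens_closure_induction with
  | hc => exact isClosed_eq (by fun_prop) (by fun_prop)
  | hadd x y hx hy => simp [hx, hy]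
  | h0 a b => simp [hJ]

theorem norm_tensConj (J : H →ₗᵢ⋆[ℂ] H) (x : Coarse H) : ‖tensConj J x‖ = ‖x‖ := by
  have h := inner_tensConj J x x
  rw [inner_self_eq_norm_sq_to_K, inner_self_eq_norm_sq_to_K] at h
  exact (sq_eq_sq₀ (norm_nonneg _) (norm_nonneg _)).1 (by exact_mod_cast h)

/-- The antiunitary `a ⊗ b ↦ J b ⊗ J a`. -/
def tensStar (J : H →ₗᵢ⋆[ℂ] H) : Coarse H →L⋆[ℂ] Coarse H := flip.comp (tensConj J)

@[simp] theorem tensStar_tens (J : H →ₗᵢ⋆[ℂ] H) (a b : H) :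
    tensStar J (tens a b) = tens (J b) (J a) := by simp [tensStar]

theorem inner_tensStar (J : H →ₗᵢ⋆[ℂ] H) (x y : Coarse H) :
    ⟪tensStar J x, tensStar J y⟫_ℂ = ⟪y, x⟫_ℂ := by
  simp [tensStar, inner_flip_flip, inner_tensConj]

theorem tensStar_tensStar {J : H →ₗᵢ⋆[ℂ] H} (hJ : ∀ x, J (J x) = x) (x : Coarse H) :
    tensStar J (tensStar J x) = x := by
  induction x using tens_closure_induction with
  | hc => exact isClosed_eq (by fun_prop) (by fun_prop)
  | hadd x y hx hy => simp [hx, hy]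
  | h0 a b => simp [hJ]

theorem norm_tensStar (J : H →ₗᵢ⋆[ℂ] H) (x : Coarse H) : ‖tensStar J x‖ = ‖x‖ := by
  have h := inner_tensStar J x x
  rw [inner_self_eq_norm_sq_to_K, inner_self_eq_norm_sq_to_K] at h
  exact (sq_eq_sq₀ (norm_nonneg _) (norm_nonneg _)).1 (by exact_mod_cast h)

theorem tensStar_opTens {J : H →ₗᵢ⋆[ℂ] H} (hJ : ∀ x, J (J x) = x) (x y : H →L[ℂ] H)
    (ζ : Coarse H) : tensStar J (opTens x y ζ) = opTens (cj J y) (cj J x) (tensStar J ζ) := by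
  induction ζ using tens_closure_induction with
  | hc => exact isClosed_eq (by fun_prop) (by fun_prop)
  | hadd x y hx hy => simp [hx, hy]
  | h0 a b => simp [hJ]

theorem tensConj_opTens {J : H →ₗᵢ⋆[ℂ] H} (hJ : ∀ x, J (J x) = x) (x y : H →L[ℂ] H)
    (ζ : Coarse H) : tensConj J (opTens x y ζ) = opTens (cj J x) (cj J y) (tensConj J ζ) := by
  induction ζ using tens_closure_induction with
  | hc => exact isClosed_eq (by fun_prop) (by fun_prop)
  | hadd x y hx hy => simp [hx, hy]
  | h0 a b => simp [hJ]

/-- The flip turns the first leg into the second, so that formulas for one kind of slice yield those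
for the other. -/
theorem sliceL_eq {J : H →ₗᵢ⋆[ℂ] H} (hJ : ∀ x, J (J x) = x) (a : H) (ζ : Coarse H) :
    sliceL a ζ = J (sliceR (J a) (tensStar J ζ)) := by
  induction ζ using tens_closure_induction with
  | hc => exact isClosed_eq (by fun_prop) (by fun_prop)
  | hadd x y hx hy => simp [hx, hy]
  | h0 c d =>
    rw [sliceL_tens, tensStar_tens, sliceR_tens, antiunitary_inner,
      map_smulₛₗ, inner_conj_symm, hJ]

/-! ### Divided differences of polynomials -/

section DividedDifference
open Polynomial WeakDual

/-- The divided difference `(P(a) - P(b)) / (a - b)` at commuting elements. -/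
def ddiff {R A : Type*} [CommRing R] [Ring A] [Algebra R A] (P : R[X]) (a b : A) : A :=
  P.sum fun k c => c • ∑ l ∈ Finset.range k, a ^ l * b ^ (k - 1 - l)

theorem map_ddiff {R A B : Type*} [CommRing R] [Ring A] [Algebra R A] [Ring B] [Algebra R B]
    (f : A →ₐ[R] B) (P : R[X]) (a b : A) : f (ddiff P a b) = ddiff P (f a) (f b) := by
  simp [ddiff, Polynomial.sum, map_sum]

theorem ddiff_map_ofReal (φ : ℝ[X]) (s t : ℝ) :
    ddiff (φ.map (algebraMap ℝ ℂ)) (s : ℂ) (t : ℂ) = ((ddiff φ s t : ℝ) : ℂ) := by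
  rw [ddiff, ddiff, Polynomial.sum_over_range _ (by simp), Polynomial.sum_over_range _ (by simp),
    Polynomial.natDegree_map]
  push_cast
  simp

theorem mul_ddiff (φ : ℝ[X]) (s t : ℝ) : (s - t) * ddiff φ s t = φ.eval s - φ.eval t := by
  rw [ddiff, Polynomial.sum, Finset.mul_sum, Polynomial.eval_eq_sum, Polynomial.eval_eq_sum,
    Polynomial.sum, Polynomial.sum, ← Finset.sum_sub_distrib]
  refine Finset.sum_congr rfl fun k _ => ?_
  rw [smul_eq_mul, mul_left_comm, (Commute.all s t).mul_geom_sum₂]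
  ring

theorem ddiff_self (φ : ℝ[X]) (s : ℝ) : ddiff φ s s = φ.derivative.eval s := by
  rw [ddiff, Polynomial.derivative_eval]
  refine Finset.sum_congr rfl fun k _ => ?_
  simp only [smul_eq_mul]
  rw [Finset.sum_congr rfl (g := fun _ => s ^ (k - 1)), Finset.sum_const, Finset.card_range,
    nsmul_eq_mul, mul_assoc]
  intro l hl
  rw [← pow_add]
  congr 1
  have := Finset.mem_range.1 hl
  omega

theorem abs_ddiff_le {φ : ℝ[X]} {K : ℝ} (h : ∀ t, |t| ≤ K → |φ.derivative.eval t| ≤ 1)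
    {s t : ℝ} (hs : |s| ≤ K) (ht : |t| ≤ K) : |ddiff φ s t| ≤ 1 := by
  by_cases hst : s = t
  · rw [hst, ddiff_self]; exact h t ht
  have h1 : ‖φ.eval s - φ.eval t‖ ≤ 1 * ‖s - t‖ := by
    refine Convex.norm_image_sub_le_of_norm_deriv_le (f := fun x => φ.eval x) (s := Set.Icc (-K) K)
      (fun x _ => φ.differentiableAt) (fun x hx => ?_) (convex_Icc _ _) (abs_le.1 ht) (abs_le.1 hs)
    rw [Polynomial.deriv]
    exact h x (abs_le.2 hx)
  rw [← mul_ddiff, norm_mul, mul_comm] at h1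
  exact le_of_mul_le_mul_right h1 (norm_pos_iff.2 (sub_ne_zero.2 hst))

/-- The Gelfand transform is isometric, and a character sends `a` and `b` to real points of [-K, K],
where the mean value theorem bounds the divided difference. -/
theorem norm_ddiff_le_comm {A : Type*} [CommCStarAlgebra A] {φ : ℝ[X]} {K : ℝ}
    (h : ∀ t, |t| ≤ K → |φ.derivative.eval t| ≤ 1) {a b : A} (ha : IsSelfAdjoint a)
    (hb : IsSelfAdjoint b) (haK : ‖a‖ ≤ K) (hbK : ‖b‖ ≤ K) :
    ‖ddiff (φ.map (algebraMap ℝ ℂ)) a b‖ ≤ 1 := by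
  have hiso := (AddMonoidHomClass.isometry_iff_norm _).1 (gelfandTransform_isometry A)
  rw [← hiso, ContinuousMap.norm_le _ zero_le_one]
  intro χ
  have hreal : ∀ c : A, IsSelfAdjoint c → ‖c‖ ≤ K → ∃ r : ℝ, |r| ≤ K ∧ χ c = (r : ℂ) := by
    intro c hc hcK
    have h1 : IsSelfAdjoint (χ c) := hc.map χ
    refine ⟨(χ c).re, ?_, (Complex.conj_eq_iff_re.1 h1).symm⟩
    have h2 : ‖gelfandTransform ℂ A c χ‖ ≤ ‖gelfandTransform ℂ A c‖ :=
      ContinuousMap.norm_coe_le_norm _ _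
    rw [hiso] at h2
    exact (Complex.abs_re_le_norm _).trans (h2.trans hcK)
  obtain ⟨r, hr, hra⟩ := hreal a ha haK
  obtain ⟨s, hs, hsb⟩ := hreal b hb hbK
  have h3 : gelfandTransform ℂ A (ddiff (φ.map (algebraMap ℝ ℂ)) a b) χ =
      ddiff (φ.map (algebraMap ℝ ℂ)) (χ a) (χ b) :=
    map_ddiff (WeakDual.CharacterSpace.toAlgHom χ) _ a b
  rw [h3, hra, hsb, ddiff_map_ofReal, Complex.norm_real]
  exact abs_ddiff_le h hr hs

/-- Two commuting self-adjoint elements generate a commutative C*-algebra. The bound is applied to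
commuting left and right multiplications. -/
theorem norm_ddiff_le {A : Type*} [CStarAlgebra A] {φ : ℝ[X]} {K : ℝ}
    (h : ∀ t, |t| ≤ K → |φ.derivative.eval t| ≤ 1) {a b : A} (ha : IsSelfAdjoint a)
    (hb : IsSelfAdjoint b) (hab : a * b = b * a) (haK : ‖a‖ ≤ K) (hbK : ‖b‖ ≤ K) :
    ‖ddiff (φ.map (algebraMap ℝ ℂ)) a b‖ ≤ 1 := by
  have hcomm : ∀ x ∈ ({a, b} : Set A), ∀ y ∈ ({a, b} : Set A), x * y = y * x := by
    rintro x (rfl | rfl) y (rfl | rfl) <;> first | rfl | exact hab | exact hab.symm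
  have hcs : ∀ x ∈ ({a, b} : Set A), ∀ y ∈ ({a, b} : Set A), x * star y = star y * x := by
    rintro x hx y (rfl | rfl)
    · rw [ha.star_eq]; exact hcomm _ hx _ (by simp)
    · rw [hb.star_eq]; exact hcomm _ hx _ (by simp)
  let c1 := StarAlgebra.adjoinCommRingOfComm ℂ hcomm hcs
  let S := (StarAlgebra.adjoin ℂ ({a, b} : Set A)).topologicalClosure
  let c2 : CommRing S := StarSubalgebra.commRingTopologicalClosure _ fun x y => mul_comm x y
  let c3 : CStarAlgebra S :=
    StarSubalgebra.cstarAlgebra S (h_closed := StarSubalgebra.isClosed_topologicalClosure _)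
  let c4 : CommCStarAlgebra S := { c3 with mul_comm := c2.mul_comm }
  have hsub := StarSubalgebra.le_topologicalClosure (StarAlgebra.adjoin ℂ ({a, b} : Set A))
  let a' : S := ⟨a, hsub (StarAlgebra.subset_adjoin ℂ _ (by simp))⟩
  let b' : S := ⟨b, hsub (StarAlgebra.subset_adjoin ℂ _ (by simp))⟩
  have key := norm_ddiff_le_comm h (a := a') (b := b') (Subtype.ext ha) (Subtype.ext hb) haK hbK
  have h2 := map_ddiff S.subtype.toAlgHom (φ.map (algebraMap ℝ ℂ)) a' b'
  change _ = ddiff _ a b at h2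
  rw [← h2]
  exact key

theorem exists_antiderivative (ψ : ℝ[X]) : ∃ φ : ℝ[X], φ.derivative = ψ ∧ φ.eval 0 = 0 := by
  induction ψ using Polynomial.induction_on' with
  | add p q hp hq =>
    obtain ⟨a, ha, ha'⟩ := hp
    obtain ⟨b, hb, hb'⟩ := hq
    exact ⟨a + b, by simp [ha, hb], by simp [ha', hb']⟩
  | monomial k c =>
    refine ⟨monomial (k + 1) (c / (k + 1)), ?_, by simp⟩
    rw [derivative_monomial]
    congr 1
    push_cast
    field_simp

/-- A polynomial stand-in for the truncation of ℝ to [-C, C]: being a polynomial it can be applied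
inside the free algebra, and its bound C + 2 does not depend on K. It is the antiderivative of a
Weierstrass approximation of a cutoff function. -/
theorem exists_truncation_polynomial {C K δ : ℝ} (hC : 0 ≤ C) (hδ : 0 < δ) :
    ∃ φ : ℝ[X], (∀ t, |t| ≤ K → |φ.derivative.eval t| ≤ 1) ∧
      (∀ t, |t| ≤ K → |φ.eval t| ≤ C + 2) ∧ (∀ t, |t| ≤ K → |t| ≤ C → |φ.eval t - t| ≤ δ) := by
  wlog hK : C + 1 ≤ K generalizing K
  · obtain ⟨φ, h1, h2, h3⟩ := this le_rfl
    have : K ≤ C + 1 := (not_le.1 hK).le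
    exact ⟨φ, fun t ht => h1 t (ht.trans this), fun t ht => h2 t (ht.trans this),
      fun t ht => h3 t (ht.trans this)⟩
  have hK0 : 0 < K := by linarith
  -- Beyond C + 1 an error η in the derivative integrates to at most ηK ≤ 1, whence C + 2; on |t| ≤
  -- C the derivative is within 2η of 1, whence the last condition.
  obtain ⟨η, hη0, hη1, hη2, hη3⟩ : ∃ η : ℝ, 0 < η ∧ η ≤ 1 / 2 ∧ η * K ≤ 1 ∧ 2 * η * C ≤ δ := by
    refine ⟨min (1 / 2) (min (1 / K) (δ / (2 * (C + 1)))), by positivity, min_le_left _ _, ?_, ?_⟩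
    · have : min (1 / 2) (min (1 / K) (δ / (2 * (C + 1)))) ≤ 1 / K :=
        (min_le_right _ _).trans (min_le_left _ _)
      rwa [le_div_iff₀ hK0] at this
    · have h : min (1 / 2) (min (1 / K) (δ / (2 * (C + 1)))) ≤ δ / (2 * (C + 1)) :=
        (min_le_right _ _).trans (min_le_right _ _)
      rw [le_div_iff₀ (by positivity)] at h
      have h0 : 0 ≤ min (1 / 2) (min (1 / K) (δ / (2 * (C + 1)))) := by positivity
      nlinarith
  -- The factor 1 - η leaves room for the approximation error, so that the derivative stays in [-1,
  -- 1].
  let ψ₀ : ℝ → ℝ := fun t => (1 - η) * max 0 (min 1 (C + 1 - |t|))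
  obtain ⟨ψ, hψ⟩ := exists_polynomial_near_of_continuousOn (-K) K ψ₀
    (by fun_prop) η hη0
  obtain ⟨φ, hφ, hφ0⟩ := exists_antiderivative ψ
  have hb : ∀ t, |t| ≤ K → |φ.derivative.eval t| ≤ 1 := by
    intro t ht
    rw [hφ]
    have h1 := abs_lt.1 (hψ t (abs_le.1 ht))
    have h2 : 0 ≤ max 0 (min 1 (C + 1 - |t|)) := le_max_left _ _
    have h3 : max 0 (min 1 (C + 1 - |t|)) ≤ 1 := max_le zero_le_one (min_le_left _ _)
    have h4 : 0 ≤ ψ₀ t := mul_nonneg (by linarith) h2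
    have h5 : ψ₀ t ≤ 1 - η := mul_le_of_le_one_right (by linarith) h3
    rw [abs_le]; constructor <;> linarith [h1.1, h1.2]
  have hmvt : ∀ (q : ℝ[X]) (c : ℝ) (s t : ℝ), (∀ x ∈ Set.uIcc s t, |q.derivative.eval x| ≤ c) →
      |q.eval t - q.eval s| ≤ c * |t - s| := by
    intro q c s t hq
    refine Convex.norm_image_sub_le_of_norm_deriv_le (f := fun x => q.eval x) (s := Set.uIcc s t)
      (fun x _ => q.differentiableAt) (fun x hx => ?_) (convex_uIcc _ _) Set.left_mem_uIcc
      Set.right_mem_uIcc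
    rw [Polynomial.deriv]
    exact hq x hx
  have habs : ∀ t x : ℝ, x ∈ Set.uIcc 0 t → |x| ≤ |t| := by
    intro t x hx
    have := Set.abs_sub_left_of_mem_uIcc hx
    simpa using this
  have hmid : ∀ t, |t| ≤ C + 1 → |φ.eval t| ≤ C + 1 := by
    intro t ht
    have := hmvt φ 1 0 t fun x hx => hb x ((habs t x hx).trans (ht.trans hK))
    rw [hφ0] at this
    simp only [sub_zero, one_mul] at this
    exact this.trans ht
  have hout : ∀ s t : ℝ, |s| = C + 1 → |t| ≤ K → (∀ x ∈ Set.uIcc s t, C + 1 ≤ |x| ∧ |x| ≤ K) →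
      |t - s| ≤ K → |φ.eval t| ≤ C + 2 := by
    intro s t hs ht hx hts
    have h1 := hmvt φ η s t fun x hx' => by
      obtain ⟨h2, h3⟩ := hx x hx'
      have h4 : ψ₀ x = 0 := by
        simp only [ψ₀]
        rw [min_eq_right (by linarith), max_eq_left (by linarith), mul_zero]
      have h5 := hψ x (abs_le.1 h3)
      rw [h4, sub_zero] at h5
      rw [hφ]; exact h5.le
    have h2 := hmid s hs.le
    have h3 : |φ.eval t| ≤ |φ.eval t - φ.eval s| + |φ.eval s| := by
      simpa using abs_add_le (φ.eval t - φ.eval s) (φ.eval s)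
    nlinarith [abs_nonneg (t - s)]
  refine ⟨φ, hb, fun t ht => ?_, fun t htK ht => ?_⟩
  · by_cases h : |t| ≤ C + 1
    · linarith [hmid t h]
    · push Not at h
      rcases le_total 0 t with h0 | h0
      · rw [abs_of_nonneg h0] at h ht
        refine hout (C + 1) t (abs_of_nonneg (by linarith)) (by rwa [abs_of_nonneg h0])
          (fun x hx => ?_) (by rw [abs_le]; constructor <;> linarith)
        rw [Set.uIcc_of_le h.le] at hx
        rw [abs_of_nonneg (by linarith [hx.1])]
        exact ⟨hx.1, hx.2.trans ht⟩
      · rw [abs_of_nonpos h0] at h ht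
        refine hout (-(C + 1)) t (by rw [abs_neg]; exact abs_of_nonneg (by linarith))
          (by rwa [abs_of_nonpos h0])
          (fun x hx => ?_) (by rw [abs_le]; constructor <;> linarith)
        rw [Set.uIcc_of_ge (by linarith)] at hx
        rw [abs_of_nonpos (by linarith [hx.2])]
        exact ⟨by linarith [hx.2], by linarith [hx.1]⟩
  · have h1 := hmvt (φ - X) (2 * η) 0 t fun x hx => by
      have h2 := (habs t x hx).trans ht
      have h3 := hψ x (abs_le.1 ((habs t x hx).trans htK))
      have h4 : ψ₀ x = 1 - η := by
        simp only [ψ₀]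
        rw [min_eq_left (by linarith), max_eq_right zero_le_one, mul_one]
      rw [h4] at h3
      have h5 := abs_lt.1 h3
      rw [derivative_sub, derivative_X, hφ, eval_sub, eval_one, abs_le]
      constructor <;> linarith [h5.1, h5.2]
    simp only [eval_sub, eval_X, hφ0, sub_zero] at h1
    have : 2 * η * |t| ≤ 2 * η * C := by gcongr
    linarith

end DividedDifference

/-! ### Weak limits -/

section WeakLimits

variable {E : Type*} [NormedAddCommGroup E] [InnerProductSpace ℂ E]

theorem exists_tendsto_ultrafilter (𝒰 : Ultrafilter ℕ) {c : ℕ → ℂ} {C : ℝ} (hc : ∀ m, ‖c m‖ ≤ C) :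
    ∃ z, Tendsto c 𝒰 (𝓝 z) := by
  have h := (isCompact_closedBall (0 : ℂ) C).ultrafilter_le_nhds (𝒰.map c) (by
    rw [le_principal_iff]
    change ∀ᶠ m in (𝒰 : Filter ℕ), c m ∈ Metric.closedBall 0 C
    exact Filter.Eventually.of_forall fun m => by simpa using hc m)
  obtain ⟨z, -, hz⟩ := h
  exact ⟨z, hz⟩

/-- Along an ultrafilter the limits exist for all test vectors at once, and one ultrafilter can
serve several sequences. The limit vector comes from the Riesz representation. -/
theorem exists_weak_limit [CompleteSpace E] (𝒰 : Ultrafilter ℕ) {x : ℕ → E} {C : ℝ}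
    (hx : ∀ m, ‖x m‖ ≤ C) :
    ∃ y : E, ∀ z, Tendsto (fun m => ⟪z, x m⟫_ℂ) 𝒰 (𝓝 ⟪z, y⟫_ℂ) := by
  have hlim : ∀ z, ∃ c, Tendsto (fun m => ⟪x m, z⟫_ℂ) 𝒰 (𝓝 c) := fun z =>
    exists_tendsto_ultrafilter 𝒰 (C := C * ‖z‖) fun m =>
      (norm_inner_le_norm _ _).trans (by gcongr; exact hx m)
  choose L hL using hlim
  let Λ : E →ₗ[ℂ] ℂ :=
    { toFun := L
      map_add' := fun a b => tendsto_nhds_unique (hL (a + b)) (by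
        simpa only [inner_add_right] using (hL a).add (hL b))
      map_smul' := fun r a => tendsto_nhds_unique (hL (r • a)) (by
        simpa only [inner_smul_right, RingHom.id_apply, smul_eq_mul] using (hL a).const_mul r) }
  let Λ' : E →L[ℂ] ℂ := Λ.mkContinuous C fun z =>
    le_of_tendsto (hL z).norm (Eventually.of_forall fun m =>
      (norm_inner_le_norm _ _).trans (by gcongr; exact hx m))
  refine ⟨(InnerProductSpace.toDual ℂ E).symm Λ', fun z => ?_⟩
  have h1 : ⟪(InnerProductSpace.toDual ℂ E).symm Λ', z⟫_ℂ = L z :=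
    InnerProductSpace.toDual_symm_apply
  have h2 := (Complex.continuous_conj.tendsto (L z)).comp (hL z)
  rw [← inner_conj_symm z, h1]
  simpa [Function.comp_def, inner_conj_symm] using h2

theorem norm_le_of_weak_limit {l : Filter ℕ} [NeBot l] {x : ℕ → E} {y : E}
    (h : ∀ z, Tendsto (fun m => ⟪z, x m⟫_ℂ) l (𝓝 ⟪z, y⟫_ℂ)) {c : ℕ → ℝ} {C : ℝ}
    (hc : Tendsto c l (𝓝 C)) (hx : ∀ m, ‖x m‖ ≤ c m) : ‖y‖ ≤ C := by
  have h1 : ‖⟪y, y⟫_ℂ‖ ≤ ‖y‖ * C :=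
    le_of_tendsto_of_tendsto' (h y).norm (hc.const_mul _) fun m =>
      (norm_inner_le_norm _ _).trans (by gcongr; exact hx m)
  rw [inner_self_eq_norm_sq_to_K, norm_pow, sq] at h1
  simp only [Complex.coe_algebraMap, Complex.norm_real, norm_norm] at h1
  rcases eq_or_lt_of_le (norm_nonneg y) with h0 | h0
  · rw [← h0]
    exact ge_of_tendsto' hc fun m => (norm_nonneg _).trans (hx m)
  · exact le_of_mul_le_mul_left h1 h0

theorem mem_of_weak_limit [CompleteSpace E] {l : Filter ℕ} [NeBot l] {W : Submodule ℂ E}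
    (hW : IsClosed (W : Set E)) {x : ℕ → E} {y : E}
    (h : ∀ z, Tendsto (fun m => ⟪z, x m⟫_ℂ) l (𝓝 ⟪z, y⟫_ℂ)) (hx : ∀ m, x m ∈ W) : y ∈ W := by
  have : CompleteSpace W := hW.completeSpace_coe
  rw [← W.orthogonal_orthogonal, Submodule.mem_orthogonal]
  intro z hz
  have h1 : ∀ m, ⟪z, x m⟫_ℂ = 0 := fun m => by
    rw [← inner_conj_symm, (Submodule.mem_orthogonal _ _).1 hz (x m) (hx m), map_zero]
  have h2 := h z
  simp only [h1] at h2
  exact (tendsto_nhds_unique h2 tendsto_const_nhds)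

/-- Closed graphs are weakly closed; the product is replaced by the Hilbert direct sum, where double
orthogonals are available. -/
theorem mem_prod_of_weak_limit {F : Type*} [NormedAddCommGroup F] [InnerProductSpace ℂ F]
    [CompleteSpace E] [CompleteSpace F] {l : Filter ℕ} [NeBot l] {W : Submodule ℂ (E × F)}
    (hW : IsClosed (W : Set (E × F))) {x : ℕ → E} {x' : ℕ → F} {y : E} {y' : F}
    (h : ∀ z, Tendsto (fun m => ⟪z, x m⟫_ℂ) l (𝓝 ⟪z, y⟫_ℂ))
    (h' : ∀ z, Tendsto (fun m => ⟪z, x' m⟫_ℂ) l (𝓝 ⟪z, y'⟫_ℂ))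
    (hx : ∀ m, (x m, x' m) ∈ W) : (y, y') ∈ W := by
  let e := WithLp.prodContinuousLinearEquiv 2 ℂ E F
  have := mem_of_weak_limit (l := l) (W := W.comap (e : WithLp 2 (E × F) →ₗ[ℂ] E × F))
    (hW.preimage e.continuous) (x := fun m => e.symm (x m, x' m)) (y := e.symm (y, y')) ?_
    (fun m => by simpa using hx m)
  · simpa using this
  · intro z
    simp only [WithLp.prod_inner_apply]
    exact (h _).add (h' _)

theorem exists_weak_operator_limit {E : Type*} [NormedAddCommGroup E] [InnerProductSpace ℂ E]
    [CompleteSpace E] (𝒰 : Ultrafilter ℕ) {x : ℕ → E →L[ℂ] E} {C : ℝ} (hx : ∀ m, ‖x m‖ ≤ C) :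
    ∃ y : E →L[ℂ] E, ∀ z v, Tendsto (fun m => ⟪z, x m v⟫_ℂ) 𝒰 (𝓝 ⟪z, y v⟫_ℂ) := by
  have h1 : ∀ v m, ‖x m v‖ ≤ C * ‖v‖ := fun v m => (x m).le_of_opNorm_le (hx m) v
  choose y hy using fun v => exists_weak_limit 𝒰 (h1 v)
  let Y : E →ₗ[ℂ] E :=
    { toFun := y
      map_add' := fun a b => ext_inner_left ℂ fun z => tendsto_nhds_unique (hy (a + b) z) (by
        simpa only [map_add, inner_add_right] using (hy a z).add (hy b z))
      map_smul' := fun r a => ext_inner_left ℂ fun z => tendsto_nhds_unique (hy (r • a) z) (by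
        simpa only [map_smul, inner_smul_right, RingHom.id_apply] using (hy a z).const_mul r) }
  exact ⟨Y.mkContinuous C fun v => norm_le_of_weak_limit (hy v) tendsto_const_nhds (h1 v),
    fun z v => hy v z⟩

end WeakLimits

/-! ### Generated von Neumann algebras -/

section VN

variable {H : Type u} [NormedAddCommGroup H] [InnerProductSpace ℂ H] [CompleteSpace H]

theorem mem_wStar_iff {S : Set (H →L[ℂ] H)} {x : H →L[ℂ] H} :
    x ∈ wStar S ↔ ∀ T, (∀ s ∈ S, s * T = T * s) → (∀ s ∈ S, star s * T = T * star s) →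
      T * x = x * T := by
  have h : x ∈ wStar S ↔ x ∈ StarSubalgebra.centralizer ℂ
    (StarSubalgebra.centralizer ℂ S : Set (H →L[ℂ] H)) := Iff.rfl
  rw [h, StarSubalgebra.mem_centralizer_iff]
  constructor
  · intro hx T h1 h2
    exact (hx T ((StarSubalgebra.mem_centralizer_iff ℂ).2 fun s hs => ⟨h1 s hs, h2 s hs⟩)).1
  · intro hx T hT
    have hT' := (StarSubalgebra.mem_centralizer_iff ℂ).1 hT
    have hT'' := (StarSubalgebra.mem_centralizer_iff ℂ).1 (star_mem hT)
    exact ⟨hx T (fun s hs => (hT' s hs).1) fun s hs => (hT' s hs).2,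
      hx (star T) (fun s hs => (hT'' s hs).1) fun s hs => (hT'' s hs).2⟩

theorem subset_wStar (S : Set (H →L[ℂ] H)) : S ⊆ wStar S := fun s hs =>
  mem_wStar_iff.2 fun _ h1 _ => (h1 s hs).symm

theorem vn_mem_iff (M : VonNeumannAlgebra H) (x : H →L[ℂ] H) :
    x ∈ M ↔ ∀ T ∈ M.commutant, T * x = x * T := by
  conv_lhs => rw [← VonNeumannAlgebra.commutant_commutant M]
  rw [VonNeumannAlgebra.mem_commutant_iff]

theorem wStar_le {S : Set (H →L[ℂ] H)} {M : VonNeumannAlgebra H} (h : S ⊆ M) : wStar S ≤ M := by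
  intro x hx
  rw [vn_mem_iff]
  intro T hT
  rw [VonNeumannAlgebra.mem_commutant_iff] at hT
  exact mem_wStar_iff.1 hx T (fun s hs => hT s (h hs)) fun s hs => hT _ (star_mem (h hs))

theorem wStar_mono {S T : Set (H →L[ℂ] H)} (h : S ⊆ T) : wStar S ≤ wStar T :=
  wStar_le (h.trans (subset_wStar T))

theorem vn_mem_of_weak_limit {l : Filter ℕ} [NeBot l] {M : VonNeumannAlgebra H}
    {x : ℕ → H →L[ℂ] H} {y : H →L[ℂ] H}
    (h : ∀ z v, Tendsto (fun m => ⟪z, x m v⟫_ℂ) l (𝓝 ⟪z, y v⟫_ℂ)) (hx : ∀ m, x m ∈ M) : y ∈ M := by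
  rw [vn_mem_iff]
  intro T hT
  ext v
  refine ext_inner_left ℂ fun z => ?_
  have h1 := h (star T z) v
  have h2 := h z (T v)
  have h3 : ∀ m, ⟪star T z, x m v⟫_ℂ = ⟪z, x m (T v)⟫_ℂ := fun m => by
    rw [ContinuousLinearMap.star_eq_adjoint, ContinuousLinearMap.adjoint_inner_left]
    exact congrArg (fun A : H →L[ℂ] H => ⟪z, A v⟫_ℂ) ((vn_mem_iff M _).1 (hx m) T hT)
  simp only [h3] at h1
  have h4 := tendsto_nhds_unique h1 h2
  rw [ContinuousLinearMap.star_eq_adjoint, ContinuousLinearMap.adjoint_inner_left] at h4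
  exact h4

/-- The projection onto a subspace reducing `S` commutes with `S` and `S*`, hence with the double
commutant. All approximations of elements of W*(S) below, one vector at a time, rest on this. -/
theorem wStar_apply_mem {S : Set (H →L[ℂ] H)} {W : Submodule ℂ H} (hW : IsClosed (W : Set H))
    (h1 : ∀ s ∈ S, ∀ v ∈ W, s v ∈ W) (h2 : ∀ s ∈ S, ∀ v ∈ W, (star s) v ∈ W)
    {x : H →L[ℂ] H} (hx : x ∈ wStar S) {v : H} (hv : v ∈ W) : x v ∈ W := by
  have : CompleteSpace W := hW.completeSpace_coe
  have hcomm : ∀ s : H →L[ℂ] H, (∀ v ∈ W, s v ∈ W) → (∀ v ∈ W, (star s) v ∈ W) →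
      s * W.starProjection = W.starProjection * s := by
    intro s hs hs'
    ext z
    have h3 : s (W.starProjection z) ∈ W := hs _ (by simp)
    have h4 : s (z - W.starProjection z) ∈ Wᗮ := by
      rw [Submodule.mem_orthogonal]
      intro w hw
      rw [← ContinuousLinearMap.adjoint_inner_left, ← ContinuousLinearMap.star_eq_adjoint]
      exact (Submodule.mem_orthogonal _ _).1 (Submodule.sub_starProjection_mem_orthogonal z) _
        (hs' w hw)
    have h5 : s z = s (W.starProjection z) + s (z - W.starProjection z) := by
      rw [← map_add]; simp
    change s (W.starProjection z) = W.starProjection (s z)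
    rw [h5, map_add, Submodule.starProjection_eq_self_iff.2 h3,
      (Submodule.starProjection_apply_eq_zero_iff W).2 h4, add_zero]
  have h6 := mem_wStar_iff.1 hx W.starProjection (fun s hs => hcomm s (h1 s hs) (h2 s hs))
    (fun s hs => hcomm (star s) (h2 s hs) (by simpa using h1 s hs))
  have h7 := congrArg (fun A : H →L[ℂ] H => A v) h6
  change W.starProjection (x v) = x (W.starProjection v) at h7
  rw [Submodule.starProjection_eq_self_iff.2 hv] at h7
  exact Submodule.starProjection_eq_self_iff.1 h7

end VN

/-! ### The modular conjugation and right multiplications -/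

section StandardForm

variable {H : Type u} [NormedAddCommGroup H] [InnerProductSpace ℂ H] [CompleteSpace H]

/-- A tracial von Neumann algebra in standard form, with its conjugation `J`. -/
structure IsStandardFormWith (M : VonNeumannAlgebra H) (Ω : H) (J : H →ₗᵢ⋆[ℂ] H) : Prop
    extends IsStandardForm M Ω where
  J_apply : ∀ x ∈ M, J (x Ω) = (star x) Ω

/-- Right multiplication by `y`. -/
def rt (J : H →ₗᵢ⋆[ℂ] H) (y : H →L[ℂ] H) : H →L[ℂ] H := cj J (star y)

theorem rt_apply (J : H →ₗᵢ⋆[ℂ] H) (y : H →L[ℂ] H) (v : H) : rt J y v = J (star y (J v)) := rfl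

variable {M : VonNeumannAlgebra H} {Ω : H} {J : H →ₗᵢ⋆[ℂ] H}

theorem vn_one_mem (M : VonNeumannAlgebra H) : (1 : H →L[ℂ] H) ∈ M :=
  one_mem M.toStarSubalgebra
theorem vn_mul_mem {x y : H →L[ℂ] H} (hx : x ∈ M) (hy : y ∈ M) : x * y ∈ M :=
  mul_mem (s := M.toStarSubalgebra) hx hy
theorem vn_add_mem {x y : H →L[ℂ] H} (hx : x ∈ M) (hy : y ∈ M) : x + y ∈ M :=
  add_mem (s := M.toStarSubalgebra) hx hy
theorem vn_sub_mem {x y : H →L[ℂ] H} (hx : x ∈ M) (hy : y ∈ M) : x - y ∈ M :=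
  M.toStarSubalgebra.toSubalgebra.sub_mem hx hy
theorem vn_star_mem {x : H →L[ℂ] H} (hx : x ∈ M) : star x ∈ M :=
  star_mem (s := M.toStarSubalgebra) hx
theorem vn_smul_mem (c : ℂ) {x : H →L[ℂ] H} (hx : x ∈ M) : c • x ∈ M :=
  M.toStarSubalgebra.smul_mem hx c

namespace IsStandardFormWith

variable (h : IsStandardFormWith M Ω J)
include h

theorem ext_clm {E : Type*} [NormedAddCommGroup E] [NormedSpace ℂ E] {σ : ℂ →+* ℂ}
    {S T : H →SL[σ] E} (hST : ∀ x ∈ M, S (x Ω) = T (x Ω)) : S = T := by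
  ext v
  refine congrFun (Continuous.ext_on h.cyclic S.continuous T.continuous ?_) v
  rintro _ ⟨x, hx, rfl⟩
  exact hST x hx

theorem ext_inner {v w : H} (hvw : ∀ x ∈ M, ⟪x Ω, v⟫_ℂ = ⟪x Ω, w⟫_ℂ) : v = w := by
  refine h.cyclic.eq_of_inner_left (𝕜 := ℂ) ?_
  rintro _ ⟨x, hx, rfl⟩
  rw [← inner_conj_symm, hvw x hx, inner_conj_symm]

theorem J_J (x : H) : J (J x) = x := by
  have h1 : J.toContinuousLinearMap.comp J.toContinuousLinearMap = ContinuousLinearMap.id ℂ H :=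
    h.ext_clm fun x hx => by
      simp [h.J_apply x hx, h.J_apply _ (vn_star_mem hx)]
  exact congrArg (fun T : H →L[ℂ] H => T x) h1

theorem J_vac : J Ω = Ω := by simpa using h.J_apply 1 (vn_one_mem M)

theorem rt_vec (y : H →L[ℂ] H) (hy : y ∈ M) (x : H →L[ℂ] H) (hx : x ∈ M) :
    rt J y (x Ω) = x (y Ω) := by
  rw [rt_apply, h.J_apply x hx]
  have := h.J_apply _ (vn_mul_mem (vn_star_mem hy) (vn_star_mem hx))
  simpa using this

theorem rt_vac (y : H →L[ℂ] H) (hy : y ∈ M) : rt J y Ω = y Ω := by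
  simpa using h.rt_vec y hy 1 (vn_one_mem M)

theorem rt_comm {y : H →L[ℂ] H} (hy : y ∈ M) {x : H →L[ℂ] H} (hx : x ∈ M) (v : H) :
    rt J y (x v) = x (rt J y v) := by
  have h1 : rt J y * x = x * rt J y := h.ext_clm fun z hz => by
    have := h.rt_vec y hy _ (vn_mul_mem hx hz)
    simpa [h.rt_vec y hy z hz] using this
  exact congrArg (fun T : H →L[ℂ] H => T v) h1

theorem star_rt (y : H →L[ℂ] H) : star (rt J y) = rt J (star y) := by
  rw [rt, star_cj h.J_J, rt]

theorem cj_rt (y : H →L[ℂ] H) : cj J (rt J y) = star y := cj_cj h.J_J _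

theorem eq_of_vec_eq {x y : H →L[ℂ] H} (hx : x ∈ M) (hy : y ∈ M) (hxy : x Ω = y Ω) : x = y := by
  refine h.ext_clm fun z hz => ?_
  rw [← h.rt_vec z hz x hx |>.trans rfl, ← h.rt_vec z hz y hy, hxy]

theorem eq_rt_of_isRightMul {y R : H →L[ℂ] H} (hy : y ∈ M) (hR : IsRightMul M Ω y R) :
    R = rt J y := h.ext_clm fun x hx => by rw [hR x hx, h.rt_vec y hy x hx]; rfl

theorem coarse_ext_inner {v w : Coarse H}
    (hvw : ∀ x ∈ M, ∀ y ∈ M, ⟪tens (x Ω) (y Ω), v⟫_ℂ = ⟪tens (x Ω) (y Ω), w⟫_ℂ) : v = w := by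
  refine coarse_inner_ext fun a b => ?_
  have h1 : ∀ x ∈ M, sliceL (x Ω) v = sliceL (x Ω) w := fun x hx => h.ext_inner fun y hy => by
    rw [inner_sliceL, inner_sliceL, hvw x hx y hy]
  have h2 : sliceR b v = sliceR b w := h.ext_inner fun x hx => by
    rw [inner_sliceR, inner_sliceR, ← inner_sliceL, ← inner_sliceL, h1 x hx]
  rw [← inner_sliceR, h2, inner_sliceR]

/-- Right multiplication on the first leg and left multiplication on the second commute with the
generators x ⊗ ρ(y): these are the inner actions on the coarse bimodule. -/
theorem tensorOp_comm {T : Coarse H →L[ℂ] Coarse H} (hT : T ∈ tensorOp M Ω) {c d : H →L[ℂ] H}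
    (hc : c ∈ M) (hd : d ∈ M) (ζ : Coarse H) :
    T (opTens (rt J c) d ζ) = opTens (rt J c) d (T ζ) := by
  have key : ∀ x ∈ M, ∀ y ∈ M,
      opTens x (rt J y) * opTens (rt J c) d = opTens (rt J c) d * opTens x (rt J y) := by
    intro x hx y hy
    rw [← opTens_mul, ← opTens_mul]
    congr 1
    · ext v; exact (h.rt_comm hc hx v).symm
    · ext v; exact h.rt_comm hy hd v
  have h1 := mem_wStar_iff.1 hT (opTens (rt J c) d) ?_ ?_
  · exact (congrArg (fun A : Coarse H →L[ℂ] Coarse H => A ζ) h1).symm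
  · rintro _ ⟨x, hx, y, hy, R, hR, rfl⟩
    rw [h.eq_rt_of_isRightMul hy hR, key x hx y hy]
  · rintro _ ⟨x, hx, y, hy, R, hR, rfl⟩
    rw [h.eq_rt_of_isRightMul hy hR, star_opTens, h.star_rt,
      key _ (vn_star_mem hx) _ (vn_star_mem hy)]

/-- J ⊗ J implements the adjoint on vectors TΩ⊗Ω. Paired with cΩ ⊗ dΩ, a commutant operator applied
to Ω ⊗ Ω, the claim follows by moving that operator past `T`. -/
theorem star_tensorOp_vac {T : Coarse H →L[ℂ] Coarse H} (hT : T ∈ tensorOp M Ω) :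
    star T (tens Ω Ω) = tensConj J (T (tens Ω Ω)) := by
  refine h.coarse_ext_inner fun c hc d hd => ?_
  have h1 : tens (c Ω) (d Ω) = opTens (rt J c) d (tens Ω Ω) := by
    rw [opTens_tens, h.rt_vac c hc]
  have h2 : ∀ x y : Coarse H, ⟪x, tensConj J y⟫_ℂ = ⟪y, tensConj J x⟫_ℂ := fun x y => by
    rw [← inner_tensConj J, tensConj_tensConj h.J_J]
  rw [h2, tensConj_tens, h.J_apply c hc, h.J_apply d hd, ContinuousLinearMap.star_eq_adjoint,
    ContinuousLinearMap.adjoint_inner_right, h1, h.tensorOp_comm hT hc hd, inner_opTens_left,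
    opTens_tens, h.star_rt, h.rt_vac _ (vn_star_mem hc)]

end IsStandardFormWith

end StandardForm

/-! ### Noncommutative polynomials and their difference quotients -/

section Polynomials

variable {H : Type u} [NormedAddCommGroup H] [InnerProductSpace ℂ H] [CompleteSpace H] {n : ℕ}

/-- The polynomial `p` evaluated at `X`. -/
abbrev pol (X : Fin n → H →L[ℂ] H) (p : FreeAlgebra ℂ (Fin n)) : H →L[ℂ] H :=
  FreeAlgebra.lift ℂ X p

/-- `p ↦ p(X) h`. -/
def polAt (X : Fin n → H →L[ℂ] H) (h : H) : FreeAlgebra ℂ (Fin n) →ₗ[ℂ] H where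
  toFun p := pol X p h
  map_add' p q := by simp
  map_smul' c p := by simp

/-- `α ⊗ β` with values in the coarse Hilbert space. -/
def tmap {V W : Type*} [AddCommGroup V] [Module ℂ V] [AddCommGroup W] [Module ℂ W]
    (α : V →ₗ[ℂ] H) (β : W →ₗ[ℂ] H) : V ⊗[ℂ] W →ₗ[ℂ] Coarse H :=
  (UniformSpace.Completion.toComplL (𝕜 := ℂ) (E := H ⊗[ℂ] H)).toLinearMap ∘ₗ
    TensorProduct.map α β

theorem tmap_tmul {V W : Type*} [AddCommGroup V] [Module ℂ V] [AddCommGroup W] [Module ℂ W]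
    (α : V →ₗ[ℂ] H) (β : W →ₗ[ℂ] H) (a : V) (b : W) : tmap α β (a ⊗ₜ b) = tens (α a) (β b) := rfl

theorem evalDiff_eq (X : Fin n → H →L[ℂ] H) (Ω : H) (i : Fin n) (p : FreeAlgebra ℂ (Fin n)) :
    evalDiff X Ω i p = tmap (evalVec X Ω) (evalVec X Ω) (freeDiff i p) := rfl

theorem evalVec_apply (X : Fin n → H →L[ℂ] H) (Ω : H) (p : FreeAlgebra ℂ (Fin n)) :
    evalVec X Ω p = pol X p Ω := rfl

theorem freeDiff_algebraMap (i : Fin n) (r : ℂ) : freeDiff i (algebraMap ℂ _ r) = 0 := by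
  simp [freeDiff, Matrix.algebraMap_matrix_apply]

theorem freeDiff_one (i : Fin n) : freeDiff i 1 = 0 := by
  simpa using freeDiff_algebraMap i 1

theorem tmap_mul_left (X : Fin n → H →L[ℂ] H) (Ω : H) (β : FreeAlgebra ℂ (Fin n) →ₗ[ℂ] H)
    (p : FreeAlgebra ℂ (Fin n)) (t : FreeAlgebra ℂ (Fin n) ⊗[ℂ] FreeAlgebra ℂ (Fin n)) :
    tmap (evalVec X Ω) β ((p ⊗ₜ[ℂ] 1) * t) = opTens (pol X p) 1 (tmap (evalVec X Ω) β t) := by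
  induction t using TensorProduct.induction_on with
  | zero => simp
  | tmul a b =>
    simp [tmap_tmul, evalVec_apply]
  | add x y hx hy => simp [mul_add, hx, hy]

theorem tmap_mul_right (X : Fin n → H →L[ℂ] H) (h : H) (α : FreeAlgebra ℂ (Fin n) →ₗ[ℂ] H)
    (q : FreeAlgebra ℂ (Fin n)) (t : FreeAlgebra ℂ (Fin n) ⊗[ℂ] FreeAlgebra ℂ (Fin n)) :
    tmap α (polAt X h) (t * (1 ⊗ₜ[ℂ] q)) = tmap α (polAt X (pol X q h)) t := by
  induction t using TensorProduct.induction_on with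
  | zero => simp
  | tmul a b => simp [tmap_tmul, polAt]
  | add x y hx hy => simp [add_mul, hx, hy]

theorem polAt_vac (X : Fin n → H →L[ℂ] H) (Ω : H) : polAt X Ω = evalVec X Ω := rfl

/-- The slice `(id ⊗ φ) ∂ᵢ`. -/
def slice (φ : FreeAlgebra ℂ (Fin n) →ₗ[ℂ] ℂ) (i : Fin n) :
    FreeAlgebra ℂ (Fin n) →ₗ[ℂ] FreeAlgebra ℂ (Fin n) :=
  (TensorProduct.rid ℂ (FreeAlgebra ℂ (Fin n))).toLinearMap ∘ₗ
    TensorProduct.map LinearMap.id φ ∘ₗ freeDiff i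

theorem rid_map_mul (φ : FreeAlgebra ℂ (Fin n) →ₗ[ℂ] ℂ) (p q : FreeAlgebra ℂ (Fin n))
    (t : FreeAlgebra ℂ (Fin n) ⊗[ℂ] FreeAlgebra ℂ (Fin n)) :
    TensorProduct.rid ℂ _ (TensorProduct.map LinearMap.id φ ((p ⊗ₜ[ℂ] 1) * t * (1 ⊗ₜ[ℂ] q))) =
      p * TensorProduct.rid ℂ _
        (TensorProduct.map LinearMap.id (φ ∘ₗ LinearMap.mulRight ℂ q) t) := by
  induction t using TensorProduct.induction_on with
  | zero => simp
  | tmul a b => simp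
  | add x y hx hy => simp only [mul_add, add_mul, map_add, hx, hy]

theorem slice_mul (φ : FreeAlgebra ℂ (Fin n) →ₗ[ℂ] ℂ) (i : Fin n) (p q : FreeAlgebra ℂ (Fin n)) :
    slice φ i (p * q) = p * slice φ i q + slice (φ ∘ₗ LinearMap.mulRight ℂ q) i p := by
  have h1 := rid_map_mul φ p 1 (freeDiff i q)
  have h2 := rid_map_mul φ 1 q (freeDiff i p)
  simp only [← Algebra.TensorProduct.one_def, mul_one, one_mul, LinearMap.mulRight_one,
    LinearMap.comp_id] at h1 h2
  simp [slice, freeDiff_mul, h1, h2]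

theorem slice_ι (φ : FreeAlgebra ℂ (Fin n) →ₗ[ℂ] ℂ) (i j : Fin n) :
    slice φ i (FreeAlgebra.ι ℂ j) = if i = j then algebraMap ℂ _ (φ 1) else 0 := by
  simp only [slice, LinearMap.comp_apply, freeDiff_ι]
  split_ifs <;> simp [Algebra.algebraMap_eq_smul_one]

theorem slice_algebraMap (φ : FreeAlgebra ℂ (Fin n) →ₗ[ℂ] ℂ) (i : Fin n) (r : ℂ) :
    slice φ i (algebraMap ℂ _ r) = 0 := by simp [slice, freeDiff_algebraMap]

theorem slice_one (φ : FreeAlgebra ℂ (Fin n) →ₗ[ℂ] ℂ) (i : Fin n) :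
    slice φ i 1 = 0 := by simp [slice, freeDiff_one]

theorem map_slice_mul (φ : FreeAlgebra ℂ (Fin n) →ₗ[ℂ] ℂ) (i : Fin n)
    (p q : FreeAlgebra ℂ (Fin n)) (t s : FreeAlgebra ℂ (Fin n) ⊗[ℂ] FreeAlgebra ℂ (Fin n)) :
    TensorProduct.map LinearMap.id (slice φ i) ((p ⊗ₜ[ℂ] 1) * s + t * (1 ⊗ₜ[ℂ] q)) =
      (p ⊗ₜ[ℂ] 1) * TensorProduct.map LinearMap.id (slice φ i) s + t * (1 ⊗ₜ[ℂ] slice φ i q) +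
        TensorProduct.map LinearMap.id (slice (φ ∘ₗ LinearMap.mulRight ℂ q) i) t := by
  have h1 : TensorProduct.map LinearMap.id (slice φ i) ((p ⊗ₜ[ℂ] 1) * s) =
      (p ⊗ₜ[ℂ] 1) * TensorProduct.map LinearMap.id (slice φ i) s := by
    induction s using TensorProduct.induction_on with
    | zero => simp
    | tmul a b => simp
    | add x y hx hy => simp only [mul_add, map_add, hx, hy]
  have h2 : TensorProduct.map LinearMap.id (slice φ i) (t * (1 ⊗ₜ[ℂ] q)) =
      t * (1 ⊗ₜ[ℂ] slice φ i q) +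
        TensorProduct.map LinearMap.id (slice (φ ∘ₗ LinearMap.mulRight ℂ q) i) t := by
    induction t using TensorProduct.induction_on with
    | zero => simp
    | tmul a b => simp [slice_mul, TensorProduct.tmul_add]
    | add x y hx hy => simp only [add_mul, map_add, hx, hy]; abel
  rw [map_add, h1, h2, add_assoc]

/-- Coassociativity of the difference quotients, with a functional applied to the last leg. -/
theorem freeDiff_slice (i j : Fin n) (p : FreeAlgebra ℂ (Fin n)) :
    ∀ φ : FreeAlgebra ℂ (Fin n) →ₗ[ℂ] ℂ, freeDiff j (slice φ i p) =
      TensorProduct.map LinearMap.id (slice φ i) (freeDiff j p) := by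
  -- The functional stays universally quantified: in a product a * b the slice of a is taken against
  -- φ(· b) instead of φ.
  induction p using FreeAlgebra.induction with
  | grade0 r => intro φ; simp [slice_algebraMap, freeDiff_algebraMap]
  | grade1 k =>
    intro φ
    rw [slice_ι, freeDiff_ι]
    split_ifs <;> simp [freeDiff_algebraMap, slice_one]
  | mul a b ha hb =>
    intro φ
    rw [slice_mul, freeDiff_mul, map_slice_mul, map_add, freeDiff_mul, hb, ha]
  | add a b ha hb => intro φ; simp [ha, hb]

/-- The graph of the closure of `∂ⱼ`. -/
def dgraph (X : Fin n → H →L[ℂ] H) (Ω : H) (j : Fin n) : Submodule ℂ (H × Coarse H) :=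
  (LinearMap.range ((evalVec X Ω).prod (evalDiff X Ω j))).topologicalClosure

theorem isClosed_dgraph (X : Fin n → H →L[ℂ] H) (Ω : H) (j : Fin n) :
    IsClosed (dgraph X Ω j : Set (H × Coarse H)) := Submodule.isClosed_topologicalClosure _

theorem poly_mem_dgraph (X : Fin n → H →L[ℂ] H) (Ω : H) (j : Fin n) (p : FreeAlgebra ℂ (Fin n)) :
    (evalVec X Ω p, evalDiff X Ω j p) ∈ dgraph X Ω j :=
  Submodule.le_topologicalClosure _ ⟨p, rfl⟩

theorem dgraph_induction {X : Fin n → H →L[ℂ] H} {Ω : H} {j : Fin n} {P : H → Coarse H → Prop}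
    (hc : IsClosed {x : H × Coarse H | P x.1 x.2})
    (hp : ∀ p, P (evalVec X Ω p) (evalDiff X Ω j p)) {h : H} {η : Coarse H}
    (hm : (h, η) ∈ dgraph X Ω j) : P h η := by
  have h1 : (h, η) ∈ closure (Set.range ((evalVec X Ω).prod (evalDiff X Ω j))) := hm
  have h2 : closure (Set.range ((evalVec X Ω).prod (evalDiff X Ω j))) ⊆
      {x : H × Coarse H | P x.1 x.2} := by
    refine closure_minimal ?_ hc
    rintro _ ⟨p, rfl⟩
    exact hp p
  exact h2 h1

theorem exists_poly_seq {X : Fin n → H →L[ℂ] H} {Ω : H} {j : Fin n} {h : H} {η : Coarse H}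
    (hm : (h, η) ∈ dgraph X Ω j) : ∃ p : ℕ → FreeAlgebra ℂ (Fin n),
      Tendsto (fun m => evalVec X Ω (p m)) atTop (𝓝 h) ∧
        Tendsto (fun m => evalDiff X Ω j (p m)) atTop (𝓝 η) := by
  have h1 : (h, η) ∈ closure (Set.range ((evalVec X Ω).prod (evalDiff X Ω j))) := hm
  obtain ⟨x, hx, hx'⟩ := mem_closure_iff_seq_limit.1 h1
  choose p hp using hx
  refine ⟨p, ?_, ?_⟩
  · have := (continuous_fst.tendsto _).comp hx'
    refine this.congr fun m => ?_
    simp [← hp m]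
  · have := (continuous_snd.tendsto _).comp hx'
    refine this.congr fun m => ?_
    simp [← hp m]

/-- The data of the theorem: `X` generates a tracial von Neumann algebra in standard form with
conjugation `J`, and has Lipschitz conjugate variables satisfying `CD(1, ∞)`. -/
structure ObataData (X : Fin n → H →L[ℂ] H) (Ω : H) (ξ : Fin n → H)
    (Jac : Fin n → Fin n → Coarse H →L[ℂ] Coarse H) (J : H →ₗᵢ⋆[ℂ] H) : Prop where
  sa : ∀ i, IsSelfAdjoint (X i)
  std : IsStandardFormWith (wStar (Set.range X)) Ω J
  free : IsAlgFree X
  lip : IsLipschitzConjugate X Ω ξ Jac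
  cd : CurvatureDim 1 Jac

/-- The conjugate Jacobian, acting by left multiplication on `L²(M) ⊗ L²(M^op)` as the commutant. -/
def jacR (Jac : Fin n → Fin n → Coarse H →L[ℂ] Coarse H) (J : H →ₗᵢ⋆[ℂ] H) (i j : Fin n) :
    Coarse H →L[ℂ] Coarse H :=
  (tensConj J).comp ((Jac i j).comp (tensConj J))

theorem pol_mem (X : Fin n → H →L[ℂ] H) (p : FreeAlgebra ℂ (Fin n)) :
    pol X p ∈ wStar (Set.range X) := by
  induction p using FreeAlgebra.induction with
  | grade0 r =>
    rw [pol, AlgHom.commutes]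
    exact algebraMap_mem (wStar (Set.range X)).toStarSubalgebra r
  | grade1 j =>
    rw [pol, FreeAlgebra.lift_ι_apply]
    exact subset_wStar _ ⟨j, rfl⟩
  | mul a b ha hb => rw [pol, map_mul]; exact vn_mul_mem ha hb
  | add a b ha hb => rw [pol, map_add]; exact vn_add_mem ha hb

namespace ObataData

variable {X : Fin n → H →L[ℂ] H} {Ω : H} {ξ : Fin n → H}
  {Jac : Fin n → Fin n → Coarse H →L[ℂ] Coarse H} {J : H →ₗᵢ⋆[ℂ] H}
  (D : ObataData X Ω ξ Jac J)
include D

/-- The closure of the polynomial vectors contains Ω and reduces every X_i, hence is invariant under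
M. -/
theorem dense_poly : DenseRange (evalVec X Ω) := by
  have h1 : (LinearMap.range (evalVec X Ω)).topologicalClosure = ⊤ := by
    rw [eq_top_iff]
    intro v _
    have hinv : ∀ i, ∀ v ∈ (LinearMap.range (evalVec X Ω)).topologicalClosure,
        X i v ∈ (LinearMap.range (evalVec X Ω)).topologicalClosure := by
      intro i v hv
      refine map_mem_closure (X i).continuous hv ?_
      rintro _ ⟨p, rfl⟩
      exact ⟨FreeAlgebra.ι ℂ i * p, by simp [evalVec_apply]⟩
    have h2 : ∀ x ∈ wStar (Set.range X),
        x Ω ∈ (LinearMap.range (evalVec X Ω)).topologicalClosure := by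
      intro x hx
      refine wStar_apply_mem (Submodule.isClosed_topologicalClosure _) ?_ ?_ hx ?_
      · rintro _ ⟨i, rfl⟩ v hv
        exact hinv i v hv
      · rintro _ ⟨i, rfl⟩ v hv
        rw [(D.sa i).star_eq]
        exact hinv i v hv
      · exact Submodule.le_topologicalClosure _ ⟨1, by simp [evalVec_apply]⟩
    have h3 := D.std.cyclic v
    refine closure_minimal (t := ((LinearMap.range (evalVec X Ω)).topologicalClosure : Set H))
      ?_ (Submodule.isClosed_topologicalClosure _) h3
    rintro _ ⟨x, hx, rfl⟩
    exact h2 x hx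
  intro v
  have : v ∈ (LinearMap.range (evalVec X Ω)).topologicalClosure := h1 ▸ Submodule.mem_top
  exact this

theorem poly_ext {E : Type*} [NormedAddCommGroup E] [NormedSpace ℂ E] {σ : ℂ →+* ℂ}
    {S T : H →SL[σ] E} (hST : ∀ p, S (evalVec X Ω p) = T (evalVec X Ω p)) : S = T := by
  ext v
  exact congrFun (D.dense_poly.equalizer S.continuous T.continuous (funext hST)) v

theorem poly_ext_inner {v w : H} (hvw : ∀ p, ⟪evalVec X Ω p, v⟫_ℂ = ⟪evalVec X Ω p, w⟫_ℂ) :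
    v = w := by
  refine Dense.eq_of_inner_left (𝕜 := ℂ) D.dense_poly ?_
  rintro _ ⟨p, rfl⟩
  rw [← inner_conj_symm, hvw p, inner_conj_symm]

theorem pol_eq_zero {p : FreeAlgebra ℂ (Fin n)} (hp : evalVec X Ω p = 0) : p = 0 := by
  refine D.free ?_
  rw [map_zero]
  refine D.std.faithful _ (pol_mem X p) ?_
  have : pol X p Ω = 0 := hp
  simp [tr, this]

/-- Faithfulness and algebraic freeness make the relation p(X)Ω ↦ (∂_i p)(X) single valued; only
then is the graph of `toLinearPMap` the relation it was built from. -/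
theorem diffQuot_graph (i : Fin n) : (diffQuot X Ω i).graph =
    LinearMap.range ((evalVec X Ω).prod (evalDiff X Ω i)) := by
  refine Submodule.toLinearPMap_graph_eq _ ?_
  rintro _ ⟨p, rfl⟩ hp
  have : p = 0 := D.pol_eq_zero hp
  simp [this]

theorem closure_graph (i : Fin n) : (diffQuot X Ω i).closure.graph = dgraph X Ω i := by
  rw [← (D.lip.closable i).graph_closure_eq_closure_graph, D.diffQuot_graph]; rfl

theorem dgraph_unique {j : Fin n} {h : H} {η η' : Coarse H} (h1 : (h, η) ∈ dgraph X Ω j)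
    (h2 : (h, η') ∈ dgraph X Ω j) : η = η' := by
  rw [← D.closure_graph] at h1 h2
  exact LinearPMap.mem_graph_snd_inj' _ h1 h2 rfl

theorem inner_conj_var (i : Fin n) (p : FreeAlgebra ℂ (Fin n)) :
    ⟪ξ i, evalVec X Ω p⟫_ℂ = ⟪tens Ω Ω, evalDiff X Ω i p⟫_ℂ := by
  have hd : Dense ((diffQuot X Ω i).domain : Set H) := by
    refine D.dense_poly.mono ?_
    rintro _ ⟨p, rfl⟩
    rw [SetLike.mem_coe, LinearPMap.mem_domain_iff]
    refine ⟨evalDiff X Ω i p, ?_⟩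
    rw [D.diffQuot_graph]
    exact ⟨p, rfl⟩
  have h1 := D.lip.conj i
  rw [LinearPMap.mem_graph_iff] at h1
  obtain ⟨y, hy, hy'⟩ := h1
  have h2 : (evalVec X Ω p, evalDiff X Ω i p) ∈ (diffQuot X Ω i).graph := by
    rw [D.diffQuot_graph]; exact ⟨p, rfl⟩
  rw [LinearPMap.mem_graph_iff] at h2
  obtain ⟨z, hz, hz'⟩ := h2
  have h3 := LinearPMap.adjoint_isFormalAdjoint hd y z
  simp only at hy hy' hz hz'
  rw [hy', hy, hz, hz'] at h3
  exact h3

theorem rt_evalVec (q p : FreeAlgebra ℂ (Fin n)) :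
    rt J (pol X q) (evalVec X Ω p) = evalVec X Ω (p * q) := by
  rw [evalVec_apply, D.std.rt_vec _ (pol_mem X q) _ (pol_mem X p), evalVec_apply]
  simp [pol]

theorem tmap_mul_right (α : FreeAlgebra ℂ (Fin n) →ₗ[ℂ] H)
    (q : FreeAlgebra ℂ (Fin n)) (t : FreeAlgebra ℂ (Fin n) ⊗[ℂ] FreeAlgebra ℂ (Fin n)) :
    tmap α (evalVec X Ω) (t * (1 ⊗ₜ[ℂ] q)) =
      opTens 1 (rt J (pol X q)) (tmap α (evalVec X Ω) t) := by
  induction t using TensorProduct.induction_on with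
  | zero => simp
  | tmul a b => simp [tmap_tmul, D.rt_evalVec]
  | add x y hx hy => simp [add_mul, hx, hy]

theorem evalDiff_mul (j : Fin n) (p q : FreeAlgebra ℂ (Fin n)) :
    evalDiff X Ω j (p * q) = opTens (pol X p) 1 (evalDiff X Ω j q) +
      opTens 1 (rt J (pol X q)) (evalDiff X Ω j p) := by
  rw [evalDiff_eq, freeDiff_mul, map_add, tmap_mul_left, D.tmap_mul_right]
  rfl

/-- Words are reversed and coefficients conjugated; the two legs of the difference quotient then
trade places. -/
theorem exists_star_poly (p : FreeAlgebra ℂ (Fin n)) : ∃ q : FreeAlgebra ℂ (Fin n),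
    pol X q = star (pol X p) ∧ ∀ j, evalDiff X Ω j q = tensStar J (evalDiff X Ω j p) := by
  have hJ := D.std.J_J
  induction p using FreeAlgebra.induction with
  | grade0 r =>
    refine ⟨algebraMap ℂ _ (star r), ?_, fun j => ?_⟩
    · rw [pol, AlgHom.commutes, algebraMap_star_comm]
      exact congrArg star (AlgHom.commutes _ r).symm
    · simp [evalDiff_eq, freeDiff_algebraMap]
  | grade1 k =>
    refine ⟨FreeAlgebra.ι ℂ k, by simp [pol, (D.sa k).star_eq], fun j => ?_⟩
    rw [evalDiff_eq, freeDiff_ι]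
    split_ifs
    · rw [tmap_tmul, tensStar_tens]; simp [evalVec_apply, D.std.J_vac]
    · simp
  | mul a b ha hb =>
    obtain ⟨a', ha1, ha2⟩ := ha
    obtain ⟨b', hb1, hb2⟩ := hb
    refine ⟨b' * a', by simp only [pol, map_mul, star_mul] at *; rw [ha1, hb1], fun j => ?_⟩
    rw [D.evalDiff_mul, D.evalDiff_mul, map_add, tensStar_opTens hJ, tensStar_opTens hJ, cj_one hJ,
      D.std.cj_rt, hb2, ha2, hb1, ha1, add_comm]
    simp [rt]
  | add a b ha hb =>
    obtain ⟨a', ha1, ha2⟩ := ha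
    obtain ⟨b', hb1, hb2⟩ := hb
    refine ⟨a' + b', by simp only [pol, map_add, star_add] at *; rw [ha1, hb1], fun j => ?_⟩
    rw [map_add, map_add, map_add, ha2, hb2]

theorem star_mem_dgraph {j : Fin n} {h : H} {η : Coarse H} (hm : (h, η) ∈ dgraph X Ω j) :
    (J h, tensStar J η) ∈ dgraph X Ω j := by
  refine dgraph_induction (P := fun h η => (J h, tensStar J η) ∈ dgraph X Ω j)
    ((isClosed_dgraph X Ω j).preimage (by fun_prop)) (fun p => ?_) hm
  obtain ⟨q, hq, hq'⟩ := D.exists_star_poly p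
  have h1 : J (evalVec X Ω p) = evalVec X Ω q := by
    rw [evalVec_apply, D.std.J_apply _ (pol_mem X p), evalVec_apply, hq]
  rw [h1, ← hq' j]
  exact poly_mem_dgraph X Ω j q

/-- The Jacobian belongs to the algebra of outer actions. Conjugation by J ⊗ J carries it into the
commutant, so it becomes a bimodule map. -/
theorem jacR_comm (i j : Fin n) {x y : H →L[ℂ] H} (hx : x ∈ wStar (Set.range X))
    (hy : y ∈ wStar (Set.range X)) (ζ : Coarse H) :
    jacR Jac J i j (opTens x (rt J y) ζ) = opTens x (rt J y) (jacR Jac J i j ζ) := by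
  have hJ := D.std.J_J
  have h1 : cj J x = rt J (star x) := by rw [rt, star_star]
  simp only [jacR, ContinuousLinearMap.comp_apply, tensConj_opTens hJ, D.std.cj_rt, h1]
  rw [D.std.tensorOp_comm (D.lip.jac_mem i j) (vn_star_mem hx) (vn_star_mem hy),
    tensConj_opTens hJ, D.std.cj_rt, star_star]
  rfl

/-- The symmetry 𝒥_ij* = 𝒥_ji allows the gradient of ξ_i to be written with operators that commute
with multiplication by polynomials. The indices are transposed in passing. -/
theorem jacR_vac (i j : Fin n) : jacR Jac J j i (tens Ω Ω) = Jac i j (tens Ω Ω) := by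
  have h1 := D.std.star_tensorOp_vac (D.lip.jac_mem i j)
  rw [D.cd.1] at h1
  simp only [jacR, ContinuousLinearMap.comp_apply, tensConj_tens, D.std.J_vac, h1]
  exact tensConj_tensConj D.std.J_J _

theorem conj_var_mem (i j : Fin n) : (ξ i, jacR Jac J j i (tens Ω Ω)) ∈ dgraph X Ω j := by
  rw [D.jacR_vac, ← D.closure_graph]
  exact D.lip.jac_eq i j

theorem inner_tensConj_left (x y : Coarse H) : ⟪tensConj J x, y⟫_ℂ = ⟪tensConj J y, x⟫_ℂ := by
  rw [← inner_tensConj J x, tensConj_tensConj D.std.J_J]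

theorem star_jacR (i j : Fin n) : star (jacR Jac J i j) = jacR Jac J j i := by
  refine ContinuousLinearMap.ext fun x => ext_inner_left ℂ fun y => ?_
  rw [ContinuousLinearMap.star_eq_adjoint, ContinuousLinearMap.adjoint_inner_right]
  simp only [jacR, ContinuousLinearMap.comp_apply]
  rw [D.inner_tensConj_left _ x, ← inner_conj_symm y, D.inner_tensConj_left _ y, inner_conj_symm,
    ← ContinuousLinearMap.adjoint_inner_left, ← ContinuousLinearMap.star_eq_adjoint, D.cd.1 i j]

theorem jacR_bound (v : Fin n → Coarse H) :
    ∑ i, ‖v i‖ ^ 2 ≤ (∑ i, ∑ j, ⟪v i, jacR Jac J i j (v j)⟫_ℂ).re := by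
  have h1 := D.cd.2 fun i => tensConj J (v i)
  simp only [norm_tensConj, one_mul, Complex.ofReal_one] at h1
  refine h1.trans (le_of_eq ?_)
  simp only [Complex.re_sum]
  refine Finset.sum_congr rfl fun i _ => Finset.sum_congr rfl fun j _ => ?_
  rw [D.inner_tensConj_left, jacR, ← inner_conj_symm, Complex.conj_re]
  rfl

end ObataData

end Polynomials

/-! ### The slices `(id ⊗ τ) ∂ᵢ` are bounded -/

section Slices

variable {H : Type u} [NormedAddCommGroup H] [InnerProductSpace ℂ H] [CompleteSpace H] {n : ℕ}

/-- The trace, as a functional on polynomials. -/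
def vacFun (X : Fin n → H →L[ℂ] H) (Ω : H) : FreeAlgebra ℂ (Fin n) →ₗ[ℂ] ℂ :=
  (innerSL ℂ Ω).toLinearMap ∘ₗ evalVec X Ω

/-- The formal adjoint of `(id ⊗ τ) ∂ᵢ`, i.e. `q ↦ ∂ᵢ* (q ⊗ 1)`. -/
def coSlice (X : Fin n → H →L[ℂ] H) (Ω : H) (ξ : Fin n → H) (i : Fin n) :
    FreeAlgebra ℂ (Fin n) →ₗ[ℂ] H :=
  polAt X (ξ i) - evalVec X Ω ∘ₗ slice (vacFun X Ω) i

theorem sliceR_tmap (X : Fin n → H →L[ℂ] H) (Ω : H) (β : FreeAlgebra ℂ (Fin n) →ₗ[ℂ] H)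
    (φ : FreeAlgebra ℂ (Fin n) →ₗ[ℂ] ℂ) (c : H) (hφ : ∀ p, ⟪c, β p⟫_ℂ = φ p)
    (t : FreeAlgebra ℂ (Fin n) ⊗[ℂ] FreeAlgebra ℂ (Fin n)) :
    sliceR c (tmap (evalVec X Ω) β t) =
      evalVec X Ω (TensorProduct.rid ℂ _ (TensorProduct.map LinearMap.id φ t)) := by
  induction t using TensorProduct.induction_on with
  | zero => simp
  | tmul a b => simp [tmap_tmul, sliceR_tens, hφ]
  | add x y hx hy => simp only [map_add, hx, hy]

theorem sliceR_vac_evalDiff (X : Fin n → H →L[ℂ] H) (Ω : H) (i : Fin n)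
    (p : FreeAlgebra ℂ (Fin n)) :
    sliceR Ω (evalDiff X Ω i p) = evalVec X Ω (slice (vacFun X Ω) i p) :=
  sliceR_tmap X Ω _ (vacFun X Ω) Ω (fun _ => rfl) _

theorem inner_evalDiff (X : Fin n → H →L[ℂ] H) (Ω : H) (i : Fin n) (v : H)
    (p : FreeAlgebra ℂ (Fin n)) :
    ⟪tens v Ω, evalDiff X Ω i p⟫_ℂ = ⟪v, evalVec X Ω (slice (vacFun X Ω) i p)⟫_ℂ := by
  rw [← sliceR_vac_evalDiff, inner_sliceR]

theorem tmap_sub_right {V W : Type*} [AddCommGroup V] [Module ℂ V] [AddCommGroup W] [Module ℂ W]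
    (α : V →ₗ[ℂ] H) (β γ : W →ₗ[ℂ] H) (t : V ⊗[ℂ] W) :
    tmap α (β - γ) t = tmap α β t - tmap α γ t := by
  induction t using TensorProduct.induction_on with
  | zero => simp
  | tmul a b => simp [tmap_tmul, tens_sub_right]
  | add x y hx hy => simp only [map_add, hx, hy]; abel

theorem tmap_map_id (α : FreeAlgebra ℂ (Fin n) →ₗ[ℂ] H) (β : FreeAlgebra ℂ (Fin n) →ₗ[ℂ] H)
    (γ : FreeAlgebra ℂ (Fin n) →ₗ[ℂ] FreeAlgebra ℂ (Fin n))
    (t : FreeAlgebra ℂ (Fin n) ⊗[ℂ] FreeAlgebra ℂ (Fin n)) :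
    tmap α β (TensorProduct.map LinearMap.id γ t) = tmap α (β ∘ₗ γ) t := by
  induction t using TensorProduct.induction_on with
  | zero => simp
  | tmul a b => simp [tmap_tmul]
  | add x y hx hy => simp only [map_add, hx, hy]

theorem opTens_tmap_right (T : H →L[ℂ] H) (α β γ : FreeAlgebra ℂ (Fin n) →ₗ[ℂ] H)
    (hT : ∀ p, T (β p) = γ p)
    (t : FreeAlgebra ℂ (Fin n) ⊗[ℂ] FreeAlgebra ℂ (Fin n)) :
    opTens 1 T (tmap α β t) = tmap α γ t := by
  induction t using TensorProduct.induction_on with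
  | zero => simp
  | tmul a b => simp [tmap_tmul, hT]
  | add x y hx hy => simp only [map_add, hx, hy]

theorem continuous_tmap_polAt (X : Fin n → H →L[ℂ] H) (α : FreeAlgebra ℂ (Fin n) →ₗ[ℂ] H)
    (t : FreeAlgebra ℂ (Fin n) ⊗[ℂ] FreeAlgebra ℂ (Fin n)) :
    Continuous fun h => tmap α (polAt X h) t := by
  induction t using TensorProduct.induction_on with
  | zero => simpa using continuous_const
  | tmul a b => exact (tensL (α a)).continuous.comp (pol X b).continuous
  | add x y hx hy => simp only [map_add]; exact hx.add hy

namespace ObataData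

variable {X : Fin n → H →L[ℂ] H} {Ω : H} {ξ : Fin n → H}
  {Jac : Fin n → Fin n → Coarse H →L[ℂ] Coarse H} {J : H →ₗᵢ⋆[ℂ] H}
  (D : ObataData X Ω ξ Jac J)
include D

/-- Expand ∂_i(q* p) by the Leibniz rule in ⟨ξ_i, q* p⟩ = ⟨1 ⊗ 1, ∂_i(q* p)⟩. -/
theorem inner_coSlice (i : Fin n) (q p : FreeAlgebra ℂ (Fin n)) :
    ⟪coSlice X Ω ξ i q, evalVec X Ω p⟫_ℂ =
      ⟪evalVec X Ω q, evalVec X Ω (slice (vacFun X Ω) i p)⟫_ℂ := by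
  obtain ⟨q', hq1, hq2⟩ := D.exists_star_poly q
  have h1 := D.inner_conj_var i (q' * p)
  have h2 : evalVec X Ω (q' * p) = star (pol X q) (evalVec X Ω p) := by
    rw [← hq1]; simp [evalVec_apply, pol]
  rw [D.evalDiff_mul, hq1, hq2, h2, ContinuousLinearMap.star_eq_adjoint,
    ContinuousLinearMap.adjoint_inner_right, ← ContinuousLinearMap.star_eq_adjoint,
    inner_add_right, inner_opTens_right, inner_opTens_right, opTens_tens, opTens_tens, star_star,
    star_one, D.std.star_rt, D.std.rt_vac _ (vn_star_mem (pol_mem X p)),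
    ← D.std.J_apply _ (pol_mem X p)] at h1
  have h3 : tens Ω (J (pol X p Ω)) = tensStar J (tens (pol X p Ω) Ω) := by
    rw [tensStar_tens, D.std.J_vac]
  simp only [one_apply_eq_self] at h1
  rw [h3, inner_tensStar, inner_evalDiff, ← inner_conj_symm (evalDiff X Ω i q), inner_evalDiff,
    inner_conj_symm] at h1
  simp only [coSlice, LinearMap.sub_apply, inner_sub_left]
  change ⟪pol X q (ξ i), _⟫_ℂ - _ = _
  rw [h1]
  simp [evalVec_apply]

theorem leibniz_poly {j : Fin n} (q : FreeAlgebra ℂ (Fin n)) {h : H} {η : Coarse H}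
    (hm : (h, η) ∈ dgraph X Ω j) :
    (pol X q h, opTens (pol X q) 1 η + tmap (evalVec X Ω) (polAt X h) (freeDiff j q)) ∈
      dgraph X Ω j := by
  refine dgraph_induction (P := fun h η => (pol X q h, opTens (pol X q) 1 η +
    tmap (evalVec X Ω) (polAt X h) (freeDiff j q)) ∈ dgraph X Ω j) ?_ (fun p => ?_) hm
  · refine (isClosed_dgraph X Ω j).preimage ?_
    have := (continuous_tmap_polAt X (evalVec X Ω) (freeDiff j q)).comp
      (continuous_fst (X := H) (Y := Coarse H))
    exact ((pol X q).continuous.comp continuous_fst).prodMk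
      (((opTens (pol X q) 1).continuous.comp continuous_snd).add this)
  · have h1 := poly_mem_dgraph X Ω j (q * p)
    have h2 : evalVec X Ω (q * p) = pol X q (evalVec X Ω p) := by simp [evalVec_apply, pol]
    rw [h2, evalDiff_eq, freeDiff_mul, map_add, tmap_mul_left, ← polAt_vac,
      FreeObata.tmap_mul_right] at h1
    exact h1

/-- The Leibniz rule for q · ξ_i produces the Jacobian term, and coassociativity differentiates the
slice of q; the remaining terms recombine into ∂_i*(· ⊗ 1) on the second leg. -/
theorem coSlice_mem (i j : Fin n) (q : FreeAlgebra ℂ (Fin n)) :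
    (coSlice X Ω ξ i q, jacR Jac J j i (tens (evalVec X Ω q) Ω) +
      tmap (evalVec X Ω) (coSlice X Ω ξ i) (freeDiff j q)) ∈ dgraph X Ω j := by
  have h1 := D.leibniz_poly q (D.conj_var_mem i j)
  have h2 := poly_mem_dgraph X Ω j (slice (vacFun X Ω) i q)
  have h3 := sub_mem h1 h2
  have h4 : opTens (pol X q) 1 (jacR Jac J j i (tens Ω Ω)) =
      jacR Jac J j i (tens (evalVec X Ω q) Ω) := by
    have := D.jacR_comm j i (pol_mem X q) (vn_one_mem _) (tens Ω Ω)
    have h5 : rt J 1 = 1 := by rw [rt, star_one, cj_one D.std.J_J]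
    rw [h5, opTens_tens] at this
    exact this.symm
  convert h3 using 1
  rw [Prod.mk_sub_mk, h4, evalDiff_eq, freeDiff_slice, tmap_map_id, coSlice, tmap_sub_right,
    add_sub_assoc]
  rfl

theorem inner_coSlice_mem {i : Fin n} (q : FreeAlgebra ℂ (Fin n)) {h : H} {η : Coarse H}
    (hm : (h, η) ∈ dgraph X Ω i) :
    ⟪coSlice X Ω ξ i q, h⟫_ℂ = ⟪tens (evalVec X Ω q) Ω, η⟫_ℂ := by
  refine dgraph_induction (P := fun h η => ⟪coSlice X Ω ξ i q, h⟫_ℂ =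
    ⟪tens (evalVec X Ω q) Ω, η⟫_ℂ) (isClosed_eq (by fun_prop) (by fun_prop)) (fun p => ?_) hm
  rw [D.inner_coSlice, inner_evalDiff]

/-- Pairing c = ∂_i*(q ⊗ 1) with itself gives ⟨q ⊗ 1, ∂̄_i c⟩. In ∂̄_i c only the Jacobian term
survives the pairing, and it is controlled by the operator norm. This is where the Lipschitz
condition makes the slices bounded. -/
theorem norm_coSlice_sq_le (i : Fin n) (q : FreeAlgebra ℂ (Fin n)) :
    ‖coSlice X Ω ξ i q‖ ^ 2 ≤ ‖jacR Jac J i i‖ * ‖evalVec X Ω q‖ ^ 2 := by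
  have h1 := D.inner_coSlice_mem q (D.coSlice_mem i i q)
  -- Since ∂_i 1 = 0, the co-slices are orthogonal to Ω, which kills the term with a co-slice on the
  -- second leg.
  have hφ : ∀ p, ⟪Ω, coSlice X Ω ξ i p⟫_ℂ = (0 : FreeAlgebra ℂ (Fin n) →ₗ[ℂ] ℂ) p := by
    intro p
    have := D.inner_coSlice i p 1
    rw [slice_one, map_zero, inner_zero_right] at this
    rw [← inner_conj_symm]
    simp only [evalVec_apply, map_one, one_apply_eq_self, pol] at this
    simp [this]
  rw [inner_add_right, ← inner_sliceR _ _ (tmap _ _ _), sliceR_tmap X Ω _ 0 Ω hφ] at h1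
  simp only [TensorProduct.map_zero_right, LinearMap.zero_apply, map_zero, inner_zero_right,
    add_zero] at h1
  have h2 : ‖coSlice X Ω ξ i q‖ ^ 2 = ‖⟪coSlice X Ω ξ i q, coSlice X Ω ξ i q⟫_ℂ‖ := by
    rw [inner_self_eq_norm_sq_to_K]; simp
  rw [h2, h1]
  have h3 : ‖tens (evalVec X Ω q) Ω‖ = ‖evalVec X Ω q‖ := by
    rw [norm_tens, D.std.norm_one, mul_one]
  calc _ ≤ ‖tens (evalVec X Ω q) Ω‖ * ‖jacR Jac J i i (tens (evalVec X Ω q) Ω)‖ :=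
        norm_inner_le_norm _ _
    _ ≤ ‖tens (evalVec X Ω q) Ω‖ * (‖jacR Jac J i i‖ * ‖tens (evalVec X Ω q) Ω‖) := by
        gcongr; exact ContinuousLinearMap.le_opNorm _ _
    _ = _ := by rw [h3]; ring

theorem exists_slice_op (i : Fin n) : ∃ S : H →L[ℂ] H,
    (∀ p, S (evalVec X Ω p) = evalVec X Ω (slice (vacFun X Ω) i p)) ∧
      ∀ p, star S (evalVec X Ω p) = coSlice X Ω ξ i p := by
  have hb : ∃ C, ∀ q, ‖coSlice X Ω ξ i q‖ ≤ C * ‖evalVec X Ω q‖ := by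
    have h0 : 0 ≤ ‖jacR Jac J i i‖ := ContinuousLinearMap.opNorm_nonneg _
    refine ⟨√‖jacR Jac J i i‖, fun q => ?_⟩
    refine abs_le_of_sq_le_sq' ?_ (by positivity) |>.2
    exact (D.norm_coSlice_sq_le i q).trans_eq (by rw [mul_pow, Real.sq_sqrt h0])
  let T := (coSlice X Ω ξ i).extendOfNorm (evalVec X Ω)
  have hT : ∀ q, T (evalVec X Ω q) = coSlice X Ω ξ i q :=
    LinearMap.extendOfNorm_eq D.dense_poly hb
  refine ⟨star T, fun p => ?_, fun p => by rw [star_star, hT]⟩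
  refine D.poly_ext_inner fun q => ?_
  rw [ContinuousLinearMap.star_eq_adjoint, ContinuousLinearMap.adjoint_inner_right, hT,
    D.inner_coSlice]

end ObataData

/-- The data of the theorem, with the bounded extensions `S i` of the slices `(id ⊗ τ) ∂ᵢ`. -/
structure SliceData (X : Fin n → H →L[ℂ] H) (Ω : H) (ξ : Fin n → H)
    (Jac : Fin n → Fin n → Coarse H →L[ℂ] Coarse H) (J : H →ₗᵢ⋆[ℂ] H) (S : Fin n → H →L[ℂ] H) : Prop
    extends ObataData X Ω ξ Jac J where
  S_apply : ∀ i p, S i (evalVec X Ω p) = evalVec X Ω (slice (vacFun X Ω) i p)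
  star_S_apply : ∀ i p, star (S i) (evalVec X Ω p) = coSlice X Ω ξ i p

theorem ObataData.exists_sliceData {X : Fin n → H →L[ℂ] H} {Ω : H} {ξ : Fin n → H}
    {Jac : Fin n → Fin n → Coarse H →L[ℂ] Coarse H} {J : H →ₗᵢ⋆[ℂ] H}
    (D : ObataData X Ω ξ Jac J) : ∃ S, SliceData X Ω ξ Jac J S := by
  choose S hS hS' using D.exists_slice_op
  exact ⟨S, D, hS, hS'⟩

namespace SliceData

variable {X : Fin n → H →L[ℂ] H} {Ω : H} {ξ : Fin n → H}
  {Jac : Fin n → Fin n → Coarse H →L[ℂ] Coarse H} {J : H →ₗᵢ⋆[ℂ] H} {S : Fin n → H →L[ℂ] H}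
  (D : SliceData X Ω ξ Jac J S)
include D

/-- Coassociativity, extended to the closure of ∂_j now that the slice is bounded. -/
theorem S_mem (i : Fin n) {j : Fin n} {h : H} {η : Coarse H} (hm : (h, η) ∈ dgraph X Ω j) :
    (S i h, opTens 1 (S i) η) ∈ dgraph X Ω j := by
  refine dgraph_induction (P := fun h η => (S i h, opTens 1 (S i) η) ∈ dgraph X Ω j)
    ((isClosed_dgraph X Ω j).preimage (by fun_prop)) (fun p => ?_) hm
  rw [D.S_apply, evalDiff_eq, opTens_tmap_right (S i) _ _ (evalVec X Ω ∘ₗ slice (vacFun X Ω) i) (D.S_apply i)]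
  have := poly_mem_dgraph X Ω j (slice (vacFun X Ω) i p)
  rw [evalDiff_eq, freeDiff_slice, tmap_map_id] at this
  exact this

/-- The adjoint slice commutes with ∂̄_j only up to the Jacobian; this defect is the source of the
curvature term in the Bochner formula. -/
theorem star_S_mem (i : Fin n) {j : Fin n} {h : H} {η : Coarse H} (hm : (h, η) ∈ dgraph X Ω j) :
    (star (S i) h, opTens 1 (star (S i)) η + jacR Jac J j i (tens h Ω)) ∈ dgraph X Ω j := by
  refine dgraph_induction (P := fun h η => (star (S i) h, opTens 1 (star (S i)) η +
    jacR Jac J j i (tens h Ω)) ∈ dgraph X Ω j)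
    ((isClosed_dgraph X Ω j).preimage ?_) (fun p => ?_) hm
  · have : Continuous fun x : H × Coarse H => jacR Jac J j i (tens x.1 Ω) :=
      (jacR Jac J j i).continuous.comp ((tensR Ω).continuous.comp continuous_fst)
    fun_prop
  rw [D.star_S_apply, evalDiff_eq, opTens_tmap_right _ _ _ _ (D.star_S_apply i), add_comm]
  exact D.coSlice_mem i j p

/-- `S + S*` is right multiplication by the conjugate variable. -/
theorem S_add_star_S (i : Fin n) (p : FreeAlgebra ℂ (Fin n)) :
    S i (evalVec X Ω p) + star (S i) (evalVec X Ω p) = pol X p (ξ i) := by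
  rw [D.S_apply, D.star_S_apply, coSlice, LinearMap.sub_apply]
  simp [polAt]

theorem S_vac (i : Fin n) : S i Ω = 0 := by
  have := D.S_apply i 1
  rw [slice_one, map_zero] at this
  simpa [evalVec_apply] using this

theorem star_S_vac (i : Fin n) : star (S i) Ω = ξ i := by
  have := D.S_add_star_S i 1
  simpa [evalVec_apply, D.S_vac] using this

/-- The slices of ∂_i u are values of the commutator [S_i, u]: on polynomial vectors c this is the
Leibniz rule for S_i(u c), and both sides are continuous in c. -/
theorem slice_evalDiff (i : Fin n) (u : FreeAlgebra ℂ (Fin n)) (c : H) :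
    sliceR (J c) (evalDiff X Ω i u) = S i (pol X u c) - pol X u (S i c) := by
  refine ext_inner_left ℂ fun z => ?_
  rw [inner_sliceR]
  have hc : Continuous fun c => tens z (J c) := (tensL z).continuous.comp J.continuous
  refine congrFun (D.dense_poly.equalizer (g := fun c => ⟪tens z (J c), evalDiff X Ω i u⟫_ℂ)
    (h := fun c => ⟪z, S i (pol X u c) - pol X u (S i c)⟫_ℂ) (by fun_prop) (by fun_prop)
    (funext fun p => ?_)) c
  have h1 : pol X u (evalVec X Ω p) = evalVec X Ω (u * p) := by simp [evalVec_apply, pol]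
  have h2 : ∀ q, ⟪J (evalVec X Ω p), evalVec X Ω q⟫_ℂ =
      (vacFun X Ω ∘ₗ LinearMap.mulRight ℂ p) q := by
    intro q
    rw [evalVec_apply, D.std.J_apply _ (pol_mem X p),
      ← D.std.rt_vac _ (vn_star_mem (pol_mem X p)), ← D.std.star_rt,
      ContinuousLinearMap.star_eq_adjoint, ContinuousLinearMap.adjoint_inner_left, D.rt_evalVec]
    rfl
  simp only [Function.comp_apply]
  rw [← inner_sliceR, evalDiff_eq, sliceR_tmap X Ω _ _ _ h2, h1, D.S_apply, D.S_apply, slice_mul,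
    map_add]
  congr 1
  simp [evalVec_apply, pol, slice]

end SliceData

end Slices

/-! ### Weak limits of operators on the coarse Hilbert space -/

section WeakLimits

theorem isClosed_setOf_tendsto_of_lipschitz {E : Type*} [NormedAddCommGroup E] {l : Filter ℕ}
    {F : ℕ → E → ℂ} {G : E → ℂ} {C : ℝ} (hF : ∀ m x y, ‖F m x - F m y‖ ≤ C * ‖x - y‖)
    (hG : Continuous G) : IsClosed {x | Tendsto (fun m => F m x) l (𝓝 (G x))} := by
  refine Equicontinuous.isClosed_setOfPred_tendsto (UniformEquicontinuous.equicontinuous ?_) hG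
  refine LipschitzWith.uniformEquicontinuous F (Real.toNNReal C) fun m =>
    LipschitzWith.of_dist_le_mul fun x y => ?_
  rw [dist_eq_norm, dist_eq_norm]
  exact (hF m x y).trans (by gcongr; exact Real.le_coe_toNNReal C)

variable {H : Type u} [NormedAddCommGroup H] [InnerProductSpace ℂ H] [CompleteSpace H]

theorem tendsto_inner_coarse {l : Filter ℕ} {T : ℕ → Coarse H →L[ℂ] Coarse H}
    {T' : Coarse H →L[ℂ] Coarse H} {C : ℝ} (hC : ∀ m, ‖T m‖ ≤ C)
    (h : ∀ a b c d, Tendsto (fun m => ⟪tens a b, T m (tens c d)⟫_ℂ) l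
      (𝓝 ⟪tens a b, T' (tens c d)⟫_ℂ)) (z w : Coarse H) :
    Tendsto (fun m => ⟪z, T m w⟫_ℂ) l (𝓝 ⟪z, T' w⟫_ℂ) := by
  have hC0 : 0 ≤ C := (ContinuousLinearMap.opNorm_nonneg _).trans (hC 0)
  induction w using tens_closure_induction with
  | hc =>
    refine isClosed_setOf_tendsto_of_lipschitz (C := ‖z‖ * C) (fun m x y => ?_)
      (G := fun w => ⟪z, T' w⟫_ℂ) (by fun_prop)
    rw [← inner_sub_right, ← map_sub, mul_assoc]
    exact (norm_inner_le_norm _ _).trans (by gcongr; exact (T m).le_of_opNorm_le (hC m) _)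
  | hadd x y hx hy => simpa only [map_add, inner_add_right] using hx.add hy
  | h0 c d =>
    induction z using tens_closure_induction with
    | hc =>
      refine isClosed_setOf_tendsto_of_lipschitz (C := C * ‖tens c d‖) (fun m x y => ?_)
        (G := fun z => ⟪z, T' (tens c d)⟫_ℂ) (by fun_prop)
      rw [← inner_sub_left, mul_comm]
      exact (norm_inner_le_norm _ _).trans (by gcongr; exact (T m).le_of_opNorm_le (hC m) _)
    | hadd x y hx hy => simpa only [inner_add_left] using hx.add hy
    | h0 a b => exact h a b c d

theorem norm_opTens_le (x y : H →L[ℂ] H) : ‖opTens x y‖ ≤ ‖x‖ * ‖y‖ := by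
  refine ContinuousLinearMap.opNorm_le_bound _ (by positivity) fun v => ?_
  refine UniformSpace.Completion.induction_on v (isClosed_le (by fun_prop) (by fun_prop)) fun w => ?_
  simp only [opTens, ContinuousLinearMap.completion_apply_coe, UniformSpace.Completion.norm_coe]
  exact (TensorProduct.mapL x y).le_of_opNorm_le (TensorProduct.norm_mapL_le x y) w

theorem tendsto_inner_opTens {l : Filter ℕ} {x y : ℕ → H →L[ℂ] H} {x' y' : H →L[ℂ] H} {C D : ℝ}
    (hC : ∀ m, ‖x m‖ ≤ C) (hD : ∀ m, ‖y m‖ ≤ D)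
    (hx : ∀ z v, Tendsto (fun m => ⟪z, x m v⟫_ℂ) l (𝓝 ⟪z, x' v⟫_ℂ))
    (hy : ∀ z v, Tendsto (fun m => ⟪z, y m v⟫_ℂ) l (𝓝 ⟪z, y' v⟫_ℂ)) (z w : Coarse H) :
    Tendsto (fun m => ⟪z, opTens (x m) (y m) w⟫_ℂ) l (𝓝 ⟪z, opTens x' y' w⟫_ℂ) := by
  have hC0 : 0 ≤ C := (ContinuousLinearMap.opNorm_nonneg _).trans (hC 0)
  refine tendsto_inner_coarse (C := C * D) (fun m => (norm_opTens_le _ _).trans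
    (mul_le_mul (hC m) (hD m) (norm_nonneg _) hC0)) (fun a b c d => ?_) z w
  simp only [opTens_tens, inner_tens]
  exact (hx a c).mul (hy b d)

theorem tendsto_inner_rt {J : H →ₗᵢ⋆[ℂ] H} (hJ : ∀ x, J (J x) = x) {l : Filter ℕ}
    {x : ℕ → H →L[ℂ] H} {x' : H →L[ℂ] H}
    (hx : ∀ z v, Tendsto (fun m => ⟪z, x m v⟫_ℂ) l (𝓝 ⟪z, x' v⟫_ℂ)) (z v : H) :
    Tendsto (fun m => ⟪z, rt J (x m) v⟫_ℂ) l (𝓝 ⟪z, rt J x' v⟫_ℂ) := by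
  have : ∀ y : H →L[ℂ] H, ⟪z, rt J y v⟫_ℂ = ⟪J v, y (J z)⟫_ℂ := fun y => by
    rw [rt_apply, antiunitary_inner_right hJ, ContinuousLinearMap.star_eq_adjoint,
      ContinuousLinearMap.adjoint_inner_left]
  simpa only [this] using hx (J v) (J z)

theorem tendsto_inner_star {l : Filter ℕ} {x : ℕ → H →L[ℂ] H} {x' : H →L[ℂ] H}
    (hx : ∀ z v, Tendsto (fun m => ⟪z, x m v⟫_ℂ) l (𝓝 ⟪z, x' v⟫_ℂ)) (z v : H) :
    Tendsto (fun m => ⟪z, star (x m) v⟫_ℂ) l (𝓝 ⟪z, star x' v⟫_ℂ) := by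
  have : ∀ y : H →L[ℂ] H, ⟪z, star y v⟫_ℂ = starRingEnd ℂ ⟪v, y z⟫_ℂ := fun y => by
    rw [ContinuousLinearMap.star_eq_adjoint, ContinuousLinearMap.adjoint_inner_right,
      inner_conj_symm]
  simp only [this]
  exact (Complex.continuous_conj.tendsto _).comp (hx v z)

theorem norm_rt_le {J : H →ₗᵢ⋆[ℂ] H} (x : H →L[ℂ] H) : ‖rt J x‖ ≤ ‖x‖ :=
  (norm_cj_le J _).trans_eq (norm_star x)

end WeakLimits

/-! ### Bounded elements of the domain -/

section BoundedElements

variable {H : Type u} [NormedAddCommGroup H] [InnerProductSpace ℂ H] [CompleteSpace H] {n : ℕ}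

/-- `x ∈ M` lies in the domain of each `∂̄ⱼ`, with `∂̄ⱼ x = ηⱼ`, and this is witnessed by polynomials
that are bounded in operator norm. -/
structure IsBdd (X : Fin n → H →L[ℂ] H) (Ω : H) (x : H →L[ℂ] H) (η : Fin n → Coarse H) : Prop where
  mem : x ∈ wStar (Set.range X)
  approx : ∀ j, ∃ (q : ℕ → FreeAlgebra ℂ (Fin n)) (C : ℝ), (∀ m, ‖pol X (q m)‖ ≤ C) ∧
    (∀ z v, Tendsto (fun m => ⟪z, pol X (q m) v⟫_ℂ) (hyperfilter ℕ) (𝓝 ⟪z, x v⟫_ℂ)) ∧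
    ∀ z, Tendsto (fun m => ⟪z, evalDiff X Ω j (q m)⟫_ℂ) (hyperfilter ℕ) (𝓝 ⟪z, η j⟫_ℂ)

theorem IsBdd.mem_dgraph {X : Fin n → H →L[ℂ] H} {Ω : H} {x : H →L[ℂ] H} {η : Fin n → Coarse H}
    (hx : IsBdd X Ω x η) (j : Fin n) : (x Ω, η j) ∈ dgraph X Ω j := by
  obtain ⟨q, C, -, h2, h3⟩ := hx.approx j
  exact mem_prod_of_weak_limit (isClosed_dgraph X Ω j) (fun z => h2 z Ω) h3
    fun m => poly_mem_dgraph X Ω j (q m)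

namespace ObataData

variable {X : Fin n → H →L[ℂ] H} {Ω : H} {ξ : Fin n → H}
  {Jac : Fin n → Fin n → Coarse H →L[ℂ] Coarse H} {J : H →ₗᵢ⋆[ℂ] H}
  (D : ObataData X Ω ξ Jac J)
include D

theorem isBdd_star {x : H →L[ℂ] H} {η : Fin n → Coarse H} (hx : IsBdd X Ω x η) :
    IsBdd X Ω (star x) fun j => tensStar J (η j) := by
  refine ⟨vn_star_mem hx.mem, fun j => ?_⟩
  obtain ⟨q, C, h1, h2, h3⟩ := hx.approx j
  choose q' hq1 hq2 using fun m => D.exists_star_poly (q m)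
  refine ⟨q', C, fun m => by rw [hq1, norm_star]; exact h1 m, ?_, fun z => ?_⟩
  · simp only [hq1]
    exact tendsto_inner_star h2
  · have : ∀ y, ⟪z, tensStar J y⟫_ℂ = starRingEnd ℂ ⟪tensStar J z, y⟫_ℂ := fun y => by
      rw [inner_conj_symm, ← inner_tensStar J, tensStar_tensStar D.std.J_J]
    simp only [hq2, this]
    exact (Complex.continuous_conj.tendsto _).comp (h3 _)

/-- Only commutation with right multiplications is asked of `x`, not an approximation bounded in
norm: it will be applied to left multiplication by aξ_i - s. -/
theorem leibniz_right_poly {j : Fin n} {x : H →L[ℂ] H}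
    (hx : ∀ y ∈ wStar (Set.range X), ∀ v, rt J y (x v) = x (rt J y v)) {η : Coarse H}
    (hm : (x Ω, η) ∈ dgraph X Ω j) (q : FreeAlgebra ℂ (Fin n)) :
    (x (evalVec X Ω q), opTens 1 (rt J (pol X q)) η + opTens x 1 (evalDiff X Ω j q)) ∈
      dgraph X Ω j := by
  obtain ⟨p, hp, hp'⟩ := exists_poly_seq hm
  have h1 : ∀ t : FreeAlgebra ℂ (Fin n) ⊗[ℂ] FreeAlgebra ℂ (Fin n),
      Tendsto (fun m => opTens (pol X (p m)) 1 (tmap (evalVec X Ω) (evalVec X Ω) t)) atTop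
        (𝓝 (opTens x 1 (tmap (evalVec X Ω) (evalVec X Ω) t))) := by
    intro t
    induction t using TensorProduct.induction_on with
    | zero => simp
    | add x y hx hy => simpa only [map_add] using hx.add hy
    | tmul a b =>
      simp only [tmap_tmul, opTens_tens, one_apply_eq_self]
      -- Writing p_m a as right multiplication by a applied to p_mΩ makes convergence of p_mΩ
      -- sufficient.
      have h2 : ∀ m, pol X (p m) (evalVec X Ω a) = rt J (pol X a) (evalVec X Ω (p m)) := fun m => by
        rw [D.rt_evalVec]; simp [evalVec_apply, pol]
      have h3 : x (evalVec X Ω a) = rt J (pol X a) (x Ω) := by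
        rw [hx _ (pol_mem X a), D.std.rt_vac _ (pol_mem X a), evalVec_apply]
      simp only [h2, h3]
      exact ((tensR (evalVec X Ω b)).continuous.tendsto _).comp
        (((rt J (pol X a)).continuous.tendsto _).comp hp)
  have h4 : x (evalVec X Ω q) = rt J (pol X q) (x Ω) := by
    rw [hx _ (pol_mem X q), D.std.rt_vac _ (pol_mem X q), evalVec_apply]
  rw [h4]
  refine (isClosed_dgraph X Ω j).mem_of_tendsto
    (b := atTop) (f := fun m => (rt J (pol X q) (evalVec X Ω (p m)),
      opTens 1 (rt J (pol X q)) (evalDiff X Ω j (p m)) +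
        opTens (pol X (p m)) 1 (evalDiff X Ω j q))) ?_ (Eventually.of_forall fun m => ?_)
  · exact (((rt J (pol X q)).continuous.tendsto _).comp hp).prodMk_nhds
      ((((opTens 1 (rt J (pol X q))).continuous.tendsto _).comp hp').add (h1 _))
  · have := poly_mem_dgraph X Ω j (p m * q)
    rw [D.evalDiff_mul, ← D.rt_evalVec, add_comm] at this
    exact this

/-- The Leibniz rule. -/
theorem leibniz {j : Fin n} {x : H →L[ℂ] H}
    (hx : ∀ y ∈ wStar (Set.range X), ∀ v, rt J y (x v) = x (rt J y v)) {η : Coarse H}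
    (hm : (x Ω, η) ∈ dgraph X Ω j) {b : H →L[ℂ] H} {β : Fin n → Coarse H} (hb : IsBdd X Ω b β) :
    (x (b Ω), opTens 1 (rt J b) η + opTens x 1 (β j)) ∈ dgraph X Ω j := by
  obtain ⟨q, C, h1, h2, h3⟩ := hb.approx j
  refine mem_prod_of_weak_limit (isClosed_dgraph X Ω j) (l := hyperfilter ℕ)
    (x := fun m => x (evalVec X Ω (q m))) (x' := fun m => opTens 1 (rt J (pol X (q m))) η +
      opTens x 1 (evalDiff X Ω j (q m))) (fun z => ?_) (fun z => ?_)
    fun m => D.leibniz_right_poly hx hm (q m)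
  · simpa only [ContinuousLinearMap.adjoint_inner_left, evalVec_apply] using h2 (x.adjoint z) Ω
  · simp only [inner_add_right]
    refine Tendsto.add ?_ ?_
    · exact tendsto_inner_opTens (C := ‖(1 : H →L[ℂ] H)‖) (fun _ => le_rfl)
        (fun m => (norm_rt_le _).trans (h1 m)) (fun _ _ => tendsto_const_nhds)
        (tendsto_inner_rt D.std.J_J h2) z η
    · simpa only [ContinuousLinearMap.adjoint_inner_left] using h3 ((opTens x 1).adjoint z)

theorem leibniz_bdd {j : Fin n} {a b : H →L[ℂ] H} {α β : Fin n → Coarse H} (ha : IsBdd X Ω a α)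
    (hb : IsBdd X Ω b β) :
    (a (b Ω), opTens 1 (rt J b) (α j) + opTens a 1 (β j)) ∈ dgraph X Ω j :=
  D.leibniz (fun _ hy v => D.std.rt_comm hy ha.mem v) (ha.mem_dgraph j) hb

theorem J_conj_var (i : Fin n) : J (ξ i) = ξ i := by
  refine D.poly_ext_inner fun p => ?_
  obtain ⟨q, hq1, hq2⟩ := D.exists_star_poly p
  have h1 : J (evalVec X Ω p) = evalVec X Ω q := by
    rw [evalVec_apply, D.std.J_apply _ (pol_mem X p), evalVec_apply, hq1]
  have h3 : tens Ω Ω = tensStar J (tens Ω Ω) := by rw [tensStar_tens, D.std.J_vac]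
  rw [antiunitary_inner_right D.std.J_J, h1, D.inner_conj_var, hq2]
  conv_lhs => rw [h3]
  rw [inner_tensStar, ← inner_conj_symm, ← D.inner_conj_var, inner_conj_symm]

end ObataData

namespace SliceData

variable {X : Fin n → H →L[ℂ] H} {Ω : H} {ξ : Fin n → H}
  {Jac : Fin n → Fin n → Coarse H →L[ℂ] Coarse H} {J : H →ₗᵢ⋆[ℂ] H} {S : Fin n → H →L[ℂ] H}
  (D : SliceData X Ω ξ Jac J S)
include D

theorem cj_S_mem (i : Fin n) {j : Fin n} {h : H} {η : Coarse H} (hm : (h, η) ∈ dgraph X Ω j) :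
    (cj J (S i) h, opTens (cj J (S i)) 1 η) ∈ dgraph X Ω j := by
  have h1 := D.star_mem_dgraph (D.S_mem i (D.star_mem_dgraph hm))
  rw [tensStar_opTens D.std.J_J, tensStar_tensStar D.std.J_J, cj_one D.std.J_J] at h1
  exact h1

/-- Right multiplication by `ξᵢ` commutes with `M`. -/
theorem conj_mul_comm (i : Fin n) {x : H →L[ℂ] H} (hx : x ∈ wStar (Set.range X)) (v : H) :
    (S i + star (S i)) (x v) = x ((S i + star (S i)) v) := by
  have h0 : ∀ k, X k * (S i + star (S i)) = (S i + star (S i)) * X k := fun k =>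
    D.poly_ext fun p => by
      have h1 : X k (evalVec X Ω p) = evalVec X Ω (FreeAlgebra.ι ℂ k * p) := by
        simp [evalVec_apply, pol]
      have h2 := D.S_add_star_S i p
      have h3 := D.S_add_star_S i (FreeAlgebra.ι ℂ k * p)
      simp only [mul_apply_eq_comp, add_apply] at *
      rw [h1, h2, h3]; simp [pol]
  have h1 := mem_wStar_iff.1 hx (S i + star (S i)) (by rintro _ ⟨k, rfl⟩; exact h0 k)
    (by rintro _ ⟨k, rfl⟩; rw [(D.sa k).star_eq]; exact h0 k)
  exact congrArg (fun T : H →L[ℂ] H => T v) h1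

theorem slice_bdd {u : H →L[ℂ] H} {η : Fin n → Coarse H} (hu : IsBdd X Ω u η) (i : Fin n) (c : H) :
    sliceR (J c) (η i) = S i (u c) - u (S i c) := by
  obtain ⟨q, C, -, h2, h3⟩ := hu.approx i
  refine ext_inner_left ℂ fun z => tendsto_nhds_unique (l := hyperfilter ℕ)
    (f := fun m => ⟪z, sliceR (J c) (evalDiff X Ω i (q m))⟫_ℂ) ?_ ?_
  · simpa only [inner_sliceR] using h3 (tens z (J c))
  · simp only [D.slice_evalDiff, inner_sub_right]
    refine Tendsto.sub ?_ (h2 _ _)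
    simpa only [ContinuousLinearMap.adjoint_inner_left] using h2 ((S i).adjoint z) c

theorem sliceR_bdd {u : H →L[ℂ] H} {η : Fin n → Coarse H} (hu : IsBdd X Ω u η) (i : Fin n)
    {b : H →L[ℂ] H} (hb : b ∈ wStar (Set.range X)) :
    sliceR (b Ω) (η i) = S i (u (star b Ω)) - u (J (cj J (S i) (b Ω))) := by
  rw [cj_apply, D.std.J_J, D.std.J_apply b hb, ← D.slice_bdd hu, ← D.std.J_apply b hb, D.std.J_J]

theorem sliceL_bdd {u : H →L[ℂ] H} {η : Fin n → Coarse H} (hu : IsBdd X Ω u η) (i : Fin n)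
    {a : H →L[ℂ] H} (ha : a ∈ wStar (Set.range X)) :
    sliceL (a Ω) (η i) = cj J (S i) (star a (u Ω)) - rt J u (J (S i (a Ω))) := by
  rw [sliceL_eq D.std.J_J, D.slice_bdd (D.isBdd_star hu), map_sub, cj_apply, rt_apply,
    D.std.J_J]
  congr 3
  have := D.std.J_apply _ (vn_mul_mem (vn_star_mem ha) hu.mem)
  simpa using this.symm

/-- The formula for `∂ᵢ* (a ⊗ b)`. -/
theorem inner_tens_dgraph (i : Fin n) {h : H} {η : Coarse H} (hm : (h, η) ∈ dgraph X Ω i)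
    {a b : H →L[ℂ] H} (ha : a ∈ wStar (Set.range X)) (hb : b ∈ wStar (Set.range X)) :
    ⟪tens (a Ω) (b Ω), η⟫_ℂ =
      ⟪rt J b (star (S i) (a Ω)) - a (cj J (S i) (b Ω)), h⟫_ℂ := by
  refine dgraph_induction (P := fun h η => ⟪tens (a Ω) (b Ω), η⟫_ℂ =
      ⟪rt J b (star (S i) (a Ω)) - a (cj J (S i) (b Ω)), h⟫_ℂ)
      (isClosed_eq (by fun_prop) (by fun_prop)) (fun p => ?_) hm
  have hs := D.slice_evalDiff i p (J (b Ω))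
  rw [D.std.J_J] at hs
  rw [← inner_sliceR, hs, inner_sub_right, inner_sub_left]
  congr 1
  · rw [← ContinuousLinearMap.adjoint_inner_left, ← ContinuousLinearMap.star_eq_adjoint,
      D.std.J_apply b hb, ← D.std.rt_vac _ (vn_star_mem hb),
      ← D.std.rt_comm (vn_star_mem hb) (pol_mem X p), ← D.std.star_rt,
      ContinuousLinearMap.star_eq_adjoint (rt J b), ContinuousLinearMap.adjoint_inner_right]
    rfl
  · have h1 : a (cj J (S i) (b Ω)) = a (J (S i (J (b Ω)))) := rfl
    have h2 := D.std.J_apply _ (vn_mul_mem (vn_star_mem ha) (pol_mem X p))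
    simp only [mul_apply_eq_comp, star_mul, star_star] at h2
    rw [h1, ← ContinuousLinearMap.adjoint_inner_left (pol X p),
      ← ContinuousLinearMap.adjoint_inner_right a, antiunitary_inner_left D.std.J_J, evalVec_apply,
      ← ContinuousLinearMap.star_eq_adjoint, ← ContinuousLinearMap.star_eq_adjoint, h2]

end SliceData

end BoundedElements

/-! ### Commutation of the difference quotients with the Laplacian -/

section Commutation

variable {H : Type u} [NormedAddCommGroup H] [InnerProductSpace ℂ H] [CompleteSpace H] {n : ℕ}

/-- `h` is in the domain of every `∂̄ⱼ`, with `∂̄ⱼ h = ηⱼ`. -/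
def InDom (X : Fin n → H →L[ℂ] H) (Ω h : H) (η : Fin n → Coarse H) : Prop :=
  ∀ j, (h, η j) ∈ dgraph X Ω j

/-- `w = ∂* η`, in the weak sense. -/
def IsDiv (X : Fin n → H →L[ℂ] H) (Ω : H) (η : Fin n → Coarse H) (w : H) : Prop :=
  ∀ z ζ, InDom X Ω z ζ → ⟪w, z⟫_ℂ = ∑ j, ⟪η j, ζ j⟫_ℂ

theorem IsDiv.symm {X : Fin n → H →L[ℂ] H} {Ω w : H} {η : Fin n → Coarse H}
    (hw : IsDiv X Ω η w) {z : H} {ζ : Fin n → Coarse H} (hz : InDom X Ω z ζ) :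
    ⟪z, w⟫_ℂ = ∑ j, ⟪ζ j, η j⟫_ℂ := by
  rw [← inner_conj_symm, hw z ζ hz, map_sum]
  simp only [inner_conj_symm]

theorem InDom.sub {X : Fin n → H →L[ℂ] H} {Ω h k : H} {η ζ : Fin n → Coarse H}
    (hh : InDom X Ω h η) (hk : InDom X Ω k ζ) : InDom X Ω (h - k) (fun j => η j - ζ j) :=
  fun j => sub_mem (hh j) (hk j)

theorem InDom.smul {X : Fin n → H →L[ℂ] H} {Ω h : H} {η : Fin n → Coarse H} (c : ℂ)
    (hh : InDom X Ω h η) : InDom X Ω (c • h) (fun j => c • η j) :=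
  fun j => Submodule.smul_mem _ c (hh j)

/-- The bounded elements form a core for `(∂̄ⱼ)ⱼ`. -/
def BddIsCore (X : Fin n → H →L[ℂ] H) (Ω : H) : Prop :=
  ∀ h η, InDom X Ω h η → ∃ (t : ℕ → H →L[ℂ] H) (τ : ℕ → Fin n → Coarse H),
    (∀ m, IsBdd X Ω (t m) (τ m)) ∧ Tendsto (fun m => t m Ω) atTop (𝓝 h) ∧
      Tendsto τ atTop (𝓝 η)

namespace SliceData

variable {X : Fin n → H →L[ℂ] H} {Ω : H} {ξ : Fin n → H}
  {Jac : Fin n → Fin n → Coarse H →L[ℂ] Coarse H} {J : H →ₗᵢ⋆[ℂ] H} {S : Fin n → H →L[ℂ] H}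
  (D : SliceData X Ω ξ Jac J S)
include D

theorem cj_conj_mul_comm (i : Fin n) {y : H →L[ℂ] H} (hy : y ∈ wStar (Set.range X)) (v : H) :
    rt J y (cj J (S i + star (S i)) v) = cj J (S i + star (S i)) (rt J y v) := by
  simp only [rt_apply, cj_apply, D.std.J_J, D.conj_mul_comm i (vn_star_mem hy)]

theorem conj_mul_eq (i : Fin n) {a : H →L[ℂ] H} (ha : a ∈ wStar (Set.range X)) :
    a (cj J (S i + star (S i)) Ω) = (S i + star (S i)) (a Ω) := by
  rw [D.conj_mul_comm i ha, cj_apply, D.std.J_vac]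
  simp only [add_apply, D.S_vac, D.star_S_vac, zero_add, D.J_conj_var]

/-- Bochner formula with bounded elements `s` and `t` in place of S_i a and J S_i J b, which are
mere L² vectors and cannot enter a Leibniz rule as factors. Each pairing with w = Δu, a' = Δa or b'
= Δb is then computed from gradients of products. -/
theorem commutation_core (i : Fin n) {u a b t s : H →L[ℂ] H} {υ α β τ σ : Fin n → Coarse H}
    {w a' b' : H} (hu : IsBdd X Ω u υ) (ha : IsBdd X Ω a α) (hb : IsBdd X Ω b β)
    (ht : IsBdd X Ω t τ) (hs : IsBdd X Ω s σ) (hw : IsDiv X Ω υ w) (ha' : IsDiv X Ω α a')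
    (hb' : IsDiv X Ω β b') :
    ⟪w, rt J b ((S i + star (S i)) (a Ω)) - rt J b (s Ω) - a (t Ω)⟫_ℂ
      - ⟪S i (u (star b Ω)) - u (J (t Ω)), a'⟫_ℂ
      - ⟪cj J (S i) (star a (u Ω)) - rt J u (J (s Ω)), b'⟫_ℂ =
    ∑ j, (⟪υ j, opTens 1 (rt J b) (opTens 1 (S i + star (S i)) (α j)) - opTens 1 (rt J b) (σ j) +
        opTens a 1 (opTens (cj J (S i + star (S i))) 1 (β j)) - opTens a 1 (τ j) +
        jacR Jac J j i (tens (a Ω) (b Ω))⟫_ℂ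
      - ⟪opTens 1 (S i) (opTens 1 (rt J (star b)) (υ j) + opTens u 1 (tensStar J (β j))) -
          opTens u 1 (tensStar J (τ j)), α j⟫_ℂ
      - ⟪opTens (cj J (S i)) 1 (opTens 1 (rt J u) (tensStar J (α j)) + opTens (star a) 1 (υ j)) -
          opTens 1 (rt J u) (tensStar J (σ j)), β j⟫_ℂ) := by
  -- R is right multiplication by ξ_i, and B = JRJ is left multiplication by ξ_i.
  set R := S i + star (S i) with hR
  set B := cj J R with hB
  -- Since S_i* a = a ξ_i - S_i a, the operator a B - s stands for left multiplication by S_i* a.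
  have hscomm : ∀ y ∈ wStar (Set.range X), ∀ v, rt J y ((a * B - s) v) = (a * B - s) (rt J y v) := by
    intro y hy v
    simp only [sub_apply, mul_apply_eq_comp, map_sub]
    rw [D.std.rt_comm hy ha.mem, D.cj_conj_mul_comm i hy, D.std.rt_comm hy hs.mem]
  have hsv : (a * B - s) Ω = R (a Ω) - s Ω := by
    rw [sub_apply, mul_apply_eq_comp, D.conj_mul_eq i ha.mem]
  have hsd : InDom X Ω ((a * B - s) Ω) fun j => opTens 1 R (α j) +
      jacR Jac J j i (tens (a Ω) Ω) - σ j := by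
    intro j
    have h1 := add_mem (D.S_mem i (ha.mem_dgraph j)) (D.star_S_mem i (ha.mem_dgraph j))
    have h2 := sub_mem h1 (hs.mem_dgraph j)
    rw [hsv]
    convert h2 using 1
    simp only [hR, opTens_add_right, add_apply, Prod.mk_add_mk, Prod.mk_sub_mk,
      add_assoc]
  -- The vector tested against Δu approximates ∂_i*(a ⊗ b) = (S_i* a) b - a (J S_i J b).
  have e1 := hw _ _ (InDom.sub (fun j => D.leibniz hscomm (hsd j) hb)
    (fun j => D.leibniz_bdd ha ht (j := j)))
  have hsb : (a * B - s) (b Ω) = rt J b (R (a Ω)) - rt J b (s Ω) := by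
    rw [← map_sub, ← hsv, hscomm b hb.mem, D.std.rt_vac b hb.mem]
  have e2 := ha'.symm (InDom.sub (fun j => D.S_mem i (D.leibniz_bdd hu (D.isBdd_star hb) (j := j)))
    (fun j => D.leibniz_bdd hu (D.isBdd_star ht) (j := j)))
  have e3 := hb'.symm (InDom.sub
    (fun j => D.cj_S_mem i (D.leibniz_bdd (D.isBdd_star ha) hu (j := j)))
    (fun j => D.leibniz_bdd (D.isBdd_star hs) hu (j := j)))
  have hJs : rt J u (J (s Ω)) = star s (u Ω) := by
    rw [D.std.J_apply s hs.mem, D.std.rt_vec u hu.mem _ (vn_star_mem hs.mem)]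
  rw [← hsb, D.std.J_apply t ht.mem, hJs, e1, e2, e3, ← Finset.sum_sub_distrib,
    ← Finset.sum_sub_distrib]
  refine Finset.sum_congr rfl fun j _ => ?_
  have hj : opTens 1 (rt J b) (jacR Jac J j i (tens (a Ω) Ω)) =
      jacR Jac J j i (tens (a Ω) (b Ω)) := by
    rw [← D.jacR_comm j i (vn_one_mem _) hb.mem, opTens_tens, D.std.rt_vac b hb.mem]
    rfl
  have hst : ⟪opTens 1 (rt J (star t)) (υ j), α j⟫_ℂ = ⟪υ j, opTens 1 (rt J t) (α j)⟫_ℂ := by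
    rw [inner_opTens_left, star_one, D.std.star_rt, star_star]
  have hss : ⟪opTens (star s) 1 (υ j), β j⟫_ℂ = ⟪υ j, opTens s 1 (β j)⟫_ℂ := by
    rw [inner_opTens_left, star_one, star_star]
  have hmul : opTens (a * B) 1 (β j) = opTens a 1 (opTens B 1 (β j)) := by
    have := opTens_mul a 1 B 1
    rw [one_mul] at this
    rw [this]; rfl
  simp only [opTens_sub_left, sub_apply, inner_add_left, inner_sub_left,
    inner_add_right, inner_sub_right, map_add, map_sub, hst, hss, hmul, hj]
  ring

/-- `∂ᵢ Δ = (Δ ⊗ 1 + 1 ⊗ Δ) ∂ᵢ + ∑ⱼ (𝒥ᵢⱼ) ∂ⱼ`, paired with simple tensors. -/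
theorem commutation (hcore : BddIsCore X Ω) (i : Fin n) {u a b : H →L[ℂ] H}
    {υ α β : Fin n → Coarse H}
    {w a' b' : H} (hu : IsBdd X Ω u υ) (ha : IsBdd X Ω a α) (hb : IsBdd X Ω b β)
    (hw : IsDiv X Ω υ w) (ha' : IsDiv X Ω α a') (hb' : IsDiv X Ω β b') :
    ⟪w, rt J b (star (S i) (a Ω)) - a (cj J (S i) (b Ω))⟫_ℂ =
      ⟪υ i, tens a' (b Ω) + tens (a Ω) b'⟫_ℂ +
        ∑ j, ⟪υ j, jacR Jac J j i (tens (a Ω) (b Ω))⟫_ℂ := by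
  -- J S_i J b and S_i a lie in the domain, so the core supplies bounded t_m and s_m approaching
  -- them together with their gradients.
  obtain ⟨t, τ, ht, htl, hτl⟩ := hcore _ _ fun j => D.cj_S_mem i (hb.mem_dgraph j)
  obtain ⟨s, σ, hs, hsl, hσl⟩ := hcore _ _ fun j => D.S_mem i (ha.mem_dgraph j)
  have key := fun m => D.commutation_core i hu ha hb (ht m) (hs m) hw ha' hb'
  have hτj := fun j => (tendsto_pi_nhds.1 hτl) j
  have hσj := fun j => (tendsto_pi_nhds.1 hσl) j
  have cJ : Tendsto (fun m => J (t m Ω)) atTop (𝓝 (J (cj J (S i) (b Ω)))) :=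
    (J.continuous.tendsto _).comp htl
  have cJ' : Tendsto (fun m => J (s m Ω)) atTop (𝓝 (J (S i (a Ω)))) :=
    (J.continuous.tendsto _).comp hsl
  have lim : ∀ {E F : Type u} [NormedAddCommGroup E] [InnerProductSpace ℂ E]
      [NormedAddCommGroup F] [InnerProductSpace ℂ F] (T : E →L[ℂ] F) {x : ℕ → E} {y : E},
      Tendsto x atTop (𝓝 y) → Tendsto (fun m => T (x m)) atTop (𝓝 (T y)) :=
    fun T _ _ hx => (T.continuous.tendsto _).comp hx
  have L := ((tendsto_const_nhds (x := w)).inner (𝕜 := ℂ) (((tendsto_const_nhds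
      (x := rt J b ((S i + star (S i)) (a Ω)))).sub (lim (rt J b) hsl)).sub (lim a htl))).sub
      ((((tendsto_const_nhds (x := S i (u (star b Ω)))).sub (lim u cJ))).inner (𝕜 := ℂ)
        (tendsto_const_nhds (x := a'))) |>.sub
      ((((tendsto_const_nhds (x := cj J (S i) (star a (u Ω)))).sub (lim (rt J u) cJ'))).inner (𝕜 := ℂ)
        (tendsto_const_nhds (x := b')))
  have cS : ∀ {x : ℕ → Coarse H} {y : Coarse H}, Tendsto x atTop (𝓝 y) →
      Tendsto (fun m => tensStar J (x m)) atTop (𝓝 (tensStar J y)) :=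
    fun hx => ((tensStar J).continuous.tendsto _).comp hx
  have Rl := tendsto_finsetSum (Finset.univ : Finset (Fin n)) fun j _ =>
    (((tendsto_const_nhds (x := υ j)).inner (𝕜 := ℂ)
      (((((tendsto_const_nhds (x := opTens 1 (rt J b) (opTens 1 (S i + star (S i)) (α j)))).sub
        (lim (opTens 1 (rt J b)) (hσj j))).add (tendsto_const_nhds
        (x := opTens a 1 (opTens (cj J (S i + star (S i))) 1 (β j))))).sub
        (lim (opTens a 1) (hτj j))).add
        (tendsto_const_nhds (x := jacR Jac J j i (tens (a Ω) (b Ω)))))).sub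
      (((tendsto_const_nhds (x := opTens 1 (S i) (opTens 1 (rt J (star b)) (υ j) +
        opTens u 1 (tensStar J (β j))))).sub (lim (opTens u 1) (cS (hτj j)))).inner (𝕜 := ℂ)
        (tendsto_const_nhds (x := α j)))).sub
      (((tendsto_const_nhds (x := opTens (cj J (S i)) 1 (opTens 1 (rt J u) (tensStar J (α j)) +
        opTens (star a) 1 (υ j)))).sub (lim (opTens 1 (rt J u)) (cS (hσj j)))).inner (𝕜 := ℂ)
        (tendsto_const_nhds (x := β j)))
  have fin := tendsto_nhds_unique L (Rl.congr fun m => (key m).symm)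
  have hR1 : ⟪υ i, tens a' (b Ω)⟫_ℂ = ⟪S i (u (star b Ω)) - u (J (cj J (S i) (b Ω))), a'⟫_ℂ := by
    rw [← D.sliceR_bdd hu i hb.mem, ← inner_conj_symm, ← inner_sliceR, inner_conj_symm]
  have hL1 : ⟪υ i, tens (a Ω) b'⟫_ℂ =
      ⟪cj J (S i) (star a (u Ω)) - rt J u (J (S i (a Ω))), b'⟫_ℂ := by
    rw [← D.sliceL_bdd hu i ha.mem, ← inner_conj_symm, ← inner_sliceL, inner_conj_symm]
  have hv : rt J b ((S i + star (S i)) (a Ω)) - rt J b (S i (a Ω)) = rt J b (star (S i) (a Ω)) := by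
    rw [add_apply, map_add]; abel
  rw [hv, ← hR1, ← hL1] at fin
  -- In the limit all terms containing S_i cancel, because operators on different legs commute; only
  -- the Jacobian is left.
  have hterm : ∀ j, ⟪υ j, opTens 1 (rt J b) (opTens 1 (S i + star (S i)) (α j)) -
        opTens 1 (rt J b) (opTens 1 (S i) (α j)) +
        opTens a 1 (opTens (cj J (S i + star (S i))) 1 (β j)) -
        opTens a 1 (opTens (cj J (S i)) 1 (β j)) +
        jacR Jac J j i (tens (a Ω) (b Ω))⟫_ℂ
      - ⟪opTens 1 (S i) (opTens 1 (rt J (star b)) (υ j) + opTens u 1 (tensStar J (β j))) -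
          opTens u 1 (tensStar J (opTens (cj J (S i)) 1 (β j))), α j⟫_ℂ
      - ⟪opTens (cj J (S i)) 1 (opTens 1 (rt J u) (tensStar J (α j)) + opTens (star a) 1 (υ j)) -
          opTens 1 (rt J u) (tensStar J (opTens 1 (S i) (α j))), β j⟫_ℂ =
      ⟪υ j, jacR Jac J j i (tens (a Ω) (b Ω))⟫_ℂ := by
    intro j
    have hJ := D.std.J_J
    have comm : ∀ (x y : H →L[ℂ] H) (ζ : Coarse H),
        opTens x 1 (opTens 1 y ζ) = opTens 1 y (opTens x 1 ζ) := fun x y ζ => by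
      have h1 := opTens_mul x 1 1 y
      have h2 := opTens_mul 1 y x 1
      rw [one_mul, mul_one] at h1 h2
      rw [h1] at h2
      exact congrArg (fun T : Coarse H →L[ℂ] Coarse H => T ζ) h2
    rw [tensStar_opTens hJ, tensStar_opTens hJ, cj_one hJ, cj_cj hJ, comm u,
      ← comm (cj J (S i)) (rt J u)]
    have h1 : ⟪opTens 1 (S i) (opTens 1 (rt J (star b)) (υ j)), α j⟫_ℂ =
        ⟪υ j, opTens 1 (rt J b) (opTens 1 (star (S i)) (α j))⟫_ℂ := by
      rw [inner_opTens_left, inner_opTens_left, star_one, D.std.star_rt, star_star]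
    have h2 : ⟪opTens (cj J (S i)) 1 (opTens (star a) 1 (υ j)), β j⟫_ℂ =
        ⟪υ j, opTens a 1 (opTens (cj J (star (S i))) 1 (β j))⟫_ℂ := by
      rw [inner_opTens_left, inner_opTens_left, star_one, star_cj hJ, star_star]
    simp only [map_add, add_sub_cancel_right, add_sub_cancel_left, h1, h2, cj_add, opTens_add_left,
      opTens_add_right, add_apply, inner_add_right, inner_sub_right]
    ring
  simp only [hterm] at fin
  rw [inner_add_right]
  linear_combination fin

end SliceData

end Commutation

/-! ### The resolvents of the Laplacian -/

section Resolvent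

variable {H : Type u} [NormedAddCommGroup H] [InnerProductSpace ℂ H] [CompleteSpace H] {n : ℕ}

/-- `R = (1 + ε Δ)⁻¹` and `V = ∂̄ R`. -/
structure IsResolvent (X : Fin n → H →L[ℂ] H) (Ω : H) (ε : ℝ) (R : H →L[ℂ] H)
    (V : Fin n → H →L[ℂ] Coarse H) : Prop where
  inDom : ∀ g, InDom X Ω (R g) fun j => V j g
  eq : ∀ g z ζ, InDom X Ω z ζ → ⟪g - R g, z⟫_ℂ = ε * ∑ j, ⟪V j g, ζ j⟫_ℂ

/-- `(h, η) ↦ (h, c⁻¹ ηⱼ)`. -/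
def domCoord (c : ℂ) (j : Fin n) :
    WithLp 2 (H × PiLp 2 fun _ : Fin n => Coarse H) →L[ℂ] H × Coarse H :=
  (WithLp.fstL 2 ℂ _ _).prod
    (c⁻¹ • (PiLp.proj 2 (𝕜 := ℂ) (fun _ : Fin n => Coarse H) j).comp (WithLp.sndL 2 ℂ _ _))

/-- The graph of `c (∂̄ⱼ)ⱼ`. -/
def domGraph (X : Fin n → H →L[ℂ] H) (Ω : H) (c : ℂ) :
    Submodule ℂ (WithLp 2 (H × PiLp 2 fun _ : Fin n => Coarse H)) :=
  ⨅ j, (dgraph X Ω j).comap (domCoord c j).toLinearMap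

theorem mem_domGraph {X : Fin n → H →L[ℂ] H} {Ω : H} {c : ℂ}
    {x : WithLp 2 (H × PiLp 2 fun _ : Fin n => Coarse H)} :
    x ∈ domGraph X Ω c ↔ ∀ j, (x.fst, c⁻¹ • x.snd j) ∈ dgraph X Ω j := by
  rw [domGraph, Submodule.mem_iInf]
  rfl

theorem isClosed_domGraph (X : Fin n → H →L[ℂ] H) (Ω : H) (c : ℂ) :
    IsClosed (domGraph X Ω c : Set (WithLp 2 (H × PiLp 2 fun _ : Fin n => Coarse H))) := by
  rw [domGraph, Submodule.coe_iInf]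
  exact isClosed_iInter fun j => (isClosed_dgraph X Ω j).preimage (domCoord c j).continuous

/-- Project (g, 0) orthogonally onto the graph of √ε ∂̄: the components are Rg and √ε ∂̄Rg, and
orthogonality of the remainder is the resolvent equation. -/
theorem exists_isResolvent (X : Fin n → H →L[ℂ] H) (Ω : H) {ε : ℝ} (hε : 0 < ε) :
    ∃ R V, IsResolvent X Ω ε R V := by
  set c : ℂ := ((√ε : ℝ) : ℂ) with hc
  have hc0 : c ≠ 0 := by
    rw [hc]; exact_mod_cast (Real.sqrt_pos.2 hε).ne'
  have hcc : c * c = ε := by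
    rw [hc, ← Complex.ofReal_mul, Real.mul_self_sqrt hε.le]
  have hcs : starRingEnd ℂ c = c := by rw [hc, Complex.conj_ofReal]
  let E := WithLp 2 (H × PiLp 2 fun _ : Fin n => Coarse H)
  have hcomp : CompleteSpace (domGraph X Ω c) := (isClosed_domGraph X Ω c).completeSpace_coe
  let inl : H →L[ℂ] E := (WithLp.prodContinuousLinearEquiv 2 ℂ H
    (PiLp 2 fun _ : Fin n => Coarse H)).symm.toContinuousLinearMap.comp
      (ContinuousLinearMap.inl ℂ H (PiLp 2 fun _ : Fin n => Coarse H))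
  let P : H →L[ℂ] E := (domGraph X Ω c).starProjection.comp inl
  refine ⟨(WithLp.fstL 2 ℂ _ _).comp P, fun j => c⁻¹ •
    ((PiLp.proj 2 (𝕜 := ℂ) (fun _ : Fin n => Coarse H) j).comp ((WithLp.sndL 2 ℂ _ _).comp P)),
    ⟨fun g j => ?_, fun g z ζ hz => ?_⟩⟩
  · exact mem_domGraph.1 (Submodule.starProjection_apply_mem (domGraph X Ω c) (inl g)) j
  · have h1 : WithLp.toLp 2 (z, WithLp.toLp 2 fun j => c • ζ j) ∈ domGraph X Ω c := by
      rw [mem_domGraph]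
      intro j
      have h0 : c⁻¹ • c • ζ j = ζ j := by rw [smul_smul, inv_mul_cancel₀ hc0, one_smul]
      change (z, c⁻¹ • c • ζ j) ∈ _
      rw [h0]
      exact hz j
    have h2 := (Submodule.mem_orthogonal' _ _).1
      (Submodule.sub_starProjection_mem_orthogonal (K := domGraph X Ω c) (inl g)) _ h1
    rw [WithLp.prod_inner_apply, PiLp.inner_apply] at h2
    have h3 : ⟪g - (P g).fst, z⟫_ℂ = ∑ j, ⟪(P g).snd j, c • ζ j⟫_ℂ := by
      have h4 : ∀ j, ⟪(inl g - P g).snd j, c • ζ j⟫_ℂ = - ⟪(P g).snd j, c • ζ j⟫_ℂ := by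
        intro j
        rw [← inner_neg_left]
        congr 1
        exact zero_sub _
      have h5 : (inl g - P g).fst = g - (P g).fst := rfl
      have h6 : ⟪(inl g - P g).fst, z⟫_ℂ + ∑ j, ⟪(inl g - P g).snd j, c • ζ j⟫_ℂ = 0 := h2
      simp only [h4, h5, Finset.sum_neg_distrib] at h6
      linear_combination h6
    refine h3.trans ?_
    rw [Finset.mul_sum]
    refine Finset.sum_congr rfl fun j _ => ?_
    change _ = (ε : ℂ) * ⟪c⁻¹ • (P g).snd j, ζ j⟫_ℂ
    rw [inner_smul_left, inner_smul_right, map_inv₀, hcs, ← hcc]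
    field_simp

namespace IsResolvent

variable {X : Fin n → H →L[ℂ] H} {Ω : H} {ε : ℝ} {R : H →L[ℂ] H} {V : Fin n → H →L[ℂ] Coarse H}
  (h : IsResolvent X Ω ε R V)
include h

theorem inner_eq (g : H) {z : H} {ζ : Fin n → Coarse H} (hz : InDom X Ω z ζ) :
    ⟪g, z⟫_ℂ = ⟪R g, z⟫_ℂ + ε * ∑ j, ⟪V j g, ζ j⟫_ℂ := by
  rw [← h.eq g z ζ hz, inner_sub_left]; ring

theorem isSelfAdjoint : IsSelfAdjoint R := by
  rw [ContinuousLinearMap.isSelfAdjoint_iff_isSymmetric]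
  intro x y
  have h1 := h.inner_eq y (h.inDom x)
  have h2 := h.inner_eq x (h.inDom y)
  change ⟪R x, y⟫_ℂ = ⟪x, R y⟫_ℂ
  rw [h2, ← inner_conj_symm, h1, map_add, inner_conj_symm, map_mul, map_sum, Complex.conj_ofReal]
  simp only [inner_conj_symm]

theorem inner_self (g : H) : ⟪g, R g⟫_ℂ = ((‖R g‖ ^ 2 + ε * ∑ j, ‖V j g‖ ^ 2 : ℝ) : ℂ) := by
  rw [h.inner_eq g (h.inDom g)]
  simp [inner_self_eq_norm_sq_to_K]

theorem energy (g : H) : ‖R g‖ ^ 2 + ε * ∑ j, ‖V j g‖ ^ 2 ≤ ‖g‖ * ‖R g‖ := by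
  have h1 : ‖⟪g, R g⟫_ℂ‖ ≤ ‖g‖ * ‖R g‖ := norm_inner_le_norm _ _
  rw [h.inner_self, Complex.norm_real] at h1
  exact (le_abs_self _).trans h1

theorem norm_apply_le (hε : 0 < ε) (g : H) : ‖R g‖ ≤ ‖g‖ := by
  have h1 := h.energy g
  have h2 : 0 ≤ ε * ∑ j, ‖V j g‖ ^ 2 := by positivity
  rcases eq_or_lt_of_le (norm_nonneg (R g)) with h0 | h0
  · rw [← h0]; positivity
  · nlinarith

theorem norm_le (hε : 0 < ε) : ‖R‖ ≤ 1 :=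
  ContinuousLinearMap.opNorm_le_bound _ zero_le_one fun g => by
    rw [one_mul]; exact h.norm_apply_le hε g

theorem isPositive (hε : 0 < ε) : R.IsPositive := by
  rw [ContinuousLinearMap.isPositive_iff_complex]
  intro g
  have h1 : ⟪R g, g⟫_ℂ = ((‖R g‖ ^ 2 + ε * ∑ j, ‖V j g‖ ^ 2 : ℝ) : ℂ) := by
    rw [← inner_conj_symm, h.inner_self, Complex.conj_ofReal]
  rw [h1]
  refine ⟨by rw [RCLike.re_to_complex, Complex.ofReal_re], ?_⟩
  rw [RCLike.re_to_complex, Complex.ofReal_re]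
  positivity

theorem isPositive_one_sub (hε : 0 < ε) : (1 - R).IsPositive := by
  rw [ContinuousLinearMap.isPositive_iff_complex]
  intro g
  have h1 : ⟪R g, g⟫_ℂ = ((‖R g‖ ^ 2 + ε * ∑ j, ‖V j g‖ ^ 2 : ℝ) : ℂ) := by
    rw [← inner_conj_symm, h.inner_self, Complex.conj_ofReal]
  have h2 : ⟪(1 - R) g, g⟫_ℂ = ((‖g‖ ^ 2 - (‖R g‖ ^ 2 + ε * ∑ j, ‖V j g‖ ^ 2) : ℝ) : ℂ) := by
    rw [sub_apply, inner_sub_left, h1]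
    simp [inner_self_eq_norm_sq_to_K]
  rw [h2]
  refine ⟨by rw [RCLike.re_to_complex, Complex.ofReal_re], ?_⟩
  rw [RCLike.re_to_complex, Complex.ofReal_re]
  have h3 := h.energy g
  have h4 := h.norm_apply_le hε g
  nlinarith [norm_nonneg g, norm_nonneg (R g)]

theorem isDiv (hε : 0 < ε) (g : H) :
    IsDiv X Ω (fun j => V j g) (((ε⁻¹ : ℝ) : ℂ) • (g - R g)) := by
  intro z ζ hz
  rw [inner_smul_left, h.eq g z ζ hz, Complex.conj_ofReal, ← mul_assoc, ← Complex.ofReal_mul,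
    inv_mul_cancel₀ hε.ne', Complex.ofReal_one, one_mul]

/-- `(R g, V g)` minimises `‖z - g‖² + ε ‖ζ‖²` over the graph. -/
theorem pythagoras (g : H) {z : H} {ζ : Fin n → Coarse H} (hz : InDom X Ω z ζ) :
    ‖z - g‖ ^ 2 + ε * ∑ j, ‖ζ j‖ ^ 2 = ‖z - R g‖ ^ 2 + ε * ∑ j, ‖ζ j - V j g‖ ^ 2 +
      (‖R g - g‖ ^ 2 + ε * ∑ j, ‖V j g‖ ^ 2) := by
  have h1 := congrArg Complex.re (h.eq g _ _ (hz.sub (h.inDom g)))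
  rw [Complex.re_ofReal_mul, Complex.re_sum] at h1
  have h2 : ‖z - g‖ ^ 2 = ‖z - R g‖ ^ 2 - 2 * (⟪g - R g, z - R g⟫_ℂ).re + ‖R g - g‖ ^ 2 := by
    have : z - g = (z - R g) - (g - R g) := by abel
    rw [this, @norm_sub_sq ℂ, norm_sub_rev (R g) g, ← inner_re_symm (𝕜 := ℂ) (g - R g)]
    rfl
  have h3 : ∀ j, ‖ζ j‖ ^ 2 = ‖ζ j - V j g‖ ^ 2 + 2 * (⟪V j g, ζ j - V j g⟫_ℂ).re +
      ‖V j g‖ ^ 2 := by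
    intro j
    have : ζ j = (ζ j - V j g) + V j g := by abel
    conv_lhs => rw [this]
    rw [@norm_add_sq ℂ, ← inner_re_symm (𝕜 := ℂ) (V j g)]
    rfl
  simp only [h2, h3, h1, Finset.sum_add_distrib, ← Finset.mul_sum]
  ring

/-- Uniqueness of the minimiser, the means by which a vector is recognised as a resolvent. -/
theorem eq_of_le (hε : 0 < ε) (g : H) {z : H} {ζ : Fin n → Coarse H} (hz : InDom X Ω z ζ)
    (hle : ‖z - g‖ ^ 2 + ε * ∑ j, ‖ζ j‖ ^ 2 ≤ ‖R g - g‖ ^ 2 + ε * ∑ j, ‖V j g‖ ^ 2) :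
    z = R g ∧ ∀ j, ζ j = V j g := by
  rw [h.pythagoras g hz] at hle
  have h0 : 0 ≤ ∑ j, ‖ζ j - V j g‖ ^ 2 := by positivity
  have h1 : ‖z - R g‖ ^ 2 + ε * ∑ j, ‖ζ j - V j g‖ ^ 2 ≤ 0 := by linarith
  have h2 : ‖z - R g‖ ^ 2 ≤ 0 := by nlinarith
  have h3 : ∑ j, ‖ζ j - V j g‖ ^ 2 ≤ 0 := by nlinarith [sq_nonneg ‖z - R g‖]
  refine ⟨?_, fun j => ?_⟩
  · rw [← sub_eq_zero, ← norm_eq_zero]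
    exact pow_eq_zero_iff two_ne_zero |>.1 (le_antisymm h2 (sq_nonneg _))
  · rw [← sub_eq_zero, ← norm_eq_zero]
    refine pow_eq_zero_iff two_ne_zero |>.1 (le_antisymm ?_ (sq_nonneg _))
    exact (Finset.single_le_sum (f := fun j => ‖ζ j - V j g‖ ^ 2) (fun _ _ => sq_nonneg _)
      (Finset.mem_univ j)).trans h3

theorem norm_sub_apply_sq_le (hε : 0 < ε) {g : H} {γ : Fin n → Coarse H} (hg : InDom X Ω g γ) :
    ‖g - R g‖ ^ 2 ≤ ε * ∑ j, ‖γ j‖ ^ 2 := by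
  have h1 := h.pythagoras g hg
  have h2 : 0 ≤ ε * ∑ j, ‖γ j - V j g‖ ^ 2 := by positivity
  have h3 : 0 ≤ ε * ∑ j, ‖V j g‖ ^ 2 := by positivity
  rw [sub_self, norm_zero] at h1
  nlinarith [sq_nonneg ‖R g - g‖]

end IsResolvent

theorem poly_inDom (X : Fin n → H →L[ℂ] H) (Ω : H) (p : FreeAlgebra ℂ (Fin n)) :
    InDom X Ω (evalVec X Ω p) fun j => evalDiff X Ω j p := fun j => poly_mem_dgraph X Ω j p

/-- The resolvents are contractions, so polynomial vectors suffice; there finite energy gives an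
error of order √ε. -/
theorem ObataData.tendsto_resolvent {X : Fin n → H →L[ℂ] H} {Ω : H} {ξ : Fin n → H}
    {Jac : Fin n → Fin n → Coarse H →L[ℂ] Coarse H} {J : H →ₗᵢ⋆[ℂ] H}
    (D : ObataData X Ω ξ Jac J) {ε : ℕ → ℝ} (hε : ∀ m, 0 < ε m) (hε0 : Tendsto ε atTop (𝓝 0))
    {R : ℕ → H →L[ℂ] H} {V : ℕ → Fin n → H →L[ℂ] Coarse H}
    (h : ∀ m, IsResolvent X Ω (ε m) (R m) (V m)) (g : H) :
    Tendsto (fun m => R m g) atTop (𝓝 g) := by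
  have hE : Equicontinuous fun m => (R m : H → H) := by
    refine UniformEquicontinuous.equicontinuous ?_
    refine LipschitzWith.uniformEquicontinuous _ 1 fun m =>
      LipschitzWith.of_dist_le_mul fun x y => ?_
    rw [dist_eq_norm, dist_eq_norm, ← map_sub, NNReal.coe_one, one_mul]
    exact (h m).norm_apply_le (hε m) _
  have hcl := hE.isClosed_setOfPred_tendsto (l := atTop) (f := fun x : H => x) continuous_id
  suffices hsub : Set.range (evalVec X Ω) ⊆ {x | Tendsto (fun m => R m x) atTop (𝓝 x)} by
    exact closure_minimal hsub hcl (D.dense_poly g)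
  rintro _ ⟨p, rfl⟩
  rw [Set.mem_ofPred_eq, tendsto_iff_norm_sub_tendsto_zero]
  have h1 : Tendsto (fun m => √(ε m * ∑ j, ‖evalDiff X Ω j p‖ ^ 2)) atTop (𝓝 0) := by
    have := (hε0.mul_const (∑ j, ‖evalDiff X Ω j p‖ ^ 2)).sqrt
    simpa using this
  refine squeeze_zero (fun _ => norm_nonneg _) (fun m => ?_) h1
  rw [norm_sub_rev]
  exact Real.le_sqrt_of_sq_le ((h m).norm_sub_apply_sq_le (hε m) (poly_inDom X Ω p))

end Resolvent

/-! ### Truncation by functional calculus -/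

section Truncation

open Polynomial

theorem ddiff_mul_sub {A : Type*} [Ring A] [Algebra ℂ A] (P : ℂ[X]) {a b : A} (h : Commute a b) :
    ddiff P a b * (a - b) = aeval a P - aeval b P := by
  rw [ddiff, aeval_eq_sum_range, aeval_eq_sum_range, ← Finset.sum_sub_distrib,
    Polynomial.sum_over_range _ (by simp), Finset.sum_mul]
  refine Finset.sum_congr rfl fun k _ => ?_
  rw [smul_mul_assoc, h.geom_sum₂_mul, smul_sub]

theorem norm_aeval_le {A : Type*} [CStarAlgebra A] {φ : ℝ[X]} {K c : ℝ} (hc : 0 ≤ c)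
    (h : ∀ t, |t| ≤ K → |φ.eval t| ≤ c) {a : A} (ha : IsSelfAdjoint a) (haK : ‖a‖ ≤ K) :
    ‖aeval a (φ.map (algebraMap ℝ ℂ))‖ ≤ c := by
  rcases subsingleton_or_nontrivial A with _ | _
  · rw [Subsingleton.elim (aeval a (φ.map (algebraMap ℝ ℂ))) 0, norm_zero]
    exact hc
  rw [aeval_map_algebraMap, ← cfc_polynomial φ a]
  refine norm_cfc_le hc fun t ht => ?_
  rw [Real.norm_eq_abs]
  exact h t ((spectrum.norm_le_norm_of_mem ht).trans haK)

variable {H : Type u} [NormedAddCommGroup H] [InnerProductSpace ℂ H] [CompleteSpace H] {n : ℕ}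

theorem pol_aeval (X : Fin n → H →L[ℂ] H) (P : ℂ[X]) (p : FreeAlgebra ℂ (Fin n)) :
    pol X (aeval p P) = aeval (pol X p) P :=
  (aeval_algHom_apply (FreeAlgebra.lift ℂ X) p P).symm

namespace ObataData

variable {X : Fin n → H →L[ℂ] H} {Ω : H} {ξ : Fin n → H}
  {Jac : Fin n → Fin n → Coarse H →L[ℂ] Coarse H} {J : H →ₗᵢ⋆[ℂ] H}
  (D : ObataData X Ω ξ Jac J)
include D

theorem rt_pow (p : FreeAlgebra ℂ (Fin n)) (k : ℕ) : rt J (pol X (p ^ k)) = rt J (pol X p) ^ k := by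
  induction k with
  | zero => rw [pow_zero, pow_zero, pol, map_one, rt, star_one, cj_one D.std.J_J]
  | succ k ih =>
    rw [pow_succ', pow_succ, pol, map_mul, rt, star_mul, cj_mul D.std.J_J]
    exact congrArg (· * _) ih

theorem opTens_pow_right (x : H →L[ℂ] H) (k : ℕ) : opTens 1 (x ^ k) = opTens 1 x ^ k := by
  induction k with
  | zero => rw [pow_zero, pow_zero, opTens_one]
  | succ k ih => rw [pow_succ, pow_succ, ← ih, ← opTens_mul, one_mul]

theorem evalDiff_pow (j : Fin n) (p : FreeAlgebra ℂ (Fin n)) (k : ℕ) :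
    evalDiff X Ω j (p ^ k) = (∑ l ∈ Finset.range k, opTens (pol X p) 1 ^ l *
      opTens 1 (rt J (pol X p)) ^ (k - 1 - l)) (evalDiff X Ω j p) := by
  induction k with
  | zero => simp [evalDiff_eq, freeDiff_one]
  | succ k ih =>
    rw [pow_succ', D.evalDiff_mul, ih, D.rt_pow, D.opTens_pow_right, Finset.sum_range_succ']
    simp only [add_apply, pow_zero, one_mul, add_tsub_cancel_right,
      Nat.sub_zero]
    congr 1
    rw [← mul_apply_eq_comp, Finset.mul_sum]
    congr 1
    refine Finset.sum_congr rfl fun l _ => ?_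
    rw [← mul_assoc, ← pow_succ', show k - (l + 1) = k - 1 - l by omega]

/-- The chain rule for the difference quotients. -/
theorem evalDiff_aeval (j : Fin n) (P : ℂ[X]) (p : FreeAlgebra ℂ (Fin n)) :
    evalDiff X Ω j (aeval p P) =
      ddiff P (opTens (pol X p) 1) (opTens 1 (rt J (pol X p))) (evalDiff X Ω j p) := by
  rw [ddiff, aeval_eq_sum_range, map_sum, Polynomial.sum_over_range _ (by simp),
    sum_apply]
  refine Finset.sum_congr rfl fun k _ => ?_
  rw [map_smul, D.evalDiff_pow]
  rfl

theorem commute_legs (x y : H →L[ℂ] H) : Commute (opTens x 1) (opTens 1 y) := by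
  change opTens x 1 * opTens 1 y = opTens 1 y * opTens x 1
  rw [← opTens_mul, ← opTens_mul, one_mul, mul_one, one_mul, mul_one]

theorem isSelfAdjoint_rt {x : H →L[ℂ] H} (hx : IsSelfAdjoint x) : IsSelfAdjoint (rt J x) := by
  rw [IsSelfAdjoint, D.std.star_rt, hx.star_eq]

theorem norm_opTens_one_le (x : H →L[ℂ] H) : ‖opTens x 1‖ ≤ ‖x‖ :=
  (norm_opTens_le _ _).trans ((mul_le_mul_of_nonneg_left ContinuousLinearMap.norm_id_le
    (norm_nonneg _)).trans_eq (mul_one _))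

theorem norm_opTens_one_le' (x : H →L[ℂ] H) : ‖opTens 1 x‖ ≤ ‖x‖ :=
  (norm_opTens_le _ _).trans ((mul_le_mul_of_nonneg_right ContinuousLinearMap.norm_id_le
    (norm_nonneg _)).trans_eq (one_mul _))

/-- By the chain rule ∂_j φ(p) is the divided difference of φ at p ⊗ 1 and 1 ⊗ ρ(p), two commuting
self-adjoint operators, applied to ∂_j p. So 1-Lipschitz functions do not increase the energy. -/
theorem norm_evalDiff_aeval_le {φ : ℝ[X]} {K : ℝ}
    (h : ∀ t, |t| ≤ K → |φ.derivative.eval t| ≤ 1) (j : Fin n) {p : FreeAlgebra ℂ (Fin n)}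
    (hp : IsSelfAdjoint (pol X p)) (hpK : ‖pol X p‖ ≤ K) :
    ‖evalDiff X Ω j (aeval p (φ.map (algebraMap ℝ ℂ)))‖ ≤ ‖evalDiff X Ω j p‖ := by
  rw [D.evalDiff_aeval]
  have h1 : IsSelfAdjoint (opTens (pol X p) 1) := by
    rw [IsSelfAdjoint, star_opTens, star_one, hp.star_eq]
  have h2 : IsSelfAdjoint (opTens 1 (rt J (pol X p))) := by
    rw [IsSelfAdjoint, star_opTens, star_one, (D.isSelfAdjoint_rt hp).star_eq]
  have h3 : ‖opTens (pol X p) 1‖ ≤ K := (D.norm_opTens_one_le _).trans hpK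
  have h4 : ‖opTens 1 (rt J (pol X p))‖ ≤ K :=
    (D.norm_opTens_one_le' _).trans ((norm_rt_le _).trans hpK)
  have h5 := norm_ddiff_le (A := Coarse H →L[ℂ] Coarse H) h h1 h2 (D.commute_legs (pol X p) (rt J (pol X p))).eq h3 h4
  exact (ContinuousLinearMap.le_of_opNorm_le _ h5 _).trans_eq (one_mul _)

theorem aeval_rt_vac (P : ℂ[X]) (p : FreeAlgebra ℂ (Fin n)) :
    aeval (rt J (pol X p)) P Ω = evalVec X Ω (aeval p P) := by
  rw [aeval_eq_sum_range, aeval_eq_sum_range, map_sum, sum_apply]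
  refine Finset.sum_congr rfl fun k _ => ?_
  rw [map_smul, smul_apply, ← D.rt_pow, D.std.rt_vac _ (pol_mem X _),
    evalVec_apply]

/-- Left multiplication by p commutes with right multiplication by q, so φ(p)Ω - φ(q)Ω is a divided
difference applied to pΩ - qΩ: the calculus is 1-Lipschitz in L². -/
theorem norm_evalVec_aeval_sub_le {φ : ℝ[X]} {K : ℝ}
    (h : ∀ t, |t| ≤ K → |φ.derivative.eval t| ≤ 1) {p q : FreeAlgebra ℂ (Fin n)}
    (hp : IsSelfAdjoint (pol X p)) (hpK : ‖pol X p‖ ≤ K)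
    (hq : IsSelfAdjoint (pol X q)) (hqK : ‖pol X q‖ ≤ K) :
    ‖evalVec X Ω (aeval p (φ.map (algebraMap ℝ ℂ))) -
      evalVec X Ω (aeval q (φ.map (algebraMap ℝ ℂ)))‖ ≤ ‖evalVec X Ω p - evalVec X Ω q‖ := by
  have hcom : Commute (pol X p) (rt J (pol X q)) := by
    ext v; exact (D.std.rt_comm (pol_mem X q) (pol_mem X p) v).symm
  have h1 : evalVec X Ω (aeval p (φ.map (algebraMap ℝ ℂ))) -
      evalVec X Ω (aeval q (φ.map (algebraMap ℝ ℂ))) =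
      ddiff (φ.map (algebraMap ℝ ℂ)) (pol X p) (rt J (pol X q)) (evalVec X Ω p - evalVec X Ω q) := by
    have h2 := congrArg (fun T : H →L[ℂ] H => T Ω) (ddiff_mul_sub (φ.map (algebraMap ℝ ℂ)) hcom)
    simp only [mul_apply_eq_comp, sub_apply, D.aeval_rt_vac,
      ← pol_aeval, D.std.rt_vac _ (pol_mem X q)] at h2
    exact h2.symm
  rw [h1]
  have h3 := norm_ddiff_le (A := H →L[ℂ] H) h hp (D.isSelfAdjoint_rt hq) hcom hpK ((norm_rt_le _).trans hqK)
  exact (ContinuousLinearMap.le_of_opNorm_le _ h3 _).trans_eq (one_mul _)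

end ObataData

end Truncation

/-! ### Resolvents of polynomials are bounded elements -/

section Core

open Polynomial

variable {H : Type u} [NormedAddCommGroup H] [InnerProductSpace ℂ H] [CompleteSpace H] {n : ℕ}

theorem IsBdd.add {X : Fin n → H →L[ℂ] H} {Ω : H} {x y : H →L[ℂ] H} {η ζ : Fin n → Coarse H}
    (hx : IsBdd X Ω x η) (hy : IsBdd X Ω y ζ) : IsBdd X Ω (x + y) fun j => η j + ζ j := by
  refine ⟨vn_add_mem hx.mem hy.mem, fun j => ?_⟩
  obtain ⟨p, C, h1, h2, h3⟩ := hx.approx j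
  obtain ⟨q, C', k1, k2, k3⟩ := hy.approx j
  refine ⟨fun m => p m + q m, C + C', fun m => ?_, fun z v => ?_, fun z => ?_⟩
  · rw [pol, map_add]
    exact (norm_add_le _ _).trans (add_le_add (h1 m) (k1 m))
  · simpa only [pol, map_add, add_apply, inner_add_right] using
      (h2 z v).add (k2 z v)
  · simpa only [map_add, inner_add_right] using (h3 z).add (k3 z)

theorem IsBdd.smul {X : Fin n → H →L[ℂ] H} {Ω : H} {x : H →L[ℂ] H} {η : Fin n → Coarse H}
    (c : ℂ) (hx : IsBdd X Ω x η) : IsBdd X Ω (c • x) fun j => c • η j := by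
  refine ⟨vn_smul_mem c hx.mem, fun j => ?_⟩
  obtain ⟨p, C, h1, h2, h3⟩ := hx.approx j
  refine ⟨fun m => c • p m, ‖c‖ * C, fun m => ?_, fun z v => ?_, fun z => ?_⟩
  · rw [pol, map_smul, norm_smul]
    exact mul_le_mul_of_nonneg_left (h1 m) (norm_nonneg _)
  · simpa only [pol, map_smul, smul_apply, inner_smul_right] using
      (h2 z v).const_mul c
  · simpa only [map_smul, inner_smul_right] using (h3 z).const_mul c

namespace ObataData

variable {X : Fin n → H →L[ℂ] H} {Ω : H} {ξ : Fin n → H}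
  {Jac : Fin n → Fin n → Coarse H →L[ℂ] Coarse H} {J : H →ₗᵢ⋆[ℂ] H}
  (D : ObataData X Ω ξ Jac J)
include D

theorem star_inDom {h : H} {η : Fin n → Coarse H} (hh : InDom X Ω h η) :
    InDom X Ω (J h) fun j => tensStar J (η j) := fun j => D.star_mem_dgraph (hh j)

theorem J_resolvent {ε : ℝ} (hε : 0 < ε) {R : H →L[ℂ] H} {V : Fin n → H →L[ℂ] Coarse H}
    (h : IsResolvent X Ω ε R V) {g : H} (hg : J g = g) :
    J (R g) = R g ∧ ∀ j, tensStar J (V j g) = V j g := by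
  refine h.eq_of_le hε g (D.star_inDom (h.inDom g)) (le_of_eq ?_)
  have h1 : ‖J (R g) - g‖ = ‖R g - g‖ := by
    rw [← LinearIsometry.norm_map J (R g - g), map_sub, hg]
  simp only [norm_tensStar, h1]

theorem exists_sa_poly {j : Fin n} {h : H} {η : Coarse H} (hm : (h, η) ∈ dgraph X Ω j)
    (hh : J h = h) (hη : tensStar J η = η) : ∃ p : ℕ → FreeAlgebra ℂ (Fin n),
      (∀ m, IsSelfAdjoint (pol X (p m))) ∧ Tendsto (fun m => evalVec X Ω (p m)) atTop (𝓝 h) ∧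
        Tendsto (fun m => evalDiff X Ω j (p m)) atTop (𝓝 η) := by
  obtain ⟨p, hp1, hp2⟩ := exists_poly_seq hm
  choose q hq1 hq2 using fun m => D.exists_star_poly (p m)
  have hq3 : ∀ m, evalVec X Ω (q m) = J (evalVec X Ω (p m)) := fun m => by
    rw [evalVec_apply, hq1, evalVec_apply, D.std.J_apply _ (pol_mem X _)]
  refine ⟨fun m => (1 / 2 : ℂ) • (p m + q m), fun m => ?_, ?_, ?_⟩
  · rw [IsSelfAdjoint, pol, map_smul, map_add]
    change star ((1 / 2 : ℂ) • (pol X (p m) + pol X (q m))) = _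
    rw [star_smul, star_add, hq1, star_star, add_comm (star _)]
    simp [hq1]
  · have h1 : h = (1 / 2 : ℂ) • (h + J h) := by rw [hh, ← two_smul ℂ h, smul_smul]; simp
    simp only [map_smul, map_add, hq3]
    nth_rewrite 1 [h1]
    exact (hp1.add ((J.continuous.tendsto _).comp hp1)).const_smul _
  · have h1 : η = (1 / 2 : ℂ) • (η + tensStar J η) := by
      rw [hη, ← two_smul ℂ η, smul_smul]; simp
    simp only [map_smul, map_add, hq2]
    nth_rewrite 1 [h1]
    exact (hp2.add (((tensStar J).continuous.tendsto _).comp hp2)).const_smul _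

/-- Approximate Rg by self-adjoint polynomials and truncate them at the level ‖p₀‖. Truncation is a
contraction, almost fixes p₀ and does not increase the energy, so the weak limit is again a
minimiser, that is Rg; it is bounded by construction. -/
theorem resolvent_isBdd_of_sa [NeZero n] {ε : ℝ} (hε : 0 < ε) {R : H →L[ℂ] H}
    {V : Fin n → H →L[ℂ] Coarse H}
    (h : IsResolvent X Ω ε R V) {p₀ : FreeAlgebra ℂ (Fin n)} (hp₀ : IsSelfAdjoint (pol X p₀)) :
    ∃ y, IsBdd X Ω y (fun j => V j (evalVec X Ω p₀)) ∧ y Ω = R (evalVec X Ω p₀) := by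
  set g := evalVec X Ω p₀ with hg
  set C := ‖pol X p₀‖ with hC
  have hJg : J g = g := by
    rw [hg, evalVec_apply, D.std.J_apply _ (pol_mem X _), hp₀.star_eq]
  obtain ⟨hJu, hJV⟩ := D.J_resolvent hε h hJg
  -- The domain is an intersection of the domains of the separate closures, so the approximating
  -- polynomials depend on j; `hyeq` shows that the truncated limits agree.
  choose p hpsa hp1 hp2 using fun j => D.exists_sa_poly (h.inDom g j) hJu (hJV j)
  -- The norms may blow up with m. K only fixes the interval on which the truncation polynomial is
  -- controlled; the resulting bound C + 2 is uniform.
  let K : ℕ → ℝ := fun m => C + ∑ j, ‖pol X (p j m)‖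
  have hC0 : 0 ≤ C := ContinuousLinearMap.opNorm_nonneg _
  have hpn : ∀ j m, 0 ≤ ‖pol X (p j m)‖ := fun j m => ContinuousLinearMap.opNorm_nonneg _
  have hK0 : ∀ m, C ≤ K m := fun m =>
    le_add_of_nonneg_right (Finset.sum_nonneg fun j _ => hpn j m)
  have hK : ∀ j m, ‖pol X (p j m)‖ ≤ K m := fun j m => by
    have h1 := Finset.single_le_sum (f := fun j => ‖pol X (p j m)‖) (fun j _ => hpn j m)
      (Finset.mem_univ j)
    simp only [K]
    linarith
  choose φ hφ1 hφ2 hφ3 using fun m : ℕ => exists_truncation_polynomial (C := C) (K := K m)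
    (δ := 1 / ((m : ℝ) + 1)) hC0 (by positivity)
  let q : Fin n → ℕ → FreeAlgebra ℂ (Fin n) := fun j m => aeval (p j m) ((φ m).map (algebraMap ℝ ℂ))
  have hqn : ∀ j m, ‖pol X (q j m)‖ ≤ C + 2 := fun j m => by
    simp only [q, pol_aeval]
    exact norm_aeval_le (by linarith) (hφ2 m) (hpsa j m) (hK j m)
  have hqd : ∀ j m, ‖evalDiff X Ω j (q j m)‖ ≤ ‖evalDiff X Ω j (p j m)‖ := fun j m =>
    D.norm_evalDiff_aeval_le (hφ1 m) j (hpsa j m) (hK j m)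
  choose y hy using fun j => exists_weak_operator_limit (hyperfilter ℕ) (hqn j)
  have hbd : ∀ j, ∃ B, ∀ m, ‖evalDiff X Ω j (q j m)‖ ≤ B := fun j => by
    obtain ⟨B, hB⟩ := (hp2 j).norm.bddAbove_range
    exact ⟨B, fun m => (hqd j m).trans (hB ⟨m, rfl⟩)⟩
  choose B hB using hbd
  choose η hη using fun j => exists_weak_limit (hyperfilter ℕ) (hB j)
  have hle : (hyperfilter ℕ : Filter ℕ) ≤ atTop := Nat.hyperfilter_le_atTop
  have hmem : ∀ j, (y j Ω, η j) ∈ dgraph X Ω j := fun j =>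
    mem_prod_of_weak_limit (isClosed_dgraph X Ω j) (fun z => hy j z Ω) (hη j)
      fun m => poly_mem_dgraph X Ω j (q j m)
  have hyM : ∀ j, y j ∈ wStar (Set.range X) := fun j =>
    vn_mem_of_weak_limit (fun z v => hy j z v) fun m => pol_mem X _
  have hηle : ∀ j, ‖η j‖ ≤ ‖V j g‖ := fun j =>
    norm_le_of_weak_limit (hη j) ((hp2 j).norm.mono_left hle) (hqd j)
  have hyeq : ∀ j k, y j = y k := fun j k => by
    refine D.std.eq_of_vec_eq (hyM j) (hyM k) ?_
    rw [← sub_eq_zero, ← norm_le_zero_iff]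
    refine norm_le_of_weak_limit (l := hyperfilter ℕ)
      (x := fun m => evalVec X Ω (q j m) - evalVec X Ω (q k m))
      (c := fun m => ‖evalVec X Ω (p j m) - evalVec X Ω (p k m)‖) (fun z => ?_) ?_ fun m => ?_
    · simp only [inner_sub_right]
      exact (hy j z Ω).sub (hy k z Ω)
    · have := ((hp1 j).sub (hp1 k)).norm.mono_left hle
      simpa using this
    · exact D.norm_evalVec_aeval_sub_le (hφ1 m) (hpsa j m) (hK j m) (hpsa k m) (hK k m)
  -- Truncation nearly fixes p₀ and is a contraction, so the distance to g grows by at most 1/(m+1).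
  -- The index 0 is available because n ≥ 1.
  have hyg : ‖y 0 Ω - g‖ ≤ ‖R g - g‖ := by
    refine norm_le_of_weak_limit (l := hyperfilter ℕ) (x := fun m => evalVec X Ω (q 0 m) - g)
      (c := fun m => ‖evalVec X Ω (p 0 m) - g‖ + 1 / ((m : ℝ) + 1)) (fun z => ?_) ?_ fun m => ?_
    · simp only [inner_sub_right]
      exact (hy 0 z Ω).sub tendsto_const_nhds
    · have := (((hp1 0).sub_const g).norm.add tendsto_one_div_add_atTop_nhds_zero_nat).mono_left hle
      simpa using this
    · have h1 := D.norm_evalVec_aeval_sub_le (hφ1 m) (hpsa 0 m) (hK 0 m) hp₀ (hK0 m)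
      have h2 : ‖evalVec X Ω (aeval p₀ ((φ m).map (algebraMap ℝ ℂ))) - g‖ ≤ 1 / ((m : ℝ) + 1) := by
        have h3 : ‖aeval (pol X p₀) ((φ m - Polynomial.X).map (algebraMap ℝ ℂ))‖ ≤
            1 / ((m : ℝ) + 1) := by
          refine norm_aeval_le (K := C) (by positivity) (fun t ht => ?_) hp₀ le_rfl
          rw [eval_sub, eval_X]
          exact hφ3 m t (ht.trans (hK0 m)) ht
        have h4 : evalVec X Ω (aeval p₀ ((φ m).map (algebraMap ℝ ℂ))) - g =
            aeval (pol X p₀) ((φ m - Polynomial.X).map (algebraMap ℝ ℂ)) Ω := by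
          rw [Polynomial.map_sub, map_X, map_sub, aeval_X, ← pol_aeval]
          rfl
        rw [h4]
        exact (ContinuousLinearMap.le_of_opNorm_le _ h3 _).trans_eq (by rw [D.std.norm_one, mul_one])
      have h5 : evalVec X Ω (q 0 m) - g = (evalVec X Ω (q 0 m) -
          evalVec X Ω (aeval p₀ ((φ m).map (algebraMap ℝ ℂ)))) +
          (evalVec X Ω (aeval p₀ ((φ m).map (algebraMap ℝ ℂ))) - g) := by abel
      rw [h5]
      exact (norm_add_le _ _).trans (add_le_add h1 h2)
  have hdom : InDom X Ω (y 0 Ω) η := fun j => hyeq j 0 ▸ hmem j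
  obtain ⟨hf1, hf2⟩ := h.eq_of_le hε g hdom (by gcongr; exact hηle _)
  refine ⟨y 0, ⟨hyM 0, fun j => ⟨q j, C + 2, hqn j, ?_, ?_⟩⟩, hf1⟩
  · exact hyeq j 0 ▸ hy j
  · rw [← hf2 j]; exact hη j

theorem resolvent_isBdd [NeZero n] {ε : ℝ} (hε : 0 < ε) {R : H →L[ℂ] H}
    {V : Fin n → H →L[ℂ] Coarse H}
    (h : IsResolvent X Ω ε R V) (p : FreeAlgebra ℂ (Fin n)) :
    ∃ y, IsBdd X Ω y (fun j => V j (evalVec X Ω p)) ∧ y Ω = R (evalVec X Ω p) := by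
  obtain ⟨q, hq1, -⟩ := D.exists_star_poly p
  have e1 : IsSelfAdjoint (pol X ((1 / 2 : ℂ) • (p + q))) := by
    rw [IsSelfAdjoint, pol, map_smul, map_add]
    change star ((1 / 2 : ℂ) • (pol X p + pol X q)) = _
    rw [star_smul, star_add, hq1, star_star, add_comm (star _)]
    simp [hq1]
  have e2 : IsSelfAdjoint (pol X ((-Complex.I / 2 : ℂ) • (p - q))) := by
    rw [IsSelfAdjoint, pol, map_smul, map_sub]
    change star ((-Complex.I / 2 : ℂ) • (pol X p - pol X q)) = _
    rw [star_smul, star_sub, hq1, star_star, ← neg_sub, smul_neg, ← neg_smul]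
    simp [hq1, neg_div]
  obtain ⟨y1, h1, h1'⟩ := D.resolvent_isBdd_of_sa hε h e1
  obtain ⟨y2, h2, h2'⟩ := D.resolvent_isBdd_of_sa hε h e2
  have e3 : p = (1 / 2 : ℂ) • (p + q) + Complex.I • ((-Complex.I / 2 : ℂ) • (p - q)) := by
    rw [smul_smul, show Complex.I * (-Complex.I / 2) = 1 / 2 by
      linear_combination (-1 / 2 : ℂ) * Complex.I_mul_I, ← smul_add, add_add_sub_cancel,
      ← two_smul ℂ p, smul_smul]
    simp
  refine ⟨y1 + Complex.I • y2, ?_, ?_⟩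
  · convert h1.add (h2.smul Complex.I) using 2 with j
    conv_lhs => rw [e3]
    simp only [map_add, map_smul]
  · rw [add_apply, smul_apply, h1', h2']
    conv_rhs => rw [e3]
    simp only [map_add, map_smul]

/-- In the graph inner product, pairing (z, ∂̄z) with (Rp, ∂̄Rp) gives ⟨p, z⟩ for ε = 1. A graph
vector orthogonal to all of these therefore vanishes. -/
theorem bddIsCore [NeZero n] : BddIsCore X Ω := by
  obtain ⟨R, V, h⟩ := exists_isResolvent X Ω one_pos
  intro z ζ hz
  let E := WithLp 2 (H × PiLp 2 fun _ : Fin n => Coarse H)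
  let L : FreeAlgebra ℂ (Fin n) →ₗ[ℂ] E :=
    { toFun := fun p => WithLp.toLp 2 (R (evalVec X Ω p), WithLp.toLp 2 fun j => V j (evalVec X Ω p))
      map_add' := fun p q => by simp only [map_add]; rfl
      map_smul' := fun c p => by simp only [map_smul]; rfl }
  have hcomp : CompleteSpace (LinearMap.range L).topologicalClosure :=
    (Submodule.isClosed_topologicalClosure _).completeSpace_coe
  let x : E := WithLp.toLp 2 (z, WithLp.toLp 2 ζ)
  let W := (LinearMap.range L).topologicalClosure
  have hWG : W ≤ domGraph X Ω 1 := by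
    refine Submodule.topologicalClosure_minimal _ ?_ (isClosed_domGraph X Ω 1)
    rintro _ ⟨p, rfl⟩
    rw [mem_domGraph]
    intro j
    rw [inv_one, one_smul]
    exact h.inDom _ j
  have hxG : x ∈ domGraph X Ω 1 := by
    rw [mem_domGraph]; intro j; rw [inv_one, one_smul]; exact hz j
  have hd : x - W.starProjection x = 0 := by
    set d := x - W.starProjection x with hd
    have h1 : d ∈ domGraph X Ω 1 := sub_mem hxG (hWG (Submodule.starProjection_apply_mem W x))
    have h2 : InDom X Ω d.fst fun j => d.snd j := fun j => by
      have := mem_domGraph.1 h1 j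
      rwa [inv_one, one_smul] at this
    have h3 : d.fst = 0 := by
      refine D.poly_ext_inner fun p => ?_
      rw [h.inner_eq _ h2, inner_zero_right]
      have h4 := (Submodule.mem_orthogonal _ _).1
        (Submodule.sub_starProjection_mem_orthogonal (K := W) x) (L p)
        (Submodule.le_topologicalClosure _ ⟨p, rfl⟩)
      rw [WithLp.prod_inner_apply, PiLp.inner_apply] at h4
      rw [Complex.ofReal_one, one_mul]
      exact h4
    have h5 : ∀ j, d.snd j = 0 := fun j => by
      have h6 := h2 j
      rw [h3] at h6
      exact D.dgraph_unique h6 (zero_mem _)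
    have h7 : ‖d‖ ^ 2 = 0 := by
      rw [WithLp.prod_norm_sq_eq_of_L2, PiLp.norm_sq_eq_of_L2, h3]
      simp [h5]
    exact norm_eq_zero.1 (pow_eq_zero_iff two_ne_zero |>.1 h7)
  have hxW : x ∈ closure (Set.range L) := by
    rw [sub_eq_zero] at hd
    have : x ∈ W := by rw [hd]; exact Submodule.starProjection_apply_mem W x
    exact this
  obtain ⟨s, hs, hs'⟩ := mem_closure_iff_seq_limit.1 hxW
  choose p hp using hs
  choose t ht ht' using fun m => D.resolvent_isBdd one_pos h (p m)
  refine ⟨t, fun m j => V j (evalVec X Ω (p m)), ht, ?_, ?_⟩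
  · have h1 := ((WithLp.fstL 2 ℂ H (PiLp 2 fun _ : Fin n => Coarse H)).continuous.tendsto x).comp hs'
    refine h1.congr fun m => ?_
    rw [Function.comp_apply, ← hp m, ht' m]
    rfl
  · rw [tendsto_pi_nhds]
    intro j
    have h1 := (((PiLp.proj 2 (𝕜 := ℂ) (fun _ : Fin n => Coarse H) j).comp
      (WithLp.sndL 2 ℂ H (PiLp 2 fun _ : Fin n => Coarse H))).continuous.tendsto x).comp hs'
    refine h1.congr fun m => ?_
    rw [Function.comp_apply, ← hp m]
    rfl

end ObataData

end Core

/-! ### The weak Poincaré inequality -/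

section Poincare

variable {H : Type u} [NormedAddCommGroup H] [InnerProductSpace ℂ H] [CompleteSpace H] {n : ℕ}

/-- `ζ ↦ ζ # (Xᵢ ⊗ 1 - 1 ⊗ Xᵢ)`. -/
def commOp (X : Fin n → H →L[ℂ] H) (J : H →ₗᵢ⋆[ℂ] H) (i : Fin n) : Coarse H →L[ℂ] Coarse H :=
  opTens (rt J (X i)) 1 - opTens 1 (X i)

theorem opTens_comm {x x' y y' : H →L[ℂ] H} (hx : ∀ v, x (x' v) = x' (x v))
    (hy : ∀ v, y (y' v) = y' (y v)) (ζ : Coarse H) :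
    opTens x y (opTens x' y' ζ) = opTens x' y' (opTens x y ζ) := by
  have h1 : opTens x y * opTens x' y' = opTens x' y' * opTens x y := by
    rw [← opTens_mul, ← opTens_mul, show x * x' = x' * x from ContinuousLinearMap.ext hx,
      show y * y' = y' * y from ContinuousLinearMap.ext hy]
  exact congrArg (fun T : Coarse H →L[ℂ] Coarse H => T ζ) h1

namespace ObataData

variable {X : Fin n → H →L[ℂ] H} {Ω : H} {ξ : Fin n → H}
  {Jac : Fin n → Fin n → Coarse H →L[ℂ] Coarse H} {J : H →ₗᵢ⋆[ℂ] H}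
  (D : ObataData X Ω ξ Jac J)
include D

theorem X_mem (i : Fin n) : X i ∈ wStar (Set.range X) := subset_wStar _ ⟨i, rfl⟩

/-- Both sides are derivations in p, because the commutator acts on the inner legs and commutes with
the outer bimodule actions; they agree on the variables. -/
theorem sum_commOp_poly (p : FreeAlgebra ℂ (Fin n)) :
    ∑ i, commOp X J i (evalDiff X Ω i p) = tens (evalVec X Ω p) Ω - tens Ω (evalVec X Ω p) := by
  induction p using FreeAlgebra.induction with
  | grade0 r =>
    have h1 : evalVec X Ω (algebraMap ℂ _ r) = r • Ω := by
      rw [evalVec_apply, pol, AlgHom.commutes, Algebra.algebraMap_eq_smul_one]; rfl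
    simp [evalDiff_eq, freeDiff_algebraMap, h1, tens_smul_left, tens_smul_right]
  | grade1 k =>
    have h1 : evalVec X Ω (FreeAlgebra.ι ℂ k) = X k Ω := by simp [evalVec_apply, pol]
    have h2 : evalVec X Ω 1 = Ω := by simp [evalVec_apply]
    rw [Finset.sum_eq_single k]
    · rw [evalDiff_eq, freeDiff_ι, if_pos rfl, tmap_tmul, h1, h2, commOp,
        sub_apply, opTens_tens, opTens_tens, D.std.rt_vac _ (D.X_mem k)]
      rfl
    · intro i _ hi
      rw [evalDiff_eq, freeDiff_ι, if_neg hi, map_zero, map_zero]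
    · simp
  | mul a b ha hb =>
    have h1 : ∀ i, commOp X J i (opTens (pol X a) 1 (evalDiff X Ω i b)) =
        opTens (pol X a) 1 (commOp X J i (evalDiff X Ω i b)) := fun i => by
      simp only [commOp, sub_apply, map_sub]
      congr 1
      · exact opTens_comm (fun v => D.std.rt_comm (D.X_mem i) (pol_mem X a) v) (fun _ => rfl) _
      · exact opTens_comm (x := 1) (x' := pol X a) (y := X i) (y' := 1)
          (fun v => rfl) (fun _ => rfl) _
    have h2 : ∀ i, commOp X J i (opTens 1 (rt J (pol X b)) (evalDiff X Ω i a)) =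
        opTens 1 (rt J (pol X b)) (commOp X J i (evalDiff X Ω i a)) := fun i => by
      simp only [commOp, sub_apply, map_sub]
      congr 1
      · exact opTens_comm (x := rt J (X i)) (x' := 1) (y := 1) (y' := rt J (pol X b))
          (fun v => rfl) (fun _ => rfl) _
      · exact opTens_comm (x := 1) (x' := 1) (fun v => rfl)
          (fun v => (D.std.rt_comm (pol_mem X b) (D.X_mem i) v).symm) _
    have h3 : pol X a (evalVec X Ω b) = evalVec X Ω (a * b) := by simp [evalVec_apply, pol]
    simp only [D.evalDiff_mul, map_add, h1, h2, Finset.sum_add_distrib, ← map_sum, ha, hb, map_sub,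
      opTens_tens, one_apply_eq_self, D.rt_evalVec, h3, D.std.rt_vac _ (pol_mem X b)]
    simp only [evalVec_apply]
    abel
  | add a b ha hb =>
    simp only [map_add, Finset.sum_add_distrib, ha, hb, tens_add_left, tens_add_right]
    abel

end ObataData

namespace SliceData

variable {X : Fin n → H →L[ℂ] H} {Ω : H} {ξ : Fin n → H}
  {Jac : Fin n → Fin n → Coarse H →L[ℂ] Coarse H} {J : H →ₗᵢ⋆[ℂ] H} {S : Fin n → H →L[ℂ] H}
  (D : SliceData X Ω ξ Jac J S)
include D

/-- Polynomials are not known to be a joint core. But ∂_i* is defined on simple tensors from M, so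
the left side paired with aΩ ⊗ bΩ is a bounded functional of `u` alone, and density of polynomials
in L² suffices. -/
theorem sum_commOp {u : H} {η : Fin n → Coarse H} (hu : InDom X Ω u η) :
    ∑ i, commOp X J i (η i) = tens u Ω - tens Ω u := by
  refine D.std.coarse_ext_inner fun a ha b hb => ?_
  obtain ⟨z, hz⟩ : ∃ z, ∀ u η, InDom X Ω u η →
      ⟪tens (a Ω) (b Ω), ∑ i, commOp X J i (η i)⟫_ℂ = ⟪z, u⟫_ℂ := by
    refine ⟨∑ i, ((rt J b (star (S i) ((a * X i) Ω)) - (a * X i) (cj J (S i) (b Ω))) -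
      (rt J (X i * b) (star (S i) (a Ω)) - a (cj J (S i) ((X i * b) Ω)))), fun u η hu => ?_⟩
    rw [inner_sum, sum_inner]
    refine Finset.sum_congr rfl fun i _ => ?_
    have hXi := D.X_mem i
    rw [inner_sub_left, ← D.inner_tens_dgraph i (hu i) (vn_mul_mem ha hXi) hb,
      ← D.inner_tens_dgraph i (hu i) ha (vn_mul_mem hXi hb), commOp,
      sub_apply, inner_sub_right, inner_opTens_right, inner_opTens_right,
      opTens_tens, opTens_tens, D.std.star_rt, (D.sa i).star_eq, D.std.rt_vec _ hXi _ ha, star_one]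
    rfl
  rw [hz u η hu]
  have h1 : (innerSL ℂ z : H →L[ℂ] ℂ) = (innerSL ℂ (tens (a Ω) (b Ω))).comp (tensR Ω - tensL Ω) :=
    D.poly_ext fun p => by
      simp only [innerSL_apply_apply, ContinuousLinearMap.comp_apply, sub_apply,
        tensR_apply, tensL_apply, ← D.sum_commOp_poly]
      rw [← hz _ _ (poly_inDom X Ω p)]
  exact congrArg (fun T : H →L[ℂ] ℂ => T u) h1

theorem centered_eq {u : H} {η : Fin n → Coarse H} (hu : InDom X Ω u η) :
    u - ⟪Ω, u⟫_ℂ • Ω = ∑ i, sliceR Ω (commOp X J i (η i)) := by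
  rw [← map_sum, D.sum_commOp hu, map_sub, sliceR_tens, sliceR_tens, inner_self_eq_norm_sq_to_K,
    D.std.norm_one]
  simp

theorem eq_smul_vac_of_grad_zero {u : H} (hu : InDom X Ω u fun _ => 0) : u = ⟪Ω, u⟫_ℂ • Ω := by
  have := D.centered_eq hu
  simp only [map_zero, Finset.sum_const_zero] at this
  exact sub_eq_zero.1 this

/-- Applying id ⊗ τ to the commutator identity recovers u - τ(u) as a bounded function of its
gradient. The size of the constant is immaterial, since iteration will improve it. -/
theorem exists_weak_poincare : ∃ C : ℝ, 0 ≤ C ∧ ∀ u η, InDom X Ω u η → ⟪Ω, u⟫_ℂ = 0 →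
    ‖u‖ ^ 2 ≤ C * ∑ i, ‖η i‖ ^ 2 := by
  refine ⟨∑ i, ‖(sliceR Ω).comp (commOp X J i)‖ ^ 2, by positivity, fun u η hu h0 => ?_⟩
  have h1 := D.centered_eq hu
  rw [h0, zero_smul, sub_zero] at h1
  have h2 : ‖u‖ ≤ ∑ i, ‖(sliceR Ω).comp (commOp X J i)‖ * ‖η i‖ := by
    rw [h1]
    exact norm_sum_le_of_le _ fun i _ => ((sliceR Ω).comp (commOp X J i)).le_opNorm (η i)
  calc ‖u‖ ^ 2 ≤ (∑ i, ‖(sliceR Ω).comp (commOp X J i)‖ * ‖η i‖) ^ 2 := by gcongr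
    _ ≤ _ := Finset.sum_mul_sq_le_sq_mul_sq _ _ _

end SliceData

end Poincare

/-! ### The Poincaré inequality and its equality case -/

section Rigidity

variable {H : Type u} [NormedAddCommGroup H] [InnerProductSpace ℂ H] [CompleteSpace H] {n : ℕ}

theorem exists_star_mul_self {T : H →L[ℂ] H} (hT : T.IsPositive) : ∃ a, T = star a * a := by
  rw [← ContinuousLinearMap.nonneg_iff_isPositive] at hT
  exact CStarAlgebra.nonneg_iff_eq_star_mul_self.1 hT

theorem apply_eq_zero_of_inner_eq_zero {T : H →L[ℂ] H} (hT : T.IsPositive) {x : H}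
    (hx : (⟪x, T x⟫_ℂ).re = 0) : T x = 0 := by
  obtain ⟨a, rfl⟩ := exists_star_mul_self hT
  have h1 : ⟪x, (star a * a) x⟫_ℂ = ⟪a x, a x⟫_ℂ := by
    rw [mul_apply_eq_comp, ContinuousLinearMap.star_eq_adjoint,
      ContinuousLinearMap.adjoint_inner_right]
  rw [h1, inner_self_eq_norm_sq_to_K] at hx
  have h2 : ‖a x‖ ^ 2 = 0 := by exact_mod_cast hx
  have h3 : a x = 0 := norm_eq_zero.1 (pow_eq_zero_iff two_ne_zero |>.1 h2)
  rw [mul_apply_eq_comp, h3, map_zero]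

theorem isPositive_opTens {T T' : H →L[ℂ] H} (hT : T.IsPositive) (hT' : T'.IsPositive) :
    (opTens T T').IsPositive := by
  obtain ⟨a, rfl⟩ := exists_star_mul_self hT
  obtain ⟨b, rfl⟩ := exists_star_mul_self hT'
  rw [opTens_mul, ← star_opTens, ← ContinuousLinearMap.nonneg_iff_isPositive]
  exact star_mul_self_nonneg _

theorem IsPositive_re_inner_nonneg {T : H →L[ℂ] H} (hT : T.IsPositive) (x : H) :
    0 ≤ (⟪x, T x⟫_ℂ).re := hT.re_inner_nonneg_right x

theorem tendsto_opTens {R : ℕ → H →L[ℂ] H} (hR : ∀ m, ‖R m‖ ≤ 1)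
    (h : ∀ g, Tendsto (fun m => R m g) atTop (𝓝 g)) (ζ : Coarse H) :
    Tendsto (fun m => opTens (R m) (R m) ζ) atTop (𝓝 ζ) := by
  have hn : ∀ m, ‖opTens (R m) (R m)‖ ≤ 1 := fun m =>
    (norm_opTens_le _ _).trans (mul_le_one₀ (hR m) (norm_nonneg _) (hR m))
  induction ζ using tens_closure_induction with
  | hc =>
    have hE : Equicontinuous fun m => (opTens (R m) (R m) : Coarse H → Coarse H) := by
      refine UniformEquicontinuous.equicontinuous ?_
      refine LipschitzWith.uniformEquicontinuous _ 1 fun m =>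
        LipschitzWith.of_dist_le_mul fun x y => ?_
      rw [dist_eq_norm, dist_eq_norm, ← map_sub, NNReal.coe_one]
      exact (opTens (R m) (R m)).le_of_opNorm_le (hn m) _
    exact hE.isClosed_setOfPred_tendsto (f := fun x : Coarse H => x) (l := atTop) continuous_id
  | hadd x y hx hy => simpa only [map_add] using hx.add hy
  | h0 a b =>
    simp only [opTens_tens]
    have hc : Continuous fun x : H × H => tens x.1 x.2 :=
      (UniformSpace.Completion.continuous_coe _).comp TensorProduct.continuous_tmul
    have gen : ∀ F : H × H → Coarse H, Continuous F →
        Tendsto (fun m => F (R m a, R m b)) atTop (𝓝 (F (a, b))) := fun F hF =>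
      (hF.tendsto (a, b)).comp ((h a).prodMk_nhds (h b))
    exact gen _ hc

theorem continuous_inner_form {E : Type*} [NormedAddCommGroup E] [InnerProductSpace ℂ E] {ι : Type*}
    [Fintype ι] (v : E) (w : ι → E) (c : ℂ) (A B K : E →L[ℂ] E) (C : ι → E →L[ℂ] E) :
    Continuous fun ζ => ⟪v, c • (A ζ + B ζ)⟫_ℂ + ∑ j, ⟪w j, C j (K ζ)⟫_ℂ := by
  fun_prop

namespace SliceData

variable {X : Fin n → H →L[ℂ] H} {Ω : H} {ξ : Fin n → H}
  {Jac : Fin n → Fin n → Coarse H →L[ℂ] Coarse H} {J : H →ₗᵢ⋆[ℂ] H} {S : Fin n → H →L[ℂ] H}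
  (D : SliceData X Ω ξ Jac J S)
include D

theorem resolvent_vac {ε : ℝ} (hε : 0 < ε) {R : H →L[ℂ] H} {V : Fin n → H →L[ℂ] Coarse H}
    (h : IsResolvent X Ω ε R V) : R Ω = Ω := by
  have h1 := h.norm_sub_apply_sq_le hε (poly_inDom X Ω 1)
  have h2 : evalVec X Ω 1 = Ω := by simp [evalVec_apply]
  have h3 : ‖Ω - R Ω‖ ^ 2 ≤ 0 := by simpa [h2, evalDiff_eq, freeDiff_one] using h1
  have h4 : ‖Ω - R Ω‖ = 0 := pow_eq_zero_iff two_ne_zero |>.1 (le_antisymm h3 (sq_nonneg _))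
  exact (sub_eq_zero.1 (norm_eq_zero.1 h4)).symm

/-- This is the Bochner formula for u = Rg: since g - Rg = ΔRg, its gradient γ - V is ∂̄ΔRg. For
polynomial g the resolvent is a bounded element; the general case follows by continuity in g. -/
theorem inner_grad_sub [NeZero n] {R : H →L[ℂ] H} {V : Fin n → H →L[ℂ] Coarse H}
    (h : IsResolvent X Ω 1 R V) {g : H} {γ : Fin n → Coarse H} (hg : InDom X Ω g γ) (i : Fin n)
    {a b : H →L[ℂ] H} {α β : Fin n → Coarse H} {a' b' : H} (ha : IsBdd X Ω a α)
    (hb : IsBdd X Ω b β) (ha' : IsDiv X Ω α a') (hb' : IsDiv X Ω β b') :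
    ⟪γ i - V i g, tens (a Ω) (b Ω)⟫_ℂ = ⟪V i g, tens a' (b Ω) + tens (a Ω) b'⟫_ℂ +
      ∑ j, ⟪V j g, jacR Jac J j i (tens (a Ω) (b Ω))⟫_ℂ := by
  have key : (fun g : H => ⟪g - R g, rt J b (star (S i) (a Ω)) - a (cj J (S i) (b Ω))⟫_ℂ) =
      fun g => ⟪V i g, tens a' (b Ω) + tens (a Ω) b'⟫_ℂ +
        ∑ j, ⟪V j g, jacR Jac J j i (tens (a Ω) (b Ω))⟫_ℂ := by
    generalize hz : rt J b (star (S i) (a Ω)) - a (cj J (S i) (b Ω)) = z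
    refine D.dense_poly.equalizer (by fun_prop) (by fun_prop) (funext fun p => ?_)
    obtain ⟨u, hu, hu'⟩ := D.resolvent_isBdd one_pos h p
    have hw := h.isDiv one_pos (evalVec X Ω p)
    rw [inv_one, Complex.ofReal_one, one_smul] at hw
    rw [Function.comp_apply, ← hz]
    exact D.commutation D.bddIsCore i hu ha hb hw ha' hb'
  have h2 := D.inner_tens_dgraph i (hg.sub (h.inDom g) i) ha.mem hb.mem
  have h3 := congrArg (starRingEnd ℂ) h2
  rw [inner_conj_symm, inner_conj_symm] at h3
  exact h3.trans (congrFun key g)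

theorem continuous_add_ext {F G : Coarse H → ℂ} (hF : Continuous F) (hG : Continuous G)
    (hF' : ∀ x y, F (x + y) = F x + F y) (hG' : ∀ x y, G (x + y) = G x + G y)
    (h : ∀ a b, F (tens (evalVec X Ω a) (evalVec X Ω b)) = G (tens (evalVec X Ω a) (evalVec X Ω b)))
    (ζ : Coarse H) : F ζ = G ζ := by
  induction ζ using tens_closure_induction with
  | hc => exact isClosed_eq hF hG
  | hadd x y hx hy => rw [hF', hG', hx, hy]
  | h0 a b =>
    have hc2 : Continuous fun b => tens a b := (tensL a).continuous
    refine congrFun (D.dense_poly.equalizer (hF.comp hc2) (hG.comp hc2) (funext fun b₀ => ?_)) b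
    have hc1 : Continuous fun a => tens a (evalVec X Ω b₀) := (tensR (evalVec X Ω b₀)).continuous
    exact congrFun (D.dense_poly.equalizer (hF.comp hc1) (hG.comp hc1) (funext fun a₀ => h a₀ b₀)) a

/-- The intertwining relation for the resolvents. -/
theorem intertwining [NeZero n] {ε : ℝ} (hε : 0 < ε) {R : H →L[ℂ] H} {V : Fin n → H →L[ℂ] Coarse H}
    (h : IsResolvent X Ω 1 R V) {R' : H →L[ℂ] H} {V' : Fin n → H →L[ℂ] Coarse H}
    (h' : IsResolvent X Ω ε R' V') {g : H} {γ : Fin n → Coarse H} (hg : InDom X Ω g γ) (i : Fin n)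
    (ζ : Coarse H) :
    ⟪γ i - V i g, opTens R' R' ζ⟫_ℂ =
      ⟪V i g, ((ε⁻¹ : ℝ) : ℂ) • (opTens (1 - R') R' ζ + opTens R' (1 - R') ζ)⟫_ℂ +
        ∑ j, ⟪V j g, jacR Jac J j i (opTens R' R' ζ)⟫_ℂ := by
  refine D.continuous_add_ext (F := fun ζ => ⟪γ i - V i g, opTens R' R' ζ⟫_ℂ) (G := fun ζ =>
      ⟪V i g, ((ε⁻¹ : ℝ) : ℂ) • (opTens (1 - R') R' ζ + opTens R' (1 - R') ζ)⟫_ℂ +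
        ∑ j, ⟪V j g, jacR Jac J j i (opTens R' R' ζ)⟫_ℂ)
    (continuous_const.inner (opTens R' R').continuous)
    (continuous_inner_form _ _ _ _ _ _ _) (fun x y => ?_)
    (fun x y => ?_) (fun a₀ b₀ => ?_) ζ
  · simp only [map_add, inner_add_right]
  · simp only [map_add, inner_add_right, smul_add, Finset.sum_add_distrib]
    ring
  -- Take a = R'a₀ and b = R'b₀, for which Δa = ε⁻¹(1 - R')a₀ and likewise for b.
  · obtain ⟨a, ha, ha'⟩ := D.resolvent_isBdd hε h' a₀
    obtain ⟨b, hb, hb'⟩ := D.resolvent_isBdd hε h' b₀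
    have key := D.inner_grad_sub h hg i ha hb (h'.isDiv hε _) (h'.isDiv hε _)
    rw [ha', hb', tens_smul_left, tens_smul_right, ← smul_add] at key
    simpa only [opTens_tens, sub_apply, one_apply_eq_self] using key

/-- Test the intertwining relation on V, drop the nonnegative term coming from Δ ⊗ 1 + 1 ⊗ Δ, and
let ε → 0 to remove the regularisation R' ⊗ R'. -/
theorem gradient_bound_aux [NeZero n] {R : H →L[ℂ] H} {V : Fin n → H →L[ℂ] Coarse H}
    (h : IsResolvent X Ω 1 R V) {g : H} {γ : Fin n → Coarse H} (hg : InDom X Ω g γ) :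
    (∑ i, ∑ j, ⟪V j g, jacR Jac J j i (V i g)⟫_ℂ).re ≤ (∑ i, ⟪γ i - V i g, V i g⟫_ℂ).re := by
  have hε : ∀ m : ℕ, 0 < 1 / ((m : ℝ) + 1) := fun m => by positivity
  choose R' V' h' using fun m : ℕ => exists_isResolvent X Ω (hε m)
  have hlim := D.tendsto_resolvent hε tendsto_one_div_add_atTop_nhds_zero_nat h'
  have hK := fun i => tendsto_opTens (fun m => (h' m).norm_le (hε m)) hlim (V i g)
  have hL : Tendsto (fun m => (∑ i, ∑ j, ⟪V j g, jacR Jac J j i (opTens (R' m) (R' m) (V i g))⟫_ℂ).re)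
      atTop (𝓝 (∑ i, ∑ j, ⟪V j g, jacR Jac J j i (V i g)⟫_ℂ).re) := by
    refine (Complex.continuous_re.tendsto _).comp ?_
    exact tendsto_finsetSum _ fun i _ => tendsto_finsetSum _ fun j _ =>
      tendsto_const_nhds.inner (((jacR Jac J j i).continuous.tendsto _).comp (hK i))
  have hR : Tendsto (fun m => (∑ i, ⟪γ i - V i g, opTens (R' m) (R' m) (V i g)⟫_ℂ).re)
      atTop (𝓝 (∑ i, ⟪γ i - V i g, V i g⟫_ℂ).re) := by
    refine (Complex.continuous_re.tendsto _).comp ?_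
    exact tendsto_finsetSum _ fun i _ => tendsto_const_nhds.inner (hK i)
  refine le_of_tendsto_of_tendsto' hL hR fun m => ?_
  simp only [D.intertwining (hε m) h (h' m) hg, Finset.sum_add_distrib, Complex.add_re]
  refine le_add_of_nonneg_left ?_
  rw [Complex.re_sum]
  refine Finset.sum_nonneg fun i _ => ?_
  rw [inner_smul_right, Complex.re_ofReal_mul, inner_add_right, Complex.add_re]
  have p1 := (h' m).isPositive (hε m)
  have p2 := (h' m).isPositive_one_sub (hε m)
  have q1 := IsPositive_re_inner_nonneg (isPositive_opTens p2 p1) (V i g)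
  have q2 := IsPositive_re_inner_nonneg (isPositive_opTens p1 p2) (V i g)
  exact mul_nonneg (inv_nonneg.2 (hε m).le) (add_nonneg q1 q2)

theorem gradient_bound [NeZero n] {R : H →L[ℂ] H} {V : Fin n → H →L[ℂ] Coarse H}
    (h : IsResolvent X Ω 1 R V) {g : H} {γ : Fin n → Coarse H} (hg : InDom X Ω g γ) :
    2 * ∑ i, ‖V i g‖ ^ 2 ≤ ∑ i, (⟪γ i, V i g⟫_ℂ).re := by
  have h1 := D.gradient_bound_aux h hg
  have h2 := D.jacR_bound fun i => V i g
  rw [Finset.sum_comm] at h1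
  have h3 := h2.trans h1
  simp only [inner_sub_left, Finset.sum_sub_distrib, Complex.sub_re, Complex.re_sum,
    inner_self_eq_norm_sq_to_K] at h3
  have h4 : ∀ i, (((‖V i g‖ : ℂ)) ^ 2).re = ‖V i g‖ ^ 2 := fun i => by
    rw [← Complex.ofReal_pow, Complex.ofReal_re]
  have h5 : ∑ i, ((RCLike.ofReal (K := ℂ) ‖V i g‖) ^ 2).re = ∑ i, ‖V i g‖ ^ 2 :=
    Finset.sum_congr rfl fun i _ => h4 i
  rw [h5] at h3
  linarith

theorem energy_decay [NeZero n] {R : H →L[ℂ] H} {V : Fin n → H →L[ℂ] Coarse H}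
    (h : IsResolvent X Ω 1 R V) {g : H} {γ : Fin n → Coarse H} (hg : InDom X Ω g γ) :
    4 * ∑ i, ‖V i g‖ ^ 2 ≤ ∑ i, ‖γ i‖ ^ 2 := by
  have h1 := D.gradient_bound h hg
  have h2 : ∑ i, (⟪γ i, V i g⟫_ℂ).re ≤ ∑ i, (‖γ i‖ ^ 2 / 4 + ‖V i g‖ ^ 2) :=
    Finset.sum_le_sum fun i _ => by
      have := (Complex.re_le_norm _).trans (norm_inner_le_norm (𝕜 := ℂ) (γ i) (V i g))
      nlinarith [sq_nonneg (‖γ i‖ - 2 * ‖V i g‖)]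
  rw [Finset.sum_add_distrib, ← Finset.sum_div] at h2
  linarith

/-- The difference of the two sides is 3(Re⟨γ, V⟩ - 2‖V‖²), nonnegative by `gradient_bound`. The
extra square is kept for the equality case. -/
theorem deficit_decay [NeZero n] {R : H →L[ℂ] H} {V : Fin n → H →L[ℂ] Coarse H}
    (h : IsResolvent X Ω 1 R V) {g : H} {γ : Fin n → Coarse H} (hg : InDom X Ω g γ) :
    (∑ i, ‖V i g‖ ^ 2 - ‖R g‖ ^ 2) + ∑ i, ‖γ i - (2 : ℂ) • V i g‖ ^ 2 ≤
      ∑ i, ‖γ i‖ ^ 2 - ‖g‖ ^ 2 := by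
  have h1 := D.gradient_bound h hg
  -- Tested on g and on 0, minimality gives ‖g - Rg‖² = Re⟨γ, V⟩ - ‖V‖² and ‖g‖² = ‖Rg‖² + ‖V‖² +
  -- Re⟨γ, V⟩.
  have e1 := h.pythagoras g hg
  have e2 := h.pythagoras g (poly_inDom X Ω 0)
  have h3 : ∀ i, ‖γ i - (2 : ℂ) • V i g‖ ^ 2 =
      ‖γ i‖ ^ 2 - 4 * (⟪γ i, V i g⟫_ℂ).re + 4 * ‖V i g‖ ^ 2 := fun i => by
    rw [@norm_sub_sq ℂ, inner_smul_right, norm_smul]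
    have : RCLike.re ((2 : ℂ) * ⟪γ i, V i g⟫_ℂ) = 2 * (⟪γ i, V i g⟫_ℂ).re := by
      simp
    rw [this]
    simp only [Complex.norm_ofNat]
    ring
  have h4 : ∀ i, ‖γ i - V i g‖ ^ 2 =
      ‖γ i‖ ^ 2 - 2 * (⟪γ i, V i g⟫_ℂ).re + ‖V i g‖ ^ 2 := fun i => by
    rw [@norm_sub_sq ℂ]; rfl
  simp only [map_zero, zero_sub, norm_neg, norm_zero, sub_self, one_mul] at e1 e2
  simp only [h4, Finset.sum_add_distrib, Finset.sum_sub_distrib, ← Finset.mul_sum] at e1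
  simp only [h3, Finset.sum_add_distrib, Finset.sum_sub_distrib, ← Finset.mul_sum]
  rw [norm_sub_rev g (R g)] at e1
  norm_num at e2
  linarith

/-- The free Poincaré inequality. -/
theorem poincare [NeZero n] {g : H} {γ : Fin n → Coarse H} (hg : InDom X Ω g γ)
    (hc : ⟪Ω, g⟫_ℂ = 0) : ‖g‖ ^ 2 ≤ ∑ i, ‖γ i‖ ^ 2 := by
  obtain ⟨R, V, h⟩ := exists_isResolvent X Ω one_pos
  obtain ⟨C, hC, hw⟩ := D.exists_weak_poincare
  -- The bound for Rg passes to g because the deficit does not increase under R, while the error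
  -- term gains the factor 1/4 from the energy.
  have key : ∀ k : ℕ, ∀ g γ, InDom X Ω g γ → ⟪Ω, g⟫_ℂ = 0 →
      ‖g‖ ^ 2 ≤ ∑ i, ‖γ i‖ ^ 2 + C * (1 / 4) ^ k * ∑ i, ‖γ i‖ ^ 2 := by
    intro k
    induction k with
    | zero =>
      intro g γ hg hc
      have := hw g γ hg hc
      have h0 : 0 ≤ ∑ i, ‖γ i‖ ^ 2 := by positivity
      rw [pow_zero, mul_one]
      linarith
    | succ k ih =>
      intro g γ hg hc
      have hc' : ⟪Ω, R g⟫_ℂ = 0 := by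
        rw [← D.resolvent_vac one_pos h, ← ContinuousLinearMap.adjoint_inner_left,
          ← ContinuousLinearMap.star_eq_adjoint, h.isSelfAdjoint.star_eq,
          D.resolvent_vac one_pos h, D.resolvent_vac one_pos h, hc]
      have h1 := ih (R g) _ (h.inDom g) hc'
      have h2 := D.energy_decay h hg
      have h3 := D.deficit_decay h hg
      have h4 : 0 ≤ ∑ i, ‖γ i - (2 : ℂ) • V i g‖ ^ 2 := by positivity
      have h5 : C * (1 / 4) ^ k * ∑ i, ‖V i g‖ ^ 2 ≤ C * (1 / 4) ^ k * (1 / 4 * ∑ i, ‖γ i‖ ^ 2) := by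
        gcongr; linarith
      have h6 : C * (1 / 4) ^ (k + 1) * ∑ i, ‖γ i‖ ^ 2 =
          C * (1 / 4) ^ k * (1 / 4 * ∑ i, ‖γ i‖ ^ 2) := by ring
      rw [h6]
      linarith
  have hl : Tendsto (fun k : ℕ => ∑ i, ‖γ i‖ ^ 2 + C * (1 / 4) ^ k * ∑ i, ‖γ i‖ ^ 2) atTop
      (𝓝 (∑ i, ‖γ i‖ ^ 2)) := by
    have h1 := tendsto_pow_atTop_nhds_zero_of_lt_one (r := (1 / 4 : ℝ)) (by norm_num) (by norm_num)
    have h2 := ((h1.const_mul C).mul_const (∑ i, ‖γ i‖ ^ 2)).const_add (∑ i, ‖γ i‖ ^ 2)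
    simpa using h2
  exact ge_of_tendsto' hl fun k => key k g γ hg hc

end SliceData

end Rigidity

/-! ### Equality in the Poincaré inequality: constant gradients -/

section Rigidity

/-- A vector at which a self-adjoint A ≥ 1 attains its lower bound is fixed by A. With r = Av - v,
the form A - 1 along v + t r is nonnegative for all real t but has slope 2‖r‖² at t = 0. -/
theorem sum_apply_eq_of_form_le {E ι : Type*} [NormedAddCommGroup E] [InnerProductSpace ℂ E]
    [CompleteSpace E] [Fintype ι] {A : ι → ι → E →L[ℂ] E} (hA : ∀ i j, star (A i j) = A j i)
    (hb : ∀ v : ι → E, ∑ i, ‖v i‖ ^ 2 ≤ (∑ i, ∑ j, ⟪v i, A i j (v j)⟫_ℂ).re) {v : ι → E}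
    (hv : (∑ i, ∑ j, ⟪v i, A i j (v j)⟫_ℂ).re ≤ ∑ i, ‖v i‖ ^ 2) (i : ι) :
    ∑ j, A i j (v j) = v i := by
  set r : ι → E := fun i => ∑ j, A i j (v j) - v i with hr
  set Q : ℝ := (∑ i, ∑ j, ⟪r i, A i j (r j)⟫_ℂ).re with hQ
  have hsym : ∀ x y : ι → E, (∑ i, ∑ j, ⟪x i, A i j (y j)⟫_ℂ).re =
      (∑ i, ∑ j, ⟪y i, A i j (x j)⟫_ℂ).re := fun x y => by
    rw [← Complex.conj_re, map_sum, Finset.sum_congr rfl fun i _ => map_sum _ _ _,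
      Finset.sum_comm]
    congr 1
    refine Finset.sum_congr rfl fun i _ => Finset.sum_congr rfl fun j _ => ?_
    rw [inner_conj_symm, ← ContinuousLinearMap.adjoint_inner_right,
      ← ContinuousLinearMap.star_eq_adjoint, hA]
  have hlin : (∑ i, ∑ j, ⟪r i, A i j (v j)⟫_ℂ).re = ∑ i, ‖r i‖ ^ 2 + ∑ i, (⟪r i, v i⟫_ℂ).re := by
    rw [Complex.re_sum, ← Finset.sum_add_distrib]
    refine Finset.sum_congr rfl fun i _ => ?_
    rw [← inner_sum, show ∑ j, A i j (v j) = r i + v i by simp [hr], inner_add_right,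
      Complex.add_re]
    congr 1
    exact inner_self_eq_norm_sq (𝕜 := ℂ) (r i)
  have hexp : ∀ t : ℝ, 0 ≤ 2 * t * ∑ i, ‖r i‖ ^ 2 + t ^ 2 * Q := fun t => by
    have h1 := hb fun i => v i + (t : ℂ) • r i
    have h2 : ∀ i, ‖v i + (t : ℂ) • r i‖ ^ 2 = ‖v i‖ ^ 2 + 2 * t * (⟪r i, v i⟫_ℂ).re +
        t ^ 2 * ‖r i‖ ^ 2 := fun i => by
      rw [@norm_add_sq ℂ, inner_smul_right, norm_smul, mul_pow, Complex.norm_real,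
        Real.norm_eq_abs, sq_abs, ← inner_conj_symm (v i)]
      have : RCLike.re ((t : ℂ) * (starRingEnd ℂ) ⟪r i, v i⟫_ℂ) = t * (⟪r i, v i⟫_ℂ).re := by
        rw [RCLike.re_eq_complex_re, Complex.re_ofReal_mul, Complex.conj_re]
      rw [this]
      ring
    have h3 : (∑ i, ∑ j, ⟪v i + (t : ℂ) • r i, A i j (v j + (t : ℂ) • r j)⟫_ℂ).re =
        (∑ i, ∑ j, ⟪v i, A i j (v j)⟫_ℂ).re + t * (∑ i, ∑ j, ⟪v i, A i j (r j)⟫_ℂ).re +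
          t * (∑ i, ∑ j, ⟪r i, A i j (v j)⟫_ℂ).re + t ^ 2 * Q := by
      rw [hQ, ← Complex.re_ofReal_mul, ← Complex.re_ofReal_mul, ← Complex.re_ofReal_mul,
        ← Complex.add_re, ← Complex.add_re, ← Complex.add_re]
      congr 1
      simp only [Finset.mul_sum, ← Finset.sum_add_distrib]
      refine Finset.sum_congr rfl fun i _ => Finset.sum_congr rfl fun j _ => ?_
      rw [map_add, map_smul]
      simp only [inner_add_left, inner_add_right, inner_smul_left, inner_smul_right,
        Complex.conj_ofReal, Complex.ofReal_pow]
      ring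
    rw [h3, hsym v r, hlin] at h1
    simp only [h2, Finset.sum_add_distrib, ← Finset.mul_sum] at h1
    have h4 : 0 ≤ t ^ 2 * ∑ i, ‖r i‖ ^ 2 := by positivity
    linarith
  have hR : ∑ i, ‖r i‖ ^ 2 ≤ 0 := by
    by_contra! hpos
    set ρ := ∑ i, ‖r i‖ ^ 2 with hρ
    have hQ0 : 0 ≤ Q := (by positivity : (0 : ℝ) ≤ ∑ i, ‖r i‖ ^ 2).trans (hb r)
    -- A small negative t makes the linear term win; Q + 1 avoids dividing by a possibly zero Q.
    have h1 := hexp (-(ρ / (Q + 1)))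
    have h2 : 2 * -(ρ / (Q + 1)) * ρ + (-(ρ / (Q + 1))) ^ 2 * Q =
        -(ρ / (Q + 1)) ^ 2 * (Q + 2) := by
      field_simp
      ring
    rw [h2] at h1
    have h3 : 0 < (ρ / (Q + 1)) ^ 2 * (Q + 2) := by positivity
    linarith
  have h0 : ‖r i‖ ^ 2 = 0 :=
    (Finset.sum_eq_zero_iff_of_nonneg fun i _ => sq_nonneg ‖r i‖).1
      (le_antisymm hR (by positivity)) i (Finset.mem_univ i)
  exact sub_eq_zero.1 (norm_eq_zero.1 (pow_eq_zero_iff two_ne_zero |>.1 h0))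

variable {H : Type u} [NormedAddCommGroup H] [InnerProductSpace ℂ H] [CompleteSpace H] {n : ℕ}

theorem eq_smul_tens_vac {Ω : H} {v : Coarse H} (hR : ∀ c, sliceR c v = ⟪Ω, sliceR c v⟫_ℂ • Ω)
    (hL : ∀ c, sliceL c v = ⟪Ω, sliceL c v⟫_ℂ • Ω) : v = ⟪tens Ω Ω, v⟫_ℂ • tens Ω Ω := by
  refine coarse_inner_ext fun a b => ?_
  rw [← inner_sliceR, hR, inner_smul_right, inner_sliceR, ← inner_sliceL, hL, inner_smul_right,
    inner_sliceL, inner_smul_right, inner_tens]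
  ring

namespace SliceData

variable {X : Fin n → H →L[ℂ] H} {Ω : H} {ξ : Fin n → H}
  {Jac : Fin n → Fin n → Coarse H →L[ℂ] Coarse H} {J : H →ₗᵢ⋆[ℂ] H} {S : Fin n → H →L[ℂ] H}
  (D : SliceData X Ω ξ Jac J S)
include D

theorem resolvent_injective {R : H →L[ℂ] H} {V : Fin n → H →L[ℂ] Coarse H}
    (h : IsResolvent X Ω 1 R V) {g : H} (hg : R g = 0) : g = 0 := by
  have h1 := h.energy g
  rw [hg, norm_zero, mul_zero, one_mul] at h1
  have h2 : ∑ j, ‖V j g‖ ^ 2 ≤ 0 := by linarith [sq_nonneg (0 : ℝ)]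
  have h3 : ∀ j, V j g = 0 := fun j => norm_eq_zero.1 <| pow_eq_zero_iff two_ne_zero |>.1 <|
    (Finset.sum_eq_zero_iff_of_nonneg fun j _ => sq_nonneg ‖V j g‖).1
      (le_antisymm h2 (by positivity)) j (Finset.mem_univ j)
  refine D.poly_ext_inner fun p => ?_
  have h4 := h.eq g _ _ (poly_inDom X Ω p)
  simp only [h3, inner_zero_left, Finset.sum_const_zero, mul_zero, hg, sub_zero] at h4
  rw [← inner_conj_symm, h4, map_zero, inner_zero_right]

theorem eq_smul_vac_of_resolvent {R : H →L[ℂ] H} {V : Fin n → H →L[ℂ] Coarse H}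
    (h : IsResolvent X Ω 1 R V) {g : H} (hg : R g = g) : g = ⟪Ω, g⟫_ℂ • Ω := by
  have h1 := h.energy g
  rw [hg, one_mul] at h1
  have h2 : ∑ j, ‖V j g‖ ^ 2 ≤ 0 := by nlinarith
  have h3 : ∀ j, V j g = 0 := fun j => norm_eq_zero.1 <| pow_eq_zero_iff two_ne_zero |>.1 <|
    (Finset.sum_eq_zero_iff_of_nonneg fun j _ => sq_nonneg ‖V j g‖).1
      (le_antisymm h2 (by positivity)) j (Finset.mem_univ j)
  have h4 := h.inDom g
  simp only [h3, hg] at h4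
  exact D.eq_smul_vac_of_grad_zero h4

theorem inner_vac_resolvent {R : H →L[ℂ] H} {V : Fin n → H →L[ℂ] Coarse H}
    (h : IsResolvent X Ω 1 R V) (g : H) : ⟪Ω, R g⟫_ℂ = ⟪Ω, g⟫_ℂ := by
  conv_rhs => rw [← D.resolvent_vac one_pos h]
  rw [← ContinuousLinearMap.adjoint_inner_right, ← ContinuousLinearMap.star_eq_adjoint,
    h.isSelfAdjoint.star_eq]

/-- A saturating vector is an eigenvector of the resolvent, and its gradient is constant. -/
theorem exists_grad_eq [NeZero n] {f : H} {γ : Fin n → Coarse H} (hf : InDom X Ω f γ)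
    (hc : ⟪Ω, f⟫_ℂ = 0) (hsat : ‖f‖ ^ 2 = ∑ i, ‖γ i‖ ^ 2) :
    IsDiv X Ω γ f ∧ (∀ i, ∑ j, jacR Jac J i j (γ j) = γ i) ∧
      ∀ i, γ i = ⟪tens Ω Ω, γ i⟫_ℂ • tens Ω Ω := by
  obtain ⟨R, V, h⟩ := exists_isResolvent X Ω one_pos
  have hd := D.deficit_decay h hf
  have hp := D.poincare (h.inDom f) (by rw [D.inner_vac_resolvent h, hc])
  -- The deficit of f is zero and that of Rf is nonnegative, so the square in `deficit_decay`
  -- vanishes.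
  have h1 : ∑ i, ‖γ i - (2 : ℂ) • V i f‖ ^ 2 ≤ 0 := by linarith
  have hγ : ∀ i, γ i = (2 : ℂ) • V i f := fun i => sub_eq_zero.1 <| norm_eq_zero.1 <|
    pow_eq_zero_iff two_ne_zero |>.1 <|
    (Finset.sum_eq_zero_iff_of_nonneg fun j _ => sq_nonneg ‖γ j - (2 : ℂ) • V j f‖).1
      (le_antisymm h1 (by positivity)) i (Finset.mem_univ i)
  have hRf : f = (2 : ℂ) • R f := by
    have h2 := hf.sub ((h.inDom f).smul 2)
    simp only [← hγ, sub_self] at h2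
    have h3 := D.eq_smul_vac_of_grad_zero h2
    rw [inner_sub_right, inner_smul_right, D.inner_vac_resolvent h, hc, mul_zero, sub_zero,
      zero_smul] at h3
    exact sub_eq_zero.1 h3
  have hV : ∀ i, V i f = γ i - V i f := fun i => by rw [hγ, two_smul, add_sub_cancel_right]
  -- Since γ - V = V, the gradient bound becomes the equality case of CD(1,∞).
  have hjac : ∀ i, ∑ j, jacR Jac J i j (V j f) = V i f := by
    refine sum_apply_eq_of_form_le D.star_jacR D.jacR_bound ?_
    have h2 := D.gradient_bound_aux h hf
    rw [Finset.sum_comm] at h2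
    refine h2.trans (le_of_eq ?_)
    rw [Complex.re_sum]
    refine Finset.sum_congr rfl fun i _ => ?_
    rw [← hV]
    exact inner_self_eq_norm_sq (𝕜 := ℂ) _
  -- With R' = R the Jacobian term equals the left side of the intertwining relation, so two
  -- nonnegative terms add up to zero.
  have hzero : ∀ i, opTens (1 - R) R (V i f) = 0 ∧ opTens R (1 - R) (V i f) = 0 := fun i => by
    have h2 := D.intertwining one_pos h h hf i (V i f)
    have h3 : ∑ j, ⟪V j f, jacR Jac J j i (opTens R R (V i f))⟫_ℂ =
        ⟪V i f, opTens R R (V i f)⟫_ℂ := by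
      generalize opTens R R (V i f) = ζ
      rw [← hjac i]
      rw [sum_inner]
      refine Finset.sum_congr rfl fun j _ => ?_
      rw [← ContinuousLinearMap.adjoint_inner_left, ← ContinuousLinearMap.star_eq_adjoint,
        D.star_jacR]
    rw [h3, ← hV, inv_one, Complex.ofReal_one, one_smul, inner_add_right] at h2
    have p1 := h.isPositive one_pos
    have p2 := h.isPositive_one_sub one_pos
    have q1 := IsPositive_re_inner_nonneg (isPositive_opTens p2 p1) (V i f)
    have q2 := IsPositive_re_inner_nonneg (isPositive_opTens p1 p2) (V i f)
    have h4 := congrArg Complex.re h2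
    rw [Complex.add_re, Complex.add_re] at h4
    exact ⟨apply_eq_zero_of_inner_eq_zero (isPositive_opTens p2 p1) (by linarith),
      apply_eq_zero_of_inner_eq_zero (isPositive_opTens p1 p2) (by linarith)⟩
  refine ⟨fun z ζ hz => ?_, fun i => ?_, fun i => ?_⟩
  · have h2 := h.eq f z ζ hz
    have h3 : f - R f = R f := by
      conv_lhs => rw [hRf]
      rw [← hRf]
      conv_lhs => enter [1]; rw [hRf]
      rw [two_smul, add_sub_cancel_right]
    rw [h3, Complex.ofReal_one, one_mul] at h2
    simp only [hγ, inner_smul_left]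
    conv_lhs => rw [hRf]
    rw [inner_smul_left, h2, Finset.mul_sum]
  · simp only [hγ, map_smul, ← Finset.smul_sum, hjac]
  · suffices hs : V i f = ⟪tens Ω Ω, V i f⟫_ℂ • tens Ω Ω by
      rw [hγ, inner_smul_right, mul_smul, ← hs]
    obtain ⟨hz1, hz2⟩ := hzero i
    -- R is injective and can be stripped off its leg after slicing. Then every slice of V is fixed
    -- by R, hence is a multiple of Ω.
    have hl : opTens (1 - R) 1 (V i f) = 0 := coarse_inner_ext fun a b => by
      have h2 : R (sliceL a (opTens (1 - R) 1 (V i f))) = 0 := by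
        have h3 := congrArg (sliceL a) hz1
        rw [map_zero, sliceL_opTens] at h3
        rw [sliceL_opTens]
        exact h3
      rw [← inner_sliceL, D.resolvent_injective h h2, inner_zero_right, inner_zero_right]
    have hr : opTens 1 (1 - R) (V i f) = 0 := coarse_inner_ext fun a b => by
      have h2 : R (sliceR b (opTens 1 (1 - R) (V i f))) = 0 := by
        have h3 := congrArg (sliceR b) hz2
        rw [map_zero, sliceR_opTens] at h3
        rw [sliceR_opTens]
        exact h3
      rw [← inner_sliceR, D.resolvent_injective h h2, inner_zero_right, inner_zero_right]
    refine eq_smul_tens_vac (fun c => ?_) fun c => ?_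
    · refine D.eq_smul_vac_of_resolvent h (sub_eq_zero.1 ?_).symm
      have h3 := congrArg (sliceR c) hl
      rwa [map_zero, sliceR_opTens, star_one] at h3
    · refine D.eq_smul_vac_of_resolvent h (sub_eq_zero.1 ?_).symm
      have h3 := congrArg (sliceL c) hr
      rwa [map_zero, sliceL_opTens, star_one] at h3

/-- A self-adjoint vector that saturates the Poincaré inequality is a linear combination of the
centered variables, and of the conjugate variables. -/
theorem exists_coeff [NeZero n] {f : H} {γ : Fin n → Coarse H} (hf : InDom X Ω f γ)
    (hc : ⟪Ω, f⟫_ℂ = 0) (hJ : J f = f) (hsat : ‖f‖ ^ 2 = ∑ i, ‖γ i‖ ^ 2) :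
    ∃ c : Fin n → ℝ, f = ∑ i, (c i : ℂ) • centered Ω (X i) Ω ∧ f = ∑ i, (c i : ℂ) • ξ i ∧
      ∑ i, c i ^ 2 = ‖f‖ ^ 2 ∧
      ∀ i, ∑ j, (c j : ℂ) • jacR Jac J i j (tens Ω Ω) = (c i : ℂ) • tens Ω Ω := by
  obtain ⟨h1, h2, h3⟩ := D.exists_grad_eq hf hc hsat
  -- Jf = f makes the gradient invariant under the flip conjugation, so its constant coefficients
  -- are real.
  have hreal : ∀ i, starRingEnd ℂ ⟪tens Ω Ω, γ i⟫_ℂ = ⟪tens Ω Ω, γ i⟫_ℂ := fun i => by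
    have h4 := D.star_inDom hf i
    rw [hJ] at h4
    have h5 : γ i = tensStar J (γ i) := D.dgraph_unique (hf i) h4
    have h6 := inner_tensStar J (tens Ω Ω) (γ i)
    rw [tensStar_tens, D.std.J_vac, ← h5] at h6
    rw [inner_conj_symm, h6]
  choose c hc' using fun i => Complex.conj_eq_iff_real.1 (hreal i)
  have hγ : ∀ i, γ i = (c i : ℂ) • tens Ω Ω := fun i => by rw [← hc']; exact h3 i
  have hΩ : ‖tens Ω Ω‖ = 1 := by rw [norm_tens, D.std.norm_one, mul_one]
  refine ⟨c, ?_, ?_, ?_, fun i => ?_⟩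
  · set y : FreeAlgebra ℂ (Fin n) := ∑ i, (c i : ℂ) • FreeAlgebra.ι ℂ i with hy
    have hyD : ∀ j, evalDiff X Ω j y = γ j := fun j => by
      have e1 : evalVec X Ω 1 = Ω := by simp [evalVec_apply]
      rw [hy, map_sum, Finset.sum_eq_single j]
      · rw [map_smul, evalDiff_eq, freeDiff_ι, if_pos rfl, tmap_tmul, e1, hγ]
      · intro i _ hi
        rw [map_smul, evalDiff_eq, freeDiff_ι, if_neg hi.symm, map_zero, smul_zero]
      · simp
    have hsub := hf.sub (poly_inDom X Ω y)
    simp only [hyD, sub_self] at hsub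
    have h4 := D.eq_smul_vac_of_grad_zero hsub
    have h5 : evalVec X Ω y = ∑ i, (c i : ℂ) • X i Ω := by
      rw [hy, map_sum]
      refine Finset.sum_congr rfl fun i _ => ?_
      rw [map_smul, evalVec_apply]
      simp [pol]
    rw [inner_sub_right, hc, zero_sub, h5, sub_eq_iff_eq_add, inner_sum, neg_smul,
      Finset.sum_smul] at h4
    rw [h4, neg_add_eq_sub, ← Finset.sum_sub_distrib]
    refine Finset.sum_congr rfl fun i _ => ?_
    simp only [centered, sub_apply, smul_apply,
      one_apply_eq_self, smul_sub, inner_smul_right, smul_smul, tr]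
  · refine D.poly_ext_inner fun p => ?_
    have h4 := h1 _ _ (poly_inDom X Ω p)
    simp only [hγ, inner_smul_left, Complex.conj_ofReal, ← D.inner_conj_var] at h4
    have h5 := congrArg (starRingEnd ℂ) h4
    rw [inner_conj_symm, map_sum] at h5
    rw [h5, inner_sum]
    refine Finset.sum_congr rfl fun i _ => ?_
    rw [map_mul, inner_conj_symm, inner_smul_right, Complex.conj_ofReal]
  · rw [hsat]
    refine Finset.sum_congr rfl fun i _ => ?_
    rw [hγ, norm_smul, hΩ, mul_one, Complex.norm_real, Real.norm_eq_abs, sq_abs]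
  · have h4 := h2 i
    simpa only [hγ, map_smul] using h4

end SliceData

end Rigidity

/-! ### The creation operator of a semicircular direction -/

section Creation

variable {H : Type u} [NormedAddCommGroup H] [InnerProductSpace ℂ H] [CompleteSpace H] {n : ℕ}

/-- `ℓ` is a creation operator that is free from `B`. -/
structure IsFreeCreation (Ω : H) (ℓ : H →L[ℂ] H) (B : StarSubalgebra ℂ (H →L[ℂ] H)) : Prop where
  isometry : star ℓ * ℓ = 1
  compress : ∀ b ∈ B, star ℓ * b * ℓ = tr Ω b • 1
  ann : ∀ b ∈ B, star ℓ (b Ω) = 0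

theorem sliceR_zero (ζ : Coarse H) : sliceR 0 ζ = 0 :=
  ext_inner_left ℂ fun z => by
    rw [inner_sliceR, ← tensL_apply, map_zero, inner_zero_left, inner_zero_right]

theorem opTens_sum_right {ι : Type*} (s : Finset ι) (x : H →L[ℂ] H) (T : ι → H →L[ℂ] H) :
    opTens x (∑ i ∈ s, T i) = ∑ i ∈ s, opTens x (T i) :=
  coarse_clm_ext fun a b => by
    rw [opTens_tens, sum_apply, sum_apply]
    simp only [opTens_tens]
    exact map_sum (tensL (x a)) _ _

/-- `∑ⱼ cⱼ Sⱼ`. -/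
def dirSlice (S : Fin n → H →L[ℂ] H) (c : Fin n → ℝ) : H →L[ℂ] H := ∑ j, (c j : ℂ) • S j

/-- `(∑ⱼ cⱼ ∂ⱼ) p`. -/
def dirDiff (X : Fin n → H →L[ℂ] H) (Ω : H) (c : Fin n → ℝ) (p : FreeAlgebra ℂ (Fin n)) : Coarse H :=
  ∑ j, (c j : ℂ) • evalDiff X Ω j p

theorem star_dirSlice (S : Fin n → H →L[ℂ] H) (c : Fin n → ℝ) :
    star (dirSlice S c) = ∑ j, (c j : ℂ) • star (S j) := by
  rw [dirSlice, star_sum]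
  refine Finset.sum_congr rfl fun j _ => ?_
  rw [star_smul]
  simp

/-- The centered linear form `∑ⱼ cⱼ (tⱼ - τ(Xⱼ))`. -/
def linPoly (X : Fin n → H →L[ℂ] H) (Ω : H) (c : Fin n → ℝ) : FreeAlgebra ℂ (Fin n) :=
  ∑ j, (c j : ℂ) • (FreeAlgebra.ι ℂ j - algebraMap ℂ _ (tr Ω (X j)))

theorem pol_linPoly (X : Fin n → H →L[ℂ] H) (Ω : H) (c : Fin n → ℝ) :
    pol X (linPoly X Ω c) = ∑ j, (c j : ℂ) • centered Ω (X j) := by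
  rw [pol, linPoly, map_sum]
  refine Finset.sum_congr rfl fun j _ => ?_
  rw [map_smul, map_sub, FreeAlgebra.lift_ι_apply, AlgHom.commutes, centered,
    Algebra.algebraMap_eq_smul_one]

theorem evalDiff_linPoly (X : Fin n → H →L[ℂ] H) (Ω : H) (c : Fin n → ℝ) (j : Fin n) :
    evalDiff X Ω j (linPoly X Ω c) = (c j : ℂ) • tens Ω Ω := by
  have e1 : evalVec X Ω 1 = Ω := by simp [evalVec_apply]
  rw [linPoly, map_sum, Finset.sum_eq_single j]
  · rw [map_smul, map_sub, evalDiff_eq, evalDiff_eq, freeDiff_ι, if_pos rfl, tmap_tmul, e1,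
      freeDiff_algebraMap, map_zero, sub_zero]
  · intro i _ hi
    rw [map_smul, map_sub, evalDiff_eq, evalDiff_eq, freeDiff_ι, if_neg hi.symm,
      freeDiff_algebraMap, map_zero, sub_zero, smul_zero]
  · simp

namespace SliceData

variable {X : Fin n → H →L[ℂ] H} {Ω : H} {ξ : Fin n → H}
  {Jac : Fin n → Fin n → Coarse H →L[ℂ] Coarse H} {J : H →ₗᵢ⋆[ℂ] H} {S : Fin n → H →L[ℂ] H}
  (D : SliceData X Ω ξ Jac J S)
include D

theorem dirSlice_evalVec (c : Fin n → ℝ) (p : FreeAlgebra ℂ (Fin n)) :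
    dirSlice S c (evalVec X Ω p) = sliceR Ω (dirDiff X Ω c p) := by
  simp only [dirSlice, sum_apply, smul_apply, D.S_apply,
    dirDiff, map_sum, map_smul, sliceR_vac_evalDiff]

theorem dirDiff_mul_of_eq_zero {c : Fin n → ℝ} {x : FreeAlgebra ℂ (Fin n)}
    (hx : dirDiff X Ω c x = 0) (q : FreeAlgebra ℂ (Fin n)) :
    dirDiff X Ω c (q * x) = opTens 1 (rt J (pol X x)) (dirDiff X Ω c q) := by
  have h1 : opTens (pol X q) 1 (dirDiff X Ω c x) = 0 := by rw [hx, map_zero]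
  simp only [dirDiff, map_sum, map_smul] at h1 ⊢
  simp only [D.evalDiff_mul, smul_add, Finset.sum_add_distrib, h1, zero_add]

theorem exists_star_dirDiff {c : Fin n → ℝ} {x : FreeAlgebra ℂ (Fin n)}
    (hx : dirDiff X Ω c x = 0) : ∃ y, pol X y = star (pol X x) ∧ dirDiff X Ω c y = 0 := by
  obtain ⟨y, hy, hy'⟩ := D.exists_star_poly x
  refine ⟨y, hy, ?_⟩
  have h1 : tensStar J (dirDiff X Ω c x) = 0 := by rw [hx, map_zero]
  simpa only [dirDiff, map_sum, map_smulₛₗ, Complex.conj_ofReal, ← hy'] using h1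

section Saturated

variable {c : Fin n → ℝ} (hc : ∑ j, c j ^ 2 = 1)
  (hξ : ∑ i, (c i : ℂ) • centered Ω (X i) Ω = ∑ i, (c i : ℂ) • ξ i)
  (hjac : ∀ i, ∑ j, (c j : ℂ) • jacR Jac J i j (tens Ω Ω) = (c i : ℂ) • tens Ω Ω)

include hjac in
-- The eigenvector relation spreads from Ω ⊗ Ω to h ⊗ Ω because `jacR` commutes with left
-- multiplication.
theorem sum_jacR_tens (i : Fin n) (h : H) :
    ∑ j, (c j : ℂ) • jacR Jac J i j (tens h Ω) = (c i : ℂ) • tens h Ω := by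
  have h1 : ∑ j, (c j : ℂ) • (jacR Jac J i j).comp (tensR Ω) = (c i : ℂ) • tensR Ω :=
    D.poly_ext fun p => by
      have h2 : tens (evalVec X Ω p) Ω = opTens (pol X p) (rt J 1) (tens Ω Ω) := by
        rw [opTens_tens, D.std.rt_vac _ (vn_one_mem _), evalVec_apply]; rfl
      have h3 := congrArg (opTens (pol X p) (rt J 1)) (hjac i)
      simp only [map_sum, map_smul, ← D.jacR_comm _ _ (pol_mem X p) (vn_one_mem _), ← h2] at h3
      simpa only [sum_apply, smul_apply,
        ContinuousLinearMap.comp_apply, tensR_apply] using h3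
  have h4 := congrArg (fun T : H →L[ℂ] Coarse H => T h) h1
  simpa only [sum_apply, smul_apply,
    ContinuousLinearMap.comp_apply, tensR_apply] using h4

include hξ in
-- The sum is right multiplication by ∑ c_i ξ_i, which saturation identifies with the centered
-- linear form.
theorem dirSlice_add_star : dirSlice S c + star (dirSlice S c) = rt J (pol X (linPoly X Ω c)) :=
  D.poly_ext fun p => by
    rw [star_dirSlice, dirSlice, ← Finset.sum_add_distrib, sum_apply,
      evalVec_apply, D.std.rt_vec _ (pol_mem X _) _ (pol_mem X p), pol_linPoly,
      sum_apply]
    simp only [smul_apply]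
    rw [hξ, map_sum]
    refine Finset.sum_congr rfl fun i _ => ?_
    rw [map_smul, ← D.S_add_star_S, ← smul_add]
    rfl

include hξ hjac in
-- Being right multiplication by a polynomial minus a slice, the adjoint maps polynomials to
-- polynomials. In this direction the Jacobian term of `star_S_mem` reduces to c_j (p ⊗ 1).
theorem exists_star_dirSlice (p : FreeAlgebra ℂ (Fin n)) : ∃ q,
    star (dirSlice S c) (evalVec X Ω p) = evalVec X Ω q ∧ ∀ j, evalDiff X Ω j q =
      opTens 1 (star (dirSlice S c)) (evalDiff X Ω j p) + (c j : ℂ) • tens (evalVec X Ω p) Ω := by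
  set q : FreeAlgebra ℂ (Fin n) := p * linPoly X Ω c -
    ∑ j, (c j : ℂ) • slice (vacFun X Ω) j p with hq
  have h1 : star (dirSlice S c) (evalVec X Ω p) = evalVec X Ω q := by
    have h2 : dirSlice S c (evalVec X Ω p) + star (dirSlice S c) (evalVec X Ω p) =
        rt J (pol X (linPoly X Ω c)) (evalVec X Ω p) := by
      rw [← D.dirSlice_add_star hξ]; rfl
    rw [D.rt_evalVec, ← eq_sub_iff_add_eq'] at h2
    rw [h2, hq, map_sub, map_sum]
    simp only [dirSlice, sum_apply, smul_apply, D.S_apply,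
      map_smul]
  refine ⟨q, h1, fun j => D.dgraph_unique (poly_mem_dgraph X Ω j q) ?_⟩
  rw [← h1, ← D.sum_jacR_tens hjac, star_dirSlice]
  have h3 : ∀ i, (c i : ℂ) • (star (S i) (evalVec X Ω p),
      opTens 1 (star (S i)) (evalDiff X Ω j p) + jacR Jac J j i (tens (evalVec X Ω p) Ω)) ∈
      dgraph X Ω j := fun i =>
    Submodule.smul_mem _ _ (D.star_S_mem i (poly_mem_dgraph X Ω j p))
  have h4 := Submodule.sum_mem _ fun i (_ : i ∈ Finset.univ) => h3 i
  have h5 : opTens 1 (∑ i, (c i : ℂ) • star (S i)) (evalDiff X Ω j p) =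
      ∑ i, (c i : ℂ) • opTens 1 (star (S i)) (evalDiff X Ω j p) := by
    rw [opTens_sum_right, sum_apply]
    simp only [opTens_smul_right, smul_apply]
  rw [h5, ← Finset.sum_add_distrib]
  convert h4 using 1
  rw [Prod.ext_iff]
  simp [Prod.fst_sum, Prod.snd_sum, sum_apply]

include hc hξ hjac in
-- With T the directional slice and q = T*p, T(q x) is a slice of ∂_c(T*p) · x. Of the two terms of
-- ∂_c(T*p), the one containing T* dies since T(x*Ω) = 0, and p ⊗ 1 contributes τ(x) p.
theorem dirSlice_rt_star {x : FreeAlgebra ℂ (Fin n)} (hx : dirDiff X Ω c x = 0) :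
    dirSlice S c * rt J (pol X x) * star (dirSlice S c) = tr Ω (pol X x) • 1 :=
  D.poly_ext fun p => by
    obtain ⟨q, hq, hq'⟩ := D.exists_star_dirSlice hξ hjac p
    have h1 : dirDiff X Ω c q = opTens 1 (star (dirSlice S c)) (dirDiff X Ω c p) +
        tens (evalVec X Ω p) Ω := by
      simp only [dirDiff, hq', smul_add, Finset.sum_add_distrib, map_sum, map_smul, smul_smul,
        ← Finset.sum_smul]
      congr 1
      rw [show ∑ j, (c j : ℂ) * c j = 1 by
        rw [← Complex.ofReal_one, ← hc]; push_cast; simp only [sq], one_smul]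
    obtain ⟨y, hy, hy'⟩ := D.exists_star_dirDiff hx
    have h2 : dirSlice S c (star (rt J (pol X x)) Ω) = 0 := by
      rw [D.std.star_rt, D.std.rt_vac _ (vn_star_mem (pol_mem X x)), ← hy, ← evalVec_apply,
        D.dirSlice_evalVec, hy', map_zero]
    rw [mul_apply_eq_comp, mul_apply_eq_comp, hq, D.rt_evalVec,
      D.dirSlice_evalVec, D.dirDiff_mul_of_eq_zero hx, h1, map_add, map_add, sliceR_opTens,
      sliceR_opTens, sliceR_opTens, star_star, h2, sliceR_zero, sliceR_tens,
      ContinuousLinearMap.star_eq_adjoint, ContinuousLinearMap.adjoint_inner_left,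
      D.std.rt_vac _ (pol_mem X x)]
    simp [tr]

end Saturated

/-- Polynomials killed by the derivative in direction U_k are closed under products and adjoints,
and contain the linear forms in orthogonal directions. -/
theorem mem_adjoin_rotate {U : Matrix (Fin n) (Fin n) ℝ} {k : Fin n}
    (hU : ∀ i, i ≠ k → ∑ j, U k j * U i j = 0) {b : H →L[ℂ] H}
    (hb : b ∈ StarAlgebra.adjoin ℂ (rotate U X Ω '' {i | i ≠ k})) :
    ∃ p, pol X p = b ∧ dirDiff X Ω (U k) p = 0 := by
  induction hb using StarAlgebra.adjoin_induction with
  | mem x hx =>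
    obtain ⟨i, hi, rfl⟩ := hx
    refine ⟨linPoly X Ω (U i), pol_linPoly X Ω (U i), ?_⟩
    simp only [dirDiff, evalDiff_linPoly, smul_smul, ← Finset.sum_smul]
    rw [show ∑ j, (U k j : ℂ) * U i j = ((∑ j, U k j * U i j : ℝ) : ℂ) by push_cast; rfl, hU i hi]
    simp
  | algebraMap r =>
    refine ⟨algebraMap ℂ _ r, by simp [pol], ?_⟩
    simp [dirDiff, evalDiff_eq, freeDiff_algebraMap]
  | add x y _ _ hx hy =>
    obtain ⟨p, rfl, hp⟩ := hx
    obtain ⟨q, rfl, hq⟩ := hy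
    refine ⟨p + q, by simp [pol], ?_⟩
    simp only [dirDiff, map_add, smul_add, Finset.sum_add_distrib] at hp hq ⊢
    rw [hp, hq, add_zero]
  | mul x y _ _ hx hy =>
    obtain ⟨p, rfl, hp⟩ := hx
    obtain ⟨q, rfl, hq⟩ := hy
    exact ⟨p * q, by simp [pol], by rw [D.dirDiff_mul_of_eq_zero hq, hp, map_zero]⟩
  | star x _ hx =>
    obtain ⟨p, rfl, hp⟩ := hx
    exact D.exists_star_dirDiff hp

/-- Take ℓ = JT*J with T the directional slice: conjugation by J turns right multiplications into
left ones. The isometry relation is `dirSlice_rt_star` at x = 1. -/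
theorem exists_isFreeCreation {U : Matrix (Fin n) (Fin n) ℝ} {k : Fin n}
    (hU : ∀ i, i ≠ k → ∑ j, U k j * U i j = 0) (hc : ∑ j, U k j ^ 2 = 1)
    (hξ : ∑ i, (U k i : ℂ) • centered Ω (X i) Ω = ∑ i, (U k i : ℂ) • ξ i)
    (hjac : ∀ i, ∑ j, (U k j : ℂ) • jacR Jac J i j (tens Ω Ω) = (U k i : ℂ) • tens Ω Ω) :
    ∃ ℓ, IsFreeCreation Ω ℓ (StarAlgebra.adjoin ℂ (rotate U X Ω '' {i | i ≠ k})) ∧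
      rotate U X Ω k = ℓ + star ℓ := by
  set T := dirSlice S (U k) with hT
  have hJ := D.std.J_J
  have hsl : star (cj J (star T)) = cj J T := by rw [star_cj hJ, star_star]
  have hmul : ∀ x, dirDiff X Ω (U k) x = 0 →
      T * rt J (pol X x) * star T = tr Ω (pol X x) • 1 := fun x hx =>
    D.dirSlice_rt_star hc hξ hjac hx
  refine ⟨cj J (star T), ⟨?_, fun b hb => ?_, fun b hb => ?_⟩, ?_⟩
  · have h1 := hmul 1 (by simp [dirDiff, evalDiff_eq, freeDiff_one])
    have h2 : rt J (pol X 1) = 1 := by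
      rw [show pol X (1 : FreeAlgebra ℂ (Fin n)) = 1 by simp [pol], rt, star_one, cj_one hJ]
    rw [h2, mul_one, show tr Ω (pol X (1 : FreeAlgebra ℂ (Fin n))) = 1 by
      simp [pol, tr, inner_self_eq_norm_sq_to_K, D.std.norm_one], one_smul] at h1
    rw [hsl, ← cj_mul hJ, h1, cj_one hJ]
  · obtain ⟨x, rfl, hx⟩ := D.mem_adjoin_rotate hU hb
    obtain ⟨y, hy, hy'⟩ := D.exists_star_dirDiff hx
    have h1 := congrArg (cj J) (hmul y hy')
    rw [cj_mul hJ, cj_mul hJ, D.std.cj_rt, hy, star_star, cj_smul, cj_one hJ] at h1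
    rw [hsl, h1, tr, tr, inner_conj_symm, ContinuousLinearMap.star_eq_adjoint,
      ContinuousLinearMap.adjoint_inner_left]
  · obtain ⟨x, rfl, hx⟩ := D.mem_adjoin_rotate hU hb
    obtain ⟨y, hy, hy'⟩ := D.exists_star_dirDiff hx
    rw [hsl, cj_apply, D.std.J_apply _ (pol_mem X x), ← hy, ← evalVec_apply, hT,
      D.dirSlice_evalVec, hy', map_zero, map_zero]
  · have h1 := congrArg (cj J) (D.dirSlice_add_star hξ)
    rw [cj_add, D.std.cj_rt] at h1
    have h2 := congrArg star h1
    rw [star_star, star_add, ← hT, ← hsl, star_star, star_cj hJ] at h2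
    rw [rotate, ← pol_linPoly, ← h2, star_cj hJ, star_star]

end SliceData

end Creation

/-! ### Freeness of a semicircular variable from the complement of its creation operator -/

section Freeness

open Polynomial

variable {H : Type u} [NormedAddCommGroup H] [InnerProductSpace ℂ H] [CompleteSpace H]

theorem exists_aeval_of_mem_adjoin {Y a : H →L[ℂ] H} (hY : IsSelfAdjoint Y)
    (ha : a ∈ StarAlgebra.adjoin ℂ {Y}) : ∃ p : ℂ[X], aeval Y p = a := by
  rw [← StarSubalgebra.mem_toSubalgebra, StarAlgebra.adjoin_toSubalgebra, Set.star_singleton,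
    hY.star_eq, Set.union_self, Algebra.adjoin_singleton_eq_range_aeval] at ha
  exact ha

theorem aeval_mem_adjoin (Y : H →L[ℂ] H) (p : ℂ[X]) : aeval Y p ∈ StarAlgebra.adjoin ℂ {Y} := by
  have h1 : aeval Y p ∈ Algebra.adjoin ℂ {Y} := by
    rw [Algebra.adjoin_singleton_eq_range_aeval]; exact ⟨p, rfl⟩
  exact (Algebra.adjoin_le (S := (StarAlgebra.adjoin ℂ {Y}).toSubalgebra)
    (StarAlgebra.subset_adjoin ℂ {Y})) h1

theorem vec_eq_of_divX (ℓ : H →L[ℂ] H) (q : ℂ[X]) (w : H) :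
    aeval ℓ q w = ℓ (aeval ℓ (divX q) w) + q.coeff 0 • w := by
  have h1 := congrArg (fun r => aeval ℓ r w) (X_mul_divX_add q)
  simp only [map_add, map_mul, aeval_X, aeval_C, Algebra.algebraMap_eq_smul_one] at h1
  exact h1.symm

namespace IsFreeCreation

variable {Ω : H} {ℓ : H →L[ℂ] H} {B : StarSubalgebra ℂ (H →L[ℂ] H)} (h : IsFreeCreation Ω ℓ B)
include h

theorem star_apply (v : H) : star ℓ (ℓ v) = v :=
  congrArg (fun T : H →L[ℂ] H => T v) h.isometry

theorem star_vac : star ℓ Ω = 0 := by simpa using h.ann 1 (one_mem B)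

theorem inner_vac (v : H) : ⟪Ω, ℓ v⟫_ℂ = 0 := by
  rw [← ContinuousLinearMap.adjoint_inner_left, ← ContinuousLinearMap.star_eq_adjoint, h.star_vac,
    inner_zero_left]

/-- On vectors killed by ℓ*, (ℓ + ℓ*) q(ℓ) w = (Xq + divX q)(ℓ) w, as ℓ* removes one ℓ from each
positive power and kills the constant term. -/
theorem exists_aeval_creation (p : ℂ[X]) :
    ∃ q : ℂ[X], ∀ w, star ℓ w = 0 → aeval (ℓ + star ℓ) p w = aeval ℓ q w := by
  induction p using Polynomial.induction_on' with
  | add p q hp hq =>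
    obtain ⟨p', hp⟩ := hp
    obtain ⟨q', hq⟩ := hq
    refine ⟨p' + q', fun w hw => ?_⟩
    rw [map_add, map_add, add_apply, add_apply, hp w hw,
      hq w hw]
  | monomial k a =>
    suffices hk : ∃ q : ℂ[X], ∀ w, star ℓ w = 0 → ((ℓ + star ℓ) ^ k) w = aeval ℓ q w by
      obtain ⟨q, hq⟩ := hk
      refine ⟨a • q, fun w hw => ?_⟩
      rw [aeval_monomial, map_smul, smul_apply, ← hq w hw,
        Algebra.algebraMap_eq_smul_one, smul_mul_assoc, one_mul, smul_apply]
    induction k with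
    | zero => exact ⟨1, fun w _ => by simp⟩
    | succ k ih =>
      obtain ⟨q, hq⟩ := ih
      refine ⟨X * q + divX q, fun w hw => ?_⟩
      rw [pow_succ', mul_apply_eq_comp, hq w hw, map_add, map_mul, aeval_X,
        add_apply, add_apply,
        mul_apply_eq_comp]
      congr 1
      rw [vec_eq_of_divX ℓ q w, map_add, h.star_apply, map_smul, hw, smul_zero, add_zero]

/-- On the kernel of ℓ* the element acts as q(ℓ), where q(0) is its trace. So a centered element
maps this kernel into the range of ℓ. -/
theorem exists_creation_of_centered (hΩ : ‖Ω‖ = 1) {a : H →L[ℂ] H}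
    (ha : a ∈ StarAlgebra.adjoin ℂ {ℓ + star ℓ}) (hτ : tr Ω a = 0) {w : H} (hw : star ℓ w = 0) :
    ∃ v, a w = ℓ v := by
  obtain ⟨p, rfl⟩ := exists_aeval_of_mem_adjoin (IsSelfAdjoint.add_star_self ℓ) ha
  obtain ⟨q, hq⟩ := h.exists_aeval_creation p
  have h1 : q.coeff 0 = 0 := by
    rw [tr, hq Ω h.star_vac, vec_eq_of_divX, inner_add_right, h.inner_vac, inner_smul_right,
      inner_self_eq_norm_sq_to_K, hΩ] at hτ
    simpa using hτ
  exact ⟨aeval ℓ (divX q) w, by rw [hq w hw, vec_eq_of_divX, h1, zero_smul, add_zero]⟩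

/-- Reading words from the right, centered letters in ℓ + ℓ* send ker ℓ* into ran ℓ, and centered
letters of `B` send ran ℓ into ker ℓ* ∩ Ω^⊥ because ℓ*bℓ = τ(b) = 0 and ℓ*b*Ω = 0. -/
theorem alternating_vec (hΩ : ‖Ω‖ = 1) (l : List (Bool × (H →L[ℂ] H))) (p : Bool × (H →L[ℂ] H))
    (hc : (p :: l).IsChain fun p q => p.1 ≠ q.1)
    (hm : ∀ q ∈ p :: l, q.2 ∈ (if q.1 then StarAlgebra.adjoin ℂ {ℓ + star ℓ} else B) ∧
      tr Ω q.2 = 0) :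
    (p.1 = true → ∃ v, ((p :: l).map Prod.snd).prod Ω = ℓ v) ∧
      (p.1 = false → star ℓ (((p :: l).map Prod.snd).prod Ω) = 0 ∧
        ⟪Ω, ((p :: l).map Prod.snd).prod Ω⟫_ℂ = 0) := by
  induction l generalizing p with
  | nil =>
    obtain ⟨hm1, hm2⟩ := hm p (by simp)
    refine ⟨fun hp => ?_, fun hp => ?_⟩
    · rw [hp, if_pos rfl] at hm1
      simpa using h.exists_creation_of_centered hΩ hm1 hm2 h.star_vac
    · rw [hp] at hm1
      simpa using ⟨h.ann p.2 hm1, hm2⟩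
  | cons q l ih =>
    obtain ⟨hm1, hm2⟩ := hm p (by simp)
    rw [List.isChain_cons_cons] at hc
    obtain ⟨ih1, ih2⟩ := ih q hc.2 fun r hr => hm r (List.mem_cons_of_mem _ hr)
    rw [List.map_cons, List.prod_cons, mul_apply_eq_comp]
    refine ⟨fun hp => ?_, fun hp => ?_⟩
    · rw [hp, if_pos rfl] at hm1
      have hq : q.1 = false := by
        have := hc.1
        rw [hp] at this
        simpa using this.symm
      exact h.exists_creation_of_centered hΩ hm1 hm2 (ih2 hq).1
    · have hm1' : p.2 ∈ B := by simpa [hp] using hm1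
      have hq : q.1 = true := by
        have := hc.1
        rw [hp] at this
        simpa using this.symm
      obtain ⟨v, hv⟩ := ih1 hq
      rw [hv]
      constructor
      · have := congrArg (fun T : H →L[ℂ] H => T v) (h.compress p.2 hm1')
        simpa [hm2] using this
      · rw [← ContinuousLinearMap.adjoint_inner_left, ← ContinuousLinearMap.star_eq_adjoint,
          ← ContinuousLinearMap.adjoint_inner_left, ← ContinuousLinearMap.star_eq_adjoint,
          h.ann _ (star_mem hm1'), inner_zero_left]

theorem areFree (hΩ : ‖Ω‖ = 1) : AreFree Ω (StarAlgebra.adjoin ℂ {ℓ + star ℓ}) B := by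
  intro l hl hc hm
  obtain ⟨p, l, rfl⟩ := List.exists_cons_of_ne_nil hl
  obtain ⟨h1, h2⟩ := h.alternating_vec hΩ l p hc hm
  rcases hp : p.1 with _ | _
  · exact (h2 hp).2
  · obtain ⟨v, hv⟩ := h1 hp
    rw [tr, hv, h.inner_vac]

/-- The Chebyshev recurrence mirrors (ℓ + ℓ*)ℓ^{k+1}Ω = ℓ^{k+2}Ω + ℓ^kΩ; two consecutive indices are
carried for the induction. -/
theorem aeval_chebyshev (k : ℕ) :
    aeval (ℓ + star ℓ) (Chebyshev.S ℂ (k : ℤ)) Ω = (ℓ ^ k) Ω ∧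
      aeval (ℓ + star ℓ) (Chebyshev.S ℂ ((k : ℤ) + 1)) Ω = (ℓ ^ (k + 1)) Ω := by
  induction k with
  | zero => simp [h.star_vac]
  | succ k ih =>
    refine ⟨by exact_mod_cast ih.2, ?_⟩
    have h1 : ((k + 1 : ℕ) : ℤ) + 1 = (k : ℤ) + 2 := by push_cast; ring
    rw [h1, Chebyshev.S_add_two, map_sub, map_mul, aeval_X, sub_apply,
      mul_apply_eq_comp, ih.1, ih.2, add_apply, pow_succ' ℓ (k + 1),
      pow_succ' ℓ k, mul_apply_eq_comp, mul_apply_eq_comp, h.star_apply,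
      add_sub_cancel_right, mul_apply_eq_comp]

theorem tr_chebyshev (hΩ : ‖Ω‖ = 1) (k : ℕ) :
    tr Ω (aeval (ℓ + star ℓ) (Chebyshev.S ℂ (k : ℤ))) = if k = 0 then 1 else 0 := by
  rw [tr, (h.aeval_chebyshev k).1]
  cases k with
  | zero => simp [inner_self_eq_norm_sq_to_K, hΩ]
  | succ k => rw [pow_succ', mul_apply_eq_comp, h.inner_vac]; simp

end IsFreeCreation

end Freeness

/-! ### Moments of the semicircular law -/

section Semicircle

open MeasureTheory Polynomial

/-- Since X S_{k+1} = S_{k+2} + S_k, agreement spreads to all X^m S_k, in particular to the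
monomials. -/
theorem linearMap_ext_chebyshev {φ ψ : ℂ[X] →ₗ[ℂ] ℂ}
    (h : ∀ k : ℕ, φ (Chebyshev.S ℂ (k : ℤ)) = ψ (Chebyshev.S ℂ (k : ℤ))) : φ = ψ := by
  have key : ∀ m k : ℕ, φ (X ^ m * Chebyshev.S ℂ (k : ℤ)) = ψ (X ^ m * Chebyshev.S ℂ (k : ℤ)) := by
    intro m
    induction m with
    | zero => simpa using h
    | succ m ih =>
      intro k
      cases k with
      | zero =>
        have := ih 1
        simpa [pow_succ] using this
      | succ k =>
        have h1 : X * Chebyshev.S ℂ ((k + 1 : ℕ) : ℤ) =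
            Chebyshev.S ℂ ((k + 2 : ℕ) : ℤ) + Chebyshev.S ℂ (k : ℤ) := by
          have := Chebyshev.S_add_two ℂ (k : ℤ)
          push_cast
          rw [this]
          ring
        rw [pow_succ, mul_assoc, h1, mul_add, map_add, map_add, ih, ih]
  refine Polynomial.lhom_ext' fun m => LinearMap.ext_ring ?_
  have := key m 0
  simpa [← X_pow_eq_monomial] using this

theorem measurable_semicircle_density : Measurable fun t : Set.Icc (-2 : ℝ) 2 =>
    ENNReal.ofReal (Real.sqrt (4 - (t : ℝ) ^ 2) / (2 * Real.pi)) := by fun_prop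

theorem integral_semicircle (f : ℝ → ℂ) : ∫ t, f (t : ℝ) ∂semicircle =
    ∫ t in (-2 : ℝ)..2, ((Real.sqrt (4 - t ^ 2) / (2 * Real.pi) : ℝ) : ℂ) * f t := by
  rw [semicircle, integral_withDensity_eq_integral_toReal_smul measurable_semicircle_density
    (by simp), intervalIntegral.integral_of_le (by norm_num), ← integral_Icc_eq_integral_Ioc,
    ← integral_subtype_comap measurableSet_Icc]
  refine integral_congr_ae (Eventually.of_forall fun t => ?_)
  simp only
  rw [ENNReal.toReal_ofReal (by positivity), Complex.real_smul]

theorem integral_semicircle_trig {f : ℝ → ℂ} (hf : Continuous f) : ∫ t, f (t : ℝ) ∂semicircle =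
    (2 / Real.pi : ℂ) * ∫ θ in (0 : ℝ)..Real.pi, f (2 * Real.cos θ) * Real.sin θ ^ 2 := by
  rw [integral_semicircle]
  have h1 := intervalIntegral.integral_deriv_smul_comp (a := 0) (b := Real.pi)
    (f := fun θ => 2 * Real.cos θ) (f' := fun θ => 2 * -Real.sin θ)
    (g := fun t => ((Real.sqrt (4 - t ^ 2) / (2 * Real.pi) : ℝ) : ℂ) * f t)
    (fun θ _ => (Real.hasDerivAt_cos θ).const_mul 2) (by fun_prop) (by fun_prop)
  simp only [Real.cos_zero, Real.cos_pi, mul_one, mul_neg, Function.comp_apply] at h1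
  rw [intervalIntegral.integral_symm, ← h1, ← intervalIntegral.integral_neg,
    ← intervalIntegral.integral_const_mul]
  refine intervalIntegral.integral_congr fun θ hθ => ?_
  rw [Set.uIcc_of_le Real.pi_pos.le] at hθ
  have hs : 0 ≤ Real.sin θ := Real.sin_nonneg_of_mem_Icc hθ
  have h2 : Real.sqrt (4 - (2 * Real.cos θ) ^ 2) = 2 * Real.sin θ := by
    rw [← Real.sqrt_sq (by positivity : 0 ≤ 2 * Real.sin θ)]
    congr 1
    nlinarith [Real.sin_sq_add_cos_sq θ]
  have h3 : (Real.pi : ℂ) ≠ 0 := by exact_mod_cast Real.pi_ne_zero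
  rw [h2, neg_smul, neg_neg, Complex.real_smul]
  push_cast
  field_simp

theorem integral_cos_nat_mul (k : ℕ) (hk : k ≠ 0) :
    ∫ θ in (0 : ℝ)..Real.pi, Real.cos (k * θ) = 0 := by
  rw [intervalIntegral.integral_comp_mul_left (fun θ => Real.cos θ) (by exact_mod_cast hk)]
  simp [Real.sin_nat_mul_pi]

/-- Substituting t = 2 cos θ and using S_k(2 cos θ) sin θ = sin((k+1)θ) reduces the claim to
integrals of cosines over [0, π]. -/
theorem integral_semicircle_chebyshev (k : ℕ) :
    ∫ t, (Chebyshev.S ℂ (k : ℤ)).eval (((t : Set.Icc (-2 : ℝ) 2) : ℝ) : ℂ) ∂semicircle =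
      if k = 0 then 1 else 0 := by
  rw [integral_semicircle_trig (f := fun t => (Chebyshev.S ℂ (k : ℤ)).eval (t : ℂ)) (by fun_prop)]
  have h1 : ∀ θ : ℝ, (Chebyshev.S ℂ (k : ℤ)).eval ((2 * Real.cos θ : ℝ) : ℂ) * (Real.sin θ : ℂ) ^ 2 =
      (((Real.cos (k * θ) - Real.cos ((k + 2 : ℕ) * θ)) / 2 : ℝ) : ℂ) := fun θ => by
    have h2 := Chebyshev.S_two_mul_complex_cos (θ : ℂ) (k : ℤ)
    have h3 : Real.cos (k * θ) - Real.cos ((k + 2 : ℕ) * θ) =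
        2 * (Real.sin ((k + 1) * θ) * Real.sin θ) := by
      rw [Real.cos_sub_cos]
      have e1 : (k * θ + (k + 2 : ℕ) * θ) / 2 = (k + 1) * θ := by push_cast; ring
      have e2 : (k * θ - (k + 2 : ℕ) * θ) / 2 = -θ := by push_cast; ring
      rw [e1, e2, Real.sin_neg]
      ring
    rw [h3, sq, ← mul_assoc]
    push_cast at h2 ⊢
    rw [h2]
    ring
  simp only [h1]
  rw [intervalIntegral.integral_ofReal]
  have hi : ∀ m : ℕ, IntervalIntegrable (fun θ => Real.cos (m * θ)) volume 0 Real.pi := fun m =>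
    Continuous.intervalIntegrable (by fun_prop) _ _
  rw [intervalIntegral.integral_div, intervalIntegral.integral_sub (hi k) (hi (k + 2)),
    integral_cos_nat_mul (k + 2) (by lia)]
  split_ifs with hk
  · subst hk
    have h3 : (Real.pi : ℂ) ≠ 0 := by exact_mod_cast Real.pi_ne_zero
    simp [h3]
  · rw [integral_cos_nat_mul k hk]
    simp

instance : IsProbabilityMeasure semicircle := by
  have h1 := integral_semicircle_chebyshev 0
  simp only [Nat.cast_zero, Chebyshev.S_zero, eval_one, integral_const, if_true,
    Complex.real_smul, mul_one, Complex.ofReal_eq_one] at h1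
  exact ⟨(ENNReal.toReal_eq_one_iff _).1 h1⟩

theorem integrable_semicircle {f : Set.Icc (-2 : ℝ) 2 → ℂ} (hf : Continuous f) :
    Integrable f semicircle :=
  hf.integrable_of_hasCompactSupport (HasCompactSupport.of_compactSpace f)

variable {H : Type u} [NormedAddCommGroup H] [InnerProductSpace ℂ H] [CompleteSpace H]

theorem IsFreeCreation.tr_aeval {Ω : H} {ℓ : H →L[ℂ] H} {B : StarSubalgebra ℂ (H →L[ℂ] H)}
    (h : IsFreeCreation Ω ℓ B) (hΩ : ‖Ω‖ = 1) (p : ℂ[X]) : tr Ω (aeval (ℓ + star ℓ) p) =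
      ∫ t, p.eval (((t : Set.Icc (-2 : ℝ) 2) : ℝ) : ℂ) ∂semicircle := by
  have hint : ∀ p : ℂ[X], Integrable
      (fun t : Set.Icc (-2 : ℝ) 2 => p.eval ((t : ℝ) : ℂ)) semicircle := fun p =>
    integrable_semicircle (by fun_prop)
  let φ : ℂ[X] →ₗ[ℂ] ℂ :=
    { toFun := fun p => tr Ω (aeval (ℓ + star ℓ) p)
      map_add' := fun p q => by simp [tr]
      map_smul' := fun c p => by simp [tr] }
  let ψ : ℂ[X] →ₗ[ℂ] ℂ :=
    { toFun := fun p => ∫ t, p.eval (((t : Set.Icc (-2 : ℝ) 2) : ℝ) : ℂ) ∂semicircle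
      map_add' := fun p q => by
        simp only [eval_add]
        exact integral_add (hint p) (hint q)
      map_smul' := fun c p => by
        simp only [eval_smul, smul_eq_mul, RingHom.id_apply]
        exact integral_const_mul c _ }
  have h1 : φ = ψ := linearMap_ext_chebyshev fun k =>
    (h.tr_chebyshev hΩ k).trans (integral_semicircle_chebyshev k).symm
  exact congrArg (fun χ : ℂ[X] →ₗ[ℂ] ℂ => χ p) h1

theorem IsFreeCreation.isStandardSemicircular {Ω : H} {ℓ : H →L[ℂ] H}
    {B : StarSubalgebra ℂ (H →L[ℂ] H)} (h : IsFreeCreation Ω ℓ B) (hΩ : ‖Ω‖ = 1) :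
    IsStandardSemicircular Ω (ℓ + star ℓ) :=
  ⟨IsSelfAdjoint.add_star_self ℓ, fun k => by simpa using h.tr_aeval hΩ (X ^ k)⟩

end Semicircle

/-! ### Generated von Neumann algebras and freeness -/

section Generated

variable {H : Type u} [NormedAddCommGroup H] [InnerProductSpace ℂ H] [CompleteSpace H]

theorem adjoin_le_wStar (S : Set (H →L[ℂ] H)) :
    StarAlgebra.adjoin ℂ S ≤ (wStar S).toStarSubalgebra :=
  StarAlgebra.adjoin_le (subset_wStar S)

/-- Vectors `x v` with `x ∈ W*(S)` are limits of vectors `a v` with `a` in the `*`-algebra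
generated by `S`. -/
theorem exists_seq_adjoin {S : Set (H →L[ℂ] H)} {x : H →L[ℂ] H} (hx : x ∈ wStar S) (v : H) :
    ∃ a : ℕ → H →L[ℂ] H, (∀ m, a m ∈ StarAlgebra.adjoin ℂ S) ∧
      Tendsto (fun m => a m v) atTop (𝓝 (x v)) := by
  let ev : (H →L[ℂ] H) →ₗ[ℂ] H := (ContinuousLinearMap.apply ℂ H v : (H →L[ℂ] H) →L[ℂ] H)
  let W : Submodule ℂ H := (Submodule.map ev
    (StarAlgebra.adjoin ℂ S).toSubalgebra.toSubmodule).topologicalClosure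
  have hinv : ∀ s ∈ StarAlgebra.adjoin ℂ S, ∀ w ∈ W, s w ∈ W := fun s hs w hw =>
    map_mem_closure s.continuous hw fun z hz => by
      obtain ⟨a, ha, rfl⟩ := hz
      exact ⟨s * a, mul_mem (s := StarAlgebra.adjoin ℂ S) hs ha, rfl⟩
  have hv : v ∈ W := Submodule.le_topologicalClosure _ ⟨1, one_mem (StarAlgebra.adjoin ℂ S), rfl⟩
  have h1 : x v ∈ W := wStar_apply_mem (Submodule.isClosed_topologicalClosure _)
    (fun s hs => hinv s (StarAlgebra.subset_adjoin ℂ S hs))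
    (fun s hs => hinv _ (star_mem (StarAlgebra.subset_adjoin ℂ S hs))) hx hv
  obtain ⟨y, hy, hy'⟩ := mem_closure_iff_seq_limit.1 h1
  choose a ha ha' using hy
  exact ⟨a, ha, hy'.congr fun m => (ha' m).symm⟩

theorem wStar_wStar (S T : Set (H →L[ℂ] H)) :
    wStar ((wStar S : Set (H →L[ℂ] H)) ∪ (wStar T : Set (H →L[ℂ] H))) = wStar (S ∪ T) := by
  refine le_antisymm (wStar_le (Set.union_subset ?_ ?_)) (wStar_mono
    (Set.union_subset_union (subset_wStar S) (subset_wStar T)))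
  · exact wStar_mono Set.subset_union_left
  · exact wStar_mono Set.subset_union_right

theorem vn_list_prod_mem {M : VonNeumannAlgebra H} {l : List (H →L[ℂ] H)} (h : ∀ x ∈ l, x ∈ M) :
    l.prod ∈ M := list_prod_mem (S := M.toStarSubalgebra) h

theorem tr_add (Ω : H) (x y : H →L[ℂ] H) : tr Ω (x + y) = tr Ω x + tr Ω y := by
  simp [tr]
theorem tr_sub (Ω : H) (x y : H →L[ℂ] H) : tr Ω (x - y) = tr Ω x - tr Ω y := by
  simp [tr]
theorem tr_smul (Ω : H) (c : ℂ) (x : H →L[ℂ] H) : tr Ω (c • x) = c * tr Ω x := by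
  simp [tr]

namespace IsStandardForm

variable {M : VonNeumannAlgebra H} {Ω : H} (h : IsStandardForm M Ω)
include h

theorem tr_one : tr Ω (1 : H →L[ℂ] H) = 1 := by
  simp [tr, inner_self_eq_norm_sq_to_K, h.norm_one]

theorem tr_centered (x : H →L[ℂ] H) : tr Ω (centered Ω x) = 0 := by
  rw [centered, tr_sub, tr_smul, h.tr_one, mul_one, sub_self]

/-- Traciality moves the right factor to the front, so convergence on the single vector Ω suffices,
without a norm bound on the sequence. -/
theorem tendsto_tr {a : ℕ → H →L[ℂ] H} {x : H →L[ℂ] H} (ha : ∀ m, a m ∈ M) (hx : x ∈ M)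
    (hax : Tendsto (fun m => a m Ω) atTop (𝓝 (x Ω))) {y z : H →L[ℂ] H} (hy : y ∈ M) (hz : z ∈ M) :
    Tendsto (fun m => tr Ω (y * (a m * z))) atTop (𝓝 (tr Ω (y * (x * z)))) := by
  have h1 : ∀ b ∈ M, tr Ω (y * (b * z)) = ⟪Ω, z (y (b Ω))⟫_ℂ := fun b hb => by
    rw [← mul_assoc, h.trace_comm _ (vn_mul_mem hy hb) _ hz]
    rfl
  rw [h1 x hx]
  refine Tendsto.congr (fun m => (h1 _ (ha m)).symm) ?_
  exact tendsto_const_nhds.inner ((z.continuous.tendsto _).comp ((y.continuous.tendsto _).comp hax))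

/-- Freeness passes to the generated von Neumann algebras. -/
theorem areFree_wStar {S T : Set (H →L[ℂ] H)} (hS : S ⊆ M) (hT : T ⊆ M)
    (hf : AreFree Ω (StarAlgebra.adjoin ℂ S) (StarAlgebra.adjoin ℂ T)) :
    AreFree Ω (wStar S).toStarSubalgebra (wStar T).toStarSubalgebra := by
  have hmem : ∀ p : Bool × (H →L[ℂ] H), p.2 ∈ (if p.1 then (wStar S).toStarSubalgebra else
      (wStar T).toStarSubalgebra) → p.2 ∈ M := by
    rintro ⟨_ | _, x⟩ hx
    · exact wStar_le hT hx
    · exact wStar_le hS hx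
  have hsub : ∀ p : Bool × (H →L[ℂ] H), p.2 ∈ (if p.1 then StarAlgebra.adjoin ℂ S else
      StarAlgebra.adjoin ℂ T) → p.2 ∈ (if p.1 then (wStar S).toStarSubalgebra else
      (wStar T).toStarSubalgebra) := by
    rintro ⟨_ | _, x⟩ hx
    · exact adjoin_le_wStar T hx
    · exact adjoin_le_wStar S hx
  have happ : ∀ p : Bool × (H →L[ℂ] H), p.2 ∈ (if p.1 then (wStar S).toStarSubalgebra else
      (wStar T).toStarSubalgebra) → ∃ a : ℕ → H →L[ℂ] H, (∀ m, a m ∈ (if p.1 then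
        StarAlgebra.adjoin ℂ S else StarAlgebra.adjoin ℂ T)) ∧
        Tendsto (fun m => a m Ω) atTop (𝓝 (p.2 Ω)) := by
    rintro ⟨_ | _, x⟩ hx
    · exact exists_seq_adjoin hx Ω
    · exact exists_seq_adjoin hx Ω
  -- Letters of l₁ lie in the von Neumann algebras and letters of l₂ in the `*`-algebras. Induction
  -- on l₁ from its right end approximates one letter at a time.
  have key : ∀ l₁ l₂ : List (Bool × (H →L[ℂ] H)), l₁ ++ l₂ ≠ [] →
      (l₁ ++ l₂).IsChain (fun p q => p.1 ≠ q.1) →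
      (∀ p ∈ l₁, p.2 ∈ (if p.1 then (wStar S).toStarSubalgebra else
        (wStar T).toStarSubalgebra) ∧ tr Ω p.2 = 0) →
      (∀ p ∈ l₂, p.2 ∈ (if p.1 then StarAlgebra.adjoin ℂ S else StarAlgebra.adjoin ℂ T) ∧
        tr Ω p.2 = 0) → tr Ω ((l₁ ++ l₂).map Prod.snd).prod = 0 := by
    intro l₁
    induction l₁ using List.reverseRecOn with
    | nil => exact fun l₂ h0 hc _ h2 => hf l₂ h0 hc h2
    | append_singleton l₁ p ih =>
      intro l₂ h0 hc h1 h2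
      have hp := h1 p (by simp)
      obtain ⟨a, ha, hap⟩ := happ p hp.1
      have hca : ∀ m, centered Ω (a m) ∈ (if p.1 then StarAlgebra.adjoin ℂ S else
          StarAlgebra.adjoin ℂ T) := fun m => sub_mem (ha m) (SMulMemClass.smul_mem _ (one_mem _))
      have hca' : Tendsto (fun m => centered Ω (a m) Ω) atTop (𝓝 (p.2 Ω)) := by
        have h3 : Tendsto (fun m => tr Ω (a m)) atTop (𝓝 (tr Ω p.2)) := tendsto_const_nhds.inner hap
        rw [hp.2] at h3
        have h4 := hap.sub (h3.smul_const Ω)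
        rw [zero_smul, sub_zero] at h4
        exact h4
      have hz : ∀ m, tr Ω ((l₁.map Prod.snd).prod * (centered Ω (a m) * (l₂.map Prod.snd).prod)) =
          0 := fun m => by
        have h3 := ih ((p.1, centered Ω (a m)) :: l₂) (by simp) ?_
          (fun q hq => h1 q (by simp [hq])) ?_
        · simpa using h3
        · rw [← List.isChain_map Prod.fst (R := fun a b => a ≠ b)] at hc ⊢
          simpa using hc
        · intro q hq
          rcases List.mem_cons.1 hq with rfl | hq
          · exact ⟨hca m, h.tr_centered _⟩
          · exact h2 q hq
      have hM1 : (l₁.map Prod.snd).prod ∈ M := vn_list_prod_mem fun x hx => by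
        obtain ⟨q, hq, rfl⟩ := List.mem_map.1 hx
        exact hmem q (h1 q (by simp [hq])).1
      have hM2 : (l₂.map Prod.snd).prod ∈ M := vn_list_prod_mem fun x hx => by
        obtain ⟨q, hq, rfl⟩ := List.mem_map.1 hx
        exact hmem q (hsub q (h2 q hq).1)
      have hlim := h.tendsto_tr (fun m => hmem (p.1, _) (hsub (p.1, _) (hca m))) (hmem p hp.1)
        hca' hM1 hM2
      have h5 := tendsto_nhds_unique hlim (tendsto_const_nhds.congr fun m => (hz m).symm)
      simpa using h5
  intro l hl hc hm
  simpa using key l [] (by simpa using hl) (by simpa using hc) hm (by simp)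

end IsStandardForm

end Generated

/-! ### Uniqueness of free products -/

section FreeProduct

variable {H : Type u} [NormedAddCommGroup H] [InnerProductSpace ℂ H] [CompleteSpace H]
  {K : Type w} [NormedAddCommGroup K] [InnerProductSpace ℂ K] [CompleteSpace K]

section Words

variable {A B P : Type*} [Ring A] [Algebra ℂ A] [Ring B] [Algebra ℂ B] [Ring P] [Algebra ℂ P]

/-- The span of the alternating products of centered elements. -/
def altSpan (τA : A → ℂ) (τB : B → ℂ) (φ : A →ₐ[ℂ] P) (ψ : B →ₐ[ℂ] P) : Submodule ℂ P :=
  Submodule.span ℂ {w | ∃ l : List (A ⊕ B), l.IsChain (fun p q => p.isLeft ≠ q.isLeft) ∧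
    (∀ c ∈ l, Sum.elim τA τB c = 0) ∧ w = (l.map (Sum.elim φ ψ)).prod}

theorem altSpan_swap_le (τA : A → ℂ) (τB : B → ℂ) (φ : A →ₐ[ℂ] P) (ψ : B →ₐ[ℂ] P) :
    altSpan τA τB φ ψ ≤ altSpan τB τA ψ φ := by
  refine Submodule.span_mono ?_
  rintro w ⟨l, hl, hc, rfl⟩
  refine ⟨l.map Sum.swap, ?_, ?_, ?_⟩
  · rw [List.isChain_map]
    refine hl.imp fun p q hpq => ?_
    rcases p with p | p <;> rcases q with q | q <;> simp_all
  · intro c hc'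
    obtain ⟨d, hd, rfl⟩ := List.mem_map.1 hc'
    rcases d with d | d
    · simpa using hc _ hd
    · simpa using hc _ hd
  · rw [List.map_map]
    congr 2
    funext c
    rcases c with c | c <;> rfl

/-- A new letter is merged with the first one if both come from `A`; the result is split into its
centered part, which extends the alternating word, and a scalar. -/
theorem mul_mem_altSpan {τA : A → ℂ} {τB : B → ℂ} {φ : A →ₐ[ℂ] P} {ψ : B →ₐ[ℂ] P}
    (hτ : ∀ a, τA (a - τA a • 1) = 0) (a : A) {w : P} (hw : w ∈ altSpan τA τB φ ψ) :
    φ a * w ∈ altSpan τA τB φ ψ := by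
  have step : ∀ (a : A) (l : List (A ⊕ B)), (Sum.inl a :: l).IsChain (fun p q => p.isLeft ≠ q.isLeft) →
      (∀ c ∈ l, Sum.elim τA τB c = 0) →
      φ a * (l.map (Sum.elim φ ψ)).prod ∈ altSpan τA τB φ ψ := by
    intro a l hl hc
    have h1 : φ a * (l.map (Sum.elim φ ψ)).prod =
        ((Sum.inl (a - τA a • 1) :: l).map (Sum.elim φ ψ)).prod +
          τA a • (l.map (Sum.elim φ ψ)).prod := by
      simp [sub_mul]
    rw [h1]
    rw [List.isChain_cons] at hl
    refine add_mem (Submodule.subset_span ⟨_, ?_, ?_, rfl⟩)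
      (Submodule.smul_mem _ _ (Submodule.subset_span ⟨l, hl.2, hc, rfl⟩))
    · exact List.isChain_cons.2 hl
    · intro c hc'
      rcases List.mem_cons.1 hc' with rfl | h2
      · exact hτ a
      · exact hc c h2
  induction hw using Submodule.span_induction with
  | zero => rw [mul_zero]; exact zero_mem _
  | add x y _ _ hx hy => rw [mul_add]; exact add_mem hx hy
  | smul r x _ hx => rw [mul_smul_comm]; exact Submodule.smul_mem _ _ hx
  | mem w hw =>
    obtain ⟨l, hl, hc, rfl⟩ := hw
    rcases l with _ | ⟨c, l⟩
    · exact step a [] (by simp) (by simp)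
    · rcases c with b | b
      · rw [List.map_cons, List.prod_cons, ← mul_assoc, Sum.elim_inl, ← map_mul]
        refine step (a * b) l ?_ fun c hc' => hc c (List.mem_cons_of_mem _ hc')
        rw [List.isChain_cons] at hl ⊢
        exact hl
      · exact step a _ (List.isChain_cons_cons.2 ⟨by simp, hl⟩) hc

theorem adjoin_le_altSpan {τA : A → ℂ} {τB : B → ℂ} {φ : A →ₐ[ℂ] P} {ψ : B →ₐ[ℂ] P}
    (hA : ∀ a, τA (a - τA a • 1) = 0) (hB : ∀ b, τB (b - τB b • 1) = 0) :
    (Algebra.adjoin ℂ (Set.range φ ∪ Set.range ψ)).toSubmodule ≤ altSpan τA τB φ ψ := by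
  have key : ∀ x ∈ Algebra.adjoin ℂ (Set.range φ ∪ Set.range ψ), ∀ w ∈ altSpan τA τB φ ψ,
      x * w ∈ altSpan τA τB φ ψ := by
    intro x hx
    induction hx using Algebra.adjoin_induction with
    | mem x hx =>
      rcases hx with ⟨a, rfl⟩ | ⟨b, rfl⟩
      · exact fun w hw => mul_mem_altSpan hA a hw
      · exact fun w hw => altSpan_swap_le _ _ _ _
          (mul_mem_altSpan hB b (altSpan_swap_le _ _ _ _ hw))
    | algebraMap r =>
      intro w hw
      rw [← Algebra.smul_def]
      exact Submodule.smul_mem _ _ hw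
    | add x y _ _ hx hy => exact fun w hw => by rw [add_mul]; exact add_mem (hx w hw) (hy w hw)
    | mul x y _ _ hx hy => exact fun w hw => by rw [mul_assoc]; exact hx _ (hy w hw)
  intro x hx
  have h1 := key x hx 1 (Submodule.subset_span ⟨[], by simp, by simp, by simp⟩)
  rwa [mul_one] at h1

end Words

variable {A B : Type*} [Ring A] [StarRing A] [Algebra ℂ A] [StarModule ℂ A]
  [Ring B] [StarRing B] [Algebra ℂ B] [StarModule ℂ B]

theorem star_mem_adjoin_of_star {P : Type*} [Ring P] [StarRing P] [Algebra ℂ P] [StarModule ℂ P]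
    {s : Set P} (hs : ∀ x ∈ s, star x ∈ s) {x : P} (hx : x ∈ Algebra.adjoin ℂ s) :
    star x ∈ Algebra.adjoin ℂ s := by
  induction hx using Algebra.adjoin_induction with
  | mem x hx => exact Algebra.subset_adjoin (hs x hx)
  | algebraMap r =>
    rw [← algebraMap_star_comm]; exact algebraMap_mem _ _
  | add x y _ _ hx hy => rw [star_add]; exact add_mem hx hy
  | mul x y _ _ hx hy => rw [star_mul]; exact mul_mem hy hx

theorem map_mem_wStar (e : (H →L[ℂ] H) ≃⋆ₐ[ℂ] (K →L[ℂ] K)) {S : Set (H →L[ℂ] H)}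
    {S' : Set (K →L[ℂ] K)} (hS : ∀ s ∈ S, e s ∈ S') {x : H →L[ℂ] H} (hx : x ∈ wStar S) :
    e x ∈ wStar S' := by
  refine mem_wStar_iff.2 fun T h1 h2 => ?_
  have h3 := mem_wStar_iff.1 hx (e.symm T) (fun s hs => ?_) fun s hs => ?_
  · have h4 := congrArg e h3
    rwa [map_mul, map_mul, e.apply_symm_apply] at h4
  · refine EquivLike.injective e ?_
    rw [map_mul, map_mul, e.apply_symm_apply]
    exact h1 _ (hS s hs)
  · refine EquivLike.injective e ?_
    have h5 : e (star s) = star (e s) := e.map_star' s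
    rw [map_mul, map_mul, e.apply_symm_apply, h5]
    exact h2 _ (hS s hs)

namespace IsFreeProduct

variable {τA : A → ℂ} {τB : B → ℂ} {M : VonNeumannAlgebra H} {Ω : H}
  {φ : A →⋆ₐ[ℂ] (H →L[ℂ] H)} {ψ : B →⋆ₐ[ℂ] (H →L[ℂ] H)} (h : IsFreeProduct τA τB M Ω φ ψ)
include h

theorem trace_sub_left (a : A) : τA (a - τA a • 1) = 0 := by
  rw [← h.trace_left, ← h.trace_left, map_sub, map_smul, map_one]
  exact h.standard.tr_centered (φ a)

theorem trace_sub_right (b : B) : τB (b - τB b • 1) = 0 := by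
  rw [← h.trace_right, ← h.trace_right, map_sub, map_smul, map_one]
  exact h.standard.tr_centered (ψ b)

theorem tr_word {l : List (A ⊕ B)} (hl : l ≠ [])
    (hc : l.IsChain (fun p q => p.isLeft ≠ q.isLeft)) (h0 : ∀ c ∈ l, Sum.elim τA τB c = 0) :
    tr Ω (l.map (Sum.elim φ ψ)).prod = 0 := by
  have h1 := h.free (l.map fun c => (c.isLeft, Sum.elim φ ψ c)) (by simpa using hl)
    (by rwa [List.isChain_map]) ?_
  · simpa [List.map_map, Function.comp_def] using h1
  · intro p hp
    obtain ⟨c, hc', rfl⟩ := List.mem_map.1 hp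
    have h2 := h0 c hc'
    rcases c with a | b
    · exact ⟨⟨a, rfl⟩, (h.trace_left a).trans h2⟩
    · exact ⟨⟨b, rfl⟩, (h.trace_right b).trans h2⟩

variable {P : VonNeumannAlgebra K} {ω : K} {φ' : A →⋆ₐ[ℂ] (K →L[ℂ] K)}
  {ψ' : B →⋆ₐ[ℂ] (K →L[ℂ] K)} (h' : IsFreeProduct τA τB P ω φ' ψ')
include h'

/-- Working in the algebra generated by the pairs (φ a, φ' a) and (ψ b, ψ' b) compares both
realisations at once and avoids any question of well-definedness. Nonempty alternating centered
words have trace zero on either side. -/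
theorem tr_eq {x : (H →L[ℂ] H) × (K →L[ℂ] K)}
    (hx : x ∈ Algebra.adjoin ℂ (Set.range (φ.prod φ') ∪ Set.range (ψ.prod ψ'))) :
    tr Ω x.1 = tr ω x.2 := by
  have h1 : x ∈ altSpan τA τB (φ.prod φ').toAlgHom (ψ.prod ψ').toAlgHom :=
    adjoin_le_altSpan h.trace_sub_left h.trace_sub_right hx
  clear hx
  induction h1 using Submodule.span_induction with
  | zero => simp [tr]
  | add x y _ _ hx hy => rw [Prod.fst_add, Prod.snd_add, tr_add, tr_add, hx, hy]
  | smul r x _ hx => rw [Prod.smul_fst, Prod.smul_snd, tr_smul, tr_smul, hx]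
  | mem w hw =>
    obtain ⟨l, hl, hc, rfl⟩ := hw
    have e1 : ∀ l : List (A ⊕ B), ((l.map (Sum.elim (φ.prod φ').toAlgHom
        (ψ.prod ψ').toAlgHom)).prod).1 = (l.map (Sum.elim φ ψ)).prod := fun l => by
      induction l with
      | nil => rfl
      | cons c l ih =>
        rw [List.map_cons, List.prod_cons, Prod.fst_mul, ih, List.map_cons, List.prod_cons]
        rcases c with c | c <;> rfl
    have e2 : ∀ l : List (A ⊕ B), ((l.map (Sum.elim (φ.prod φ').toAlgHom
        (ψ.prod ψ').toAlgHom)).prod).2 = (l.map (Sum.elim φ' ψ')).prod := fun l => by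
      induction l with
      | nil => rfl
      | cons c l ih =>
        rw [List.map_cons, List.prod_cons, Prod.snd_mul, ih, List.map_cons, List.prod_cons]
        rcases c with c | c <;> rfl
    rw [e1, e2]
    rcases eq_or_ne l [] with rfl | hne
    · simpa using h.standard.tr_one.trans h'.standard.tr_one.symm
    · rw [h.tr_word hne hl hc, h'.tr_word hne hl hc]

theorem norm_vec_eq {x : (H →L[ℂ] H) × (K →L[ℂ] K)}
    (hx : x ∈ Algebra.adjoin ℂ (Set.range (φ.prod φ') ∪ Set.range (ψ.prod ψ'))) :
    ‖x.1 Ω‖ = ‖x.2 ω‖ := by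
  have hs : star x ∈ Algebra.adjoin ℂ (Set.range (φ.prod φ') ∪ Set.range (ψ.prod ψ')) := by
    refine star_mem_adjoin_of_star ?_ hx
    rintro _ (⟨a, rfl⟩ | ⟨b, rfl⟩)
    · exact Or.inl ⟨star a, map_star _ _⟩
    · exact Or.inr ⟨star b, map_star _ _⟩
  have h1 := tr_eq h h' (mul_mem hs hx)
  rw [Prod.fst_mul, Prod.snd_mul, Prod.fst_star, Prod.snd_star, tr, tr, mul_apply_eq_comp,
    mul_apply_eq_comp, ContinuousLinearMap.star_eq_adjoint,
    ContinuousLinearMap.star_eq_adjoint, ContinuousLinearMap.adjoint_inner_right,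
    ContinuousLinearMap.adjoint_inner_right, inner_self_eq_norm_sq_to_K,
    inner_self_eq_norm_sq_to_K] at h1
  have h2 : ‖x.1 Ω‖ ^ 2 = ‖x.2 ω‖ ^ 2 := by exact_mod_cast h1
  exact (pow_left_inj₀ (norm_nonneg _) (norm_nonneg _) two_ne_zero).1 h2

omit h' in
-- The algebra Q will be the product of the two operator algebras and π one of its projections.
theorem dense_vec {Q : Type*} [Ring Q] [StarRing Q] [Algebra ℂ Q] [StarModule ℂ Q]
    {φ₂ : A →⋆ₐ[ℂ] Q} {ψ₂ : B →⋆ₐ[ℂ] Q} (π : Q →⋆ₐ[ℂ] (H →L[ℂ] H)) (hφ : ∀ a, π (φ₂ a) = φ a)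
    (hψ : ∀ b, π (ψ₂ b) = ψ b) :
    DenseRange fun x : Algebra.adjoin ℂ (Set.range φ₂ ∪ Set.range ψ₂) => π x Ω := by
  have hlift : ∀ a ∈ StarAlgebra.adjoin ℂ (Set.range φ ∪ Set.range ψ),
      ∃ y ∈ Algebra.adjoin ℂ (Set.range φ₂ ∪ Set.range ψ₂), π y = a := by
    intro a ha
    induction ha using StarAlgebra.adjoin_induction with
    | mem x hx =>
      rcases hx with ⟨a, rfl⟩ | ⟨b, rfl⟩
      · exact ⟨φ₂ a, Algebra.subset_adjoin (Or.inl ⟨a, rfl⟩), hφ a⟩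
      · exact ⟨ψ₂ b, Algebra.subset_adjoin (Or.inr ⟨b, rfl⟩), hψ b⟩
    | algebraMap r => exact ⟨algebraMap ℂ _ r, algebraMap_mem _ r, AlgHomClass.commutes π r⟩
    | add x y _ _ hx hy =>
      obtain ⟨x', hx, rfl⟩ := hx
      obtain ⟨y', hy, rfl⟩ := hy
      exact ⟨x' + y', add_mem hx hy, map_add _ _ _⟩
    | mul x y _ _ hx hy =>
      obtain ⟨x', hx, rfl⟩ := hx
      obtain ⟨y', hy, rfl⟩ := hy
      exact ⟨x' * y', mul_mem hx hy, map_mul _ _ _⟩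
    | star x _ hx =>
      obtain ⟨x', hx, rfl⟩ := hx
      refine ⟨star x', star_mem_adjoin_of_star ?_ hx, map_star _ _⟩
      rintro _ (⟨a, rfl⟩ | ⟨b, rfl⟩)
      · exact Or.inl ⟨star a, map_star _ _⟩
      · exact Or.inr ⟨star b, map_star _ _⟩
  refine fun v => closure_minimal ?_ isClosed_closure (h.standard.cyclic v)
  rintro _ ⟨x, hx, rfl⟩
  rw [← h.generate] at hx
  obtain ⟨a, ha, hlim⟩ := exists_seq_adjoin hx Ω
  refine mem_closure_of_tendsto hlim (Eventually.of_forall fun m => ?_)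
  obtain ⟨y, hy, hy'⟩ := hlift _ (ha m)
  exact ⟨⟨y, hy⟩, by rw [← hy']⟩

/-- Two realisations of a free product are unitarily equivalent. -/
theorem exists_unitary : ∃ V : H ≃ₗᵢ[ℂ] K, V Ω = ω ∧ (∀ a v, V (φ a v) = φ' a (V v)) ∧
    ∀ b v, V (ψ b v) = ψ' b (V v) := by
  set 𝒜 := Algebra.adjoin ℂ (Set.range (φ.prod φ') ∪ Set.range (ψ.prod ψ')) with h𝒜
  let e : 𝒜 →ₗ[ℂ] H :=
    { toFun := fun x => (x : (H →L[ℂ] H) × (K →L[ℂ] K)).1 Ω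
      map_add' := fun x y => rfl
      map_smul' := fun c x => rfl }
  let f : 𝒜 →ₗ[ℂ] K :=
    { toFun := fun x => (x : (H →L[ℂ] H) × (K →L[ℂ] K)).2 ω
      map_add' := fun x y => rfl
      map_smul' := fun c x => rfl }
  have hn : ∀ x, ‖f x‖ = ‖e x‖ := fun x => (norm_vec_eq h h' x.2).symm
  have he : DenseRange e := h.dense_vec (φ₂ := φ.prod φ') (ψ₂ := ψ.prod ψ')
    (StarAlgHom.fst ℂ _ _) (fun _ => rfl) fun _ => rfl
  have hf : DenseRange f := h'.dense_vec (φ₂ := φ.prod φ') (ψ₂ := ψ.prod ψ')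
    (StarAlgHom.snd ℂ _ _) (fun _ => rfl) fun _ => rfl
  have hb : ∃ C : ℝ, ∀ x, ‖f x‖ ≤ C * ‖e x‖ := ⟨1, fun x => by rw [hn, one_mul]⟩
  let V₀ : H →L[ℂ] K := f.extendOfNorm e
  have hV : ∀ x, V₀ (e x) = f x := LinearMap.extendOfNorm_eq he hb
  have hVn : ∀ v, ‖V₀ v‖ = ‖v‖ := fun v => by
    refine congrFun (he.equalizer (g := fun v => ‖V₀ v‖) (h := fun v => ‖v‖) (by fun_prop)
      (by fun_prop) (funext fun x => ?_)) v
    simp only [Function.comp_apply, hV, hn]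
  let V₁ : H →ₗᵢ[ℂ] K := ⟨V₀, hVn⟩
  have hsurj : Function.Surjective V₁ := by
    have h1 : DenseRange V₁ := hf.mono (by rintro _ ⟨x, rfl⟩; exact ⟨e x, hV x⟩)
    rw [← Set.range_eq_univ, ← h1.closure_range]
    exact V₁.isometry.isClosedEmbedding.isClosed_range.closure_eq.symm
  refine ⟨LinearIsometryEquiv.ofSurjective V₁ hsurj, ?_, fun a v => ?_, fun b v => ?_⟩
  · exact hV 1
  · refine congrFun (he.equalizer (g := fun v => V₀ (φ a v)) (h := fun v => φ' a (V₀ v))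
      (by fun_prop) (by fun_prop) (funext fun x => ?_)) v
    have h1 := hV (⟨φ.prod φ' a, Algebra.subset_adjoin (Or.inl ⟨a, rfl⟩)⟩ * x)
    have h2 := hV x
    simp only [Function.comp_apply]
    rw [h2]
    exact h1
  · refine congrFun (he.equalizer (g := fun v => V₀ (ψ b v)) (h := fun v => ψ' b (V₀ v))
      (by fun_prop) (by fun_prop) (funext fun x => ?_)) v
    have h1 := hV (⟨ψ.prod ψ' b, Algebra.subset_adjoin (Or.inr ⟨b, rfl⟩)⟩ * x)
    have h2 := hV x
    simp only [Function.comp_apply]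
    rw [h2]
    exact h1

omit h' in
theorem isoFreeProduct : IsoFreeProduct.{u, w} τA τB M Ω φ ψ := by
  refine ⟨h, ?_⟩
  intro K _ _ _ P ω φ' ψ' h'
  obtain ⟨V, hV, hφ, hψ⟩ := exists_unitary h h'
  have eφ : ∀ a, V.conjStarAlgEquiv (φ a) = φ' a := fun a => by
    ext v
    rw [LinearIsometryEquiv.conjStarAlgEquiv_apply_apply, hφ, LinearIsometryEquiv.apply_symm_apply]
  have eψ : ∀ b, V.conjStarAlgEquiv (ψ b) = ψ' b := fun b => by
    ext v
    rw [LinearIsometryEquiv.conjStarAlgEquiv_apply_apply, hψ, LinearIsometryEquiv.apply_symm_apply]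
  have m1 : ∀ x ∈ M, V.conjStarAlgEquiv x ∈ P := fun x hx => by
    rw [← h.generate] at hx
    rw [← h'.generate]
    refine map_mem_wStar V.conjStarAlgEquiv ?_ hx
    rintro _ (⟨a, rfl⟩ | ⟨b, rfl⟩)
    · exact Or.inl ⟨a, (eφ a).symm⟩
    · exact Or.inr ⟨b, (eψ b).symm⟩
  have m2 : ∀ y ∈ P, V.conjStarAlgEquiv.symm y ∈ M := fun y hy => by
    rw [← h'.generate] at hy
    rw [← h.generate]
    refine map_mem_wStar V.conjStarAlgEquiv.symm ?_ hy
    rintro _ (⟨a, rfl⟩ | ⟨b, rfl⟩)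
    · exact Or.inl ⟨a, by rw [← eφ, StarAlgEquiv.symm_apply_apply]⟩
    · exact Or.inr ⟨b, by rw [← eψ, StarAlgEquiv.symm_apply_apply]⟩
  let Φ : M.toStarSubalgebra ≃⋆ₐ[ℂ] P.toStarSubalgebra :=
    { toFun := fun x => ⟨V.conjStarAlgEquiv x, m1 x x.2⟩
      invFun := fun y => ⟨V.conjStarAlgEquiv.symm y, m2 y y.2⟩
      left_inv := fun x => Subtype.ext (V.conjStarAlgEquiv.symm_apply_apply _)
      right_inv := fun y => Subtype.ext (V.conjStarAlgEquiv.apply_symm_apply _)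
      map_mul' := fun x y => Subtype.ext (map_mul V.conjStarAlgEquiv (x : H →L[ℂ] H) y)
      map_add' := fun x y => Subtype.ext (map_add V.conjStarAlgEquiv (x : H →L[ℂ] H) y)
      map_star' := fun x => Subtype.ext (map_star V.conjStarAlgEquiv (x : H →L[ℂ] H))
      map_smul' := fun c x => Subtype.ext (map_smul V.conjStarAlgEquiv c (x : H →L[ℂ] H)) }
  refine ⟨Φ, fun x => ?_, fun a x hx => ?_, fun b x hx => ?_⟩
  · change ⟪ω, V ((x : H →L[ℂ] H) (V.symm ω))⟫_ℂ = ⟪Ω, (x : H →L[ℂ] H) Ω⟫_ℂ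
    rw [← hV, V.symm_apply_apply, V.inner_map_map]
  · rw [← eφ, ← hx]; rfl
  · rw [← eψ, ← hx]; rfl

end IsFreeProduct

end FreeProduct

/-! ### The standard representation of `L^∞` -/

open MeasureTheory

section Multiplication

variable {α : Type*} [MeasurableSpace α] {μ : Measure α} [IsFiniteMeasure μ]

theorem memLp_LInf_top (g : LInf μ) : MemLp (g : α →ₘ[μ] ℂ) ⊤ μ := by
  obtain ⟨C, hC⟩ := g.2
  exact memLp_top_of_bound (g : α →ₘ[μ] ℂ).aestronglyMeasurable C hC

theorem memLp_LInf_two (g : LInf μ) : MemLp (g : α →ₘ[μ] ℂ) 2 μ := by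
  obtain ⟨C, hC⟩ := g.2
  exact MemLp.of_bound (g : α →ₘ[μ] ℂ).aestronglyMeasurable C hC

/-- The operator of multiplication by `g ∈ L^∞` on `L²`. -/
def mulOp (g : LInf μ) : Lp ℂ 2 μ →L[ℂ] Lp ℂ 2 μ :=
  (ContinuousLinearMap.mul ℂ ℂ).holderL μ ⊤ 2 2 ((memLp_LInf_top g).toLp _)

/-- The vector of `L²` given by `g ∈ L^∞`. -/
def toL2 (g : LInf μ) : Lp ℂ 2 μ := (memLp_LInf_two g).toLp _

theorem coeFn_toL2 (g : LInf μ) : toL2 g =ᵐ[μ] (g : α →ₘ[μ] ℂ) := (memLp_LInf_two g).coeFn_toLp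

theorem coeFn_mulOp (g : LInf μ) (h : Lp ℂ 2 μ) :
    mulOp g h =ᵐ[μ] fun t => (g : α →ₘ[μ] ℂ) t * h t := by
  refine ((ContinuousLinearMap.mul ℂ ℂ).coeFn_holder (r := 2) ((memLp_LInf_top g).toLp _) h).trans ?_
  filter_upwards [(memLp_LInf_top g).coeFn_toLp] with t ht
  simp [ht]

theorem toL2_injective : Function.Injective (toL2 : LInf μ → Lp ℂ 2 μ) := fun g g' h => by
  have h1 := coeFn_toL2 g
  rw [h] at h1
  exact Subtype.ext (AEEqFun.ext (h1.symm.trans (coeFn_toL2 g')))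

theorem mulOp_toL2 (g g' : LInf μ) : mulOp g (toL2 g') = toL2 (g * g') := by
  refine Lp.ext ?_
  filter_upwards [coeFn_mulOp g (toL2 g'), coeFn_toL2 g', coeFn_toL2 (g * g'),
    AEEqFun.coeFn_mul (g : α →ₘ[μ] ℂ) g'] with t h1 h2 h3 h4
  rw [h1, h2, h3]
  exact h4.symm

theorem toL2_add (g g' : LInf μ) : toL2 (g + g') = toL2 g + toL2 g' := by
  refine Lp.ext ?_
  filter_upwards [Lp.coeFn_add (toL2 g) (toL2 g'), coeFn_toL2 g, coeFn_toL2 g', coeFn_toL2 (g + g'),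
    AEEqFun.coeFn_add (g : α →ₘ[μ] ℂ) g'] with t h1 h2 h3 h4 h5
  rw [h1, Pi.add_apply, h2, h3, h4]
  exact h5

theorem toL2_smul (c : ℂ) (g : LInf μ) : toL2 (c • g) = c • toL2 g := by
  refine Lp.ext ?_
  filter_upwards [Lp.coeFn_smul c (toL2 g), coeFn_toL2 g, coeFn_toL2 (c • g),
    AEEqFun.coeFn_smul c (g : α →ₘ[μ] ℂ)] with t h1 h2 h3 h4
  rw [h1, Pi.smul_apply, h2, h3]
  exact h4

theorem inner_toL2 (g : LInf μ) (h : Lp ℂ 2 μ) :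
    ⟪toL2 g, h⟫_ℂ = ∫ t, (starRingEnd ℂ) ((g : α →ₘ[μ] ℂ) t) * h t ∂μ := by
  rw [L2.inner_def]
  refine integral_congr_ae ?_
  filter_upwards [coeFn_toL2 g] with t ht
  rw [ht, RCLike.inner_apply, mul_comm]

theorem inner_toL2_one (g : LInf μ) :
    ⟪toL2 (1 : LInf μ), toL2 g⟫_ℂ = ∫ t, (g : α →ₘ[μ] ℂ) t ∂μ := by
  rw [inner_toL2]
  refine integral_congr_ae ?_
  filter_upwards [coeFn_toL2 g, AEEqFun.coeFn_one (μ := μ) (β := ℂ)] with t h1 h2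
  have h3 : ((1 : LInf μ) : α →ₘ[μ] ℂ) t = 1 := h2
  rw [h1, h3, map_one, one_mul]

theorem inner_mulOp_left (g : LInf μ) (h k : Lp ℂ 2 μ) :
    ⟪mulOp g h, k⟫_ℂ = ⟪h, mulOp (star g) k⟫_ℂ := by
  rw [L2.inner_def, L2.inner_def]
  refine integral_congr_ae ?_
  filter_upwards [coeFn_mulOp g h, coeFn_mulOp (star g) k,
    AEEqFun.coeFn_star (g : α →ₘ[μ] ℂ)] with t h1 h2 h3
  have h4 : ((star g : LInf μ) : α →ₘ[μ] ℂ) t = star ((g : α →ₘ[μ] ℂ) t) := h3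
  rw [h1, h2, h4, RCLike.inner_apply, RCLike.inner_apply, map_mul, RCLike.star_def]
  ring

/-- A vector of `L²` whose multiplication operator is bounded on `L^∞` is itself bounded. -/
theorem exists_toL2_eq {h : Lp ℂ 2 μ} {C : ℝ} (hC : 0 ≤ C)
    (hh : ∀ g : LInf μ, ‖mulOp g h‖ ≤ C * ‖toL2 g‖) : ∃ g : LInf μ, toL2 g = h := by
  have hsm : StronglyMeasurable h := Lp.stronglyMeasurable h
  -- The hypothesis is tested on the indicator of E; it fails unless E is null.
  let E : Set α := {t | C < ‖h t‖}
  have hE : MeasurableSet E := measurableSet_lt measurable_const hsm.norm.measurable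
  have h1E : AEStronglyMeasurable (E.indicator fun _ => (1 : ℂ)) μ :=
    (stronglyMeasurable_const.indicator hE).aestronglyMeasurable
  let g : LInf μ := ⟨AEEqFun.mk _ h1E, 1, by
    filter_upwards [AEEqFun.coeFn_mk _ h1E] with t ht
    rw [ht]
    by_cases hm : t ∈ E <;> simp [hm]⟩
  have hg : ((g : α →ₘ[μ] ℂ) : α → ℂ) =ᵐ[μ] E.indicator fun _ => (1 : ℂ) := AEEqFun.coeFn_mk _ h1E
  have hae : ∀ᵐ t ∂μ, ‖h t‖ ≤ C := by
    have i1 : Integrable (fun t => ‖(mulOp g h : Lp ℂ 2 μ) t‖ ^ 2) μ :=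
      (Lp.memLp (mulOp g h)).integrable_norm_pow two_ne_zero
    have i2 : Integrable (fun t => ‖(toL2 g : Lp ℂ 2 μ) t‖ ^ 2) μ :=
      (Lp.memLp (toL2 g)).integrable_norm_pow two_ne_zero
    have n : ∀ k : Lp ℂ 2 μ, ‖k‖ ^ 2 = ∫ t, ‖k t‖ ^ 2 ∂μ := fun k => by
      have h1 := inner_self_eq_norm_sq_to_K (𝕜 := ℂ) k
      have h2 : ((‖k‖ ^ 2 : ℝ) : ℂ) = ((∫ t, ‖k t‖ ^ 2 ∂μ : ℝ) : ℂ) := by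
        push_cast
        rw [← integral_complex_ofReal]
        refine h1.symm.trans ((L2.inner_def _ _).trans (integral_congr_ae ?_))
        filter_upwards with t
        rw [inner_self_eq_norm_sq_to_K]
        simp
      exact_mod_cast h2
    have e1 : (fun t => ‖(mulOp g h : Lp ℂ 2 μ) t‖ ^ 2 - C ^ 2 * ‖(toL2 g : Lp ℂ 2 μ) t‖ ^ 2) =ᵐ[μ]
        E.indicator fun t => ‖h t‖ ^ 2 - C ^ 2 := by
      filter_upwards [coeFn_mulOp g h, coeFn_toL2 g, hg] with t h1 h2 h3
      rw [h1, h2, h3]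
      by_cases hm : t ∈ E <;> simp [hm]
    have hpos : ∀ t, t ∈ E → 0 < ‖h t‖ ^ 2 - C ^ 2 := fun t ht => by
      have : C < ‖h t‖ := ht
      nlinarith
    have e2 : 0 ≤ᵐ[μ] E.indicator fun t => ‖h t‖ ^ 2 - C ^ 2 :=
      Eventually.of_forall fun t => Set.indicator_nonneg (fun t ht => (hpos t ht).le) t
    have e3 : ∫ t, E.indicator (fun t => ‖h t‖ ^ 2 - C ^ 2) t ∂μ = 0 := by
      refine le_antisymm ?_ (integral_nonneg_of_ae e2)
      rw [← integral_congr_ae e1, integral_sub i1 (i2.const_mul _), integral_const_mul, ← n, ← n]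
      have := hh g
      have h2 := mul_self_le_mul_self (norm_nonneg _) this
      nlinarith
    have e4 := (integral_eq_zero_iff_of_nonneg_ae e2
      ((i1.sub (i2.const_mul _)).congr e1)).1 e3
    filter_upwards [e4] with t ht
    by_contra hlt
    have hm : t ∈ E := not_le.1 hlt
    rw [Set.indicator_of_mem hm] at ht
    exact (hpos t hm).ne' ht
  refine ⟨⟨AEEqFun.mk h hsm.aestronglyMeasurable, C, ?_⟩, Lp.ext ?_⟩
  · filter_upwards [hae, AEEqFun.coeFn_mk h hsm.aestronglyMeasurable] with t h1 h2
    rwa [h2]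
  · exact (coeFn_toL2 _).trans (AEEqFun.coeFn_mk h hsm.aestronglyMeasurable)

end Multiplication

/-! ### Polynomials in `L^∞` of an interval -/

open MeasureTheory Polynomial

section PolynomialApproximation

variable {μ : Measure (Set.Icc (-2 : ℝ) 2)} [IsProbabilityMeasure μ]

/-- A continuous function, as an element of `L^∞`. -/
def contLInf (f : C(Set.Icc (-2 : ℝ) 2, ℂ)) : LInf μ :=
  ⟨AEEqFun.mk f f.continuous.aestronglyMeasurable, ‖f‖, by
    filter_upwards [AEEqFun.coeFn_mk f (μ := μ) f.continuous.aestronglyMeasurable] with t ht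
    rw [ht]
    exact f.norm_coe_le_norm t⟩

theorem coeFn_contLInf (f : C(Set.Icc (-2 : ℝ) 2, ℂ)) :
    ((contLInf f : LInf μ) : Set.Icc (-2 : ℝ) 2 →ₘ[μ] ℂ) =ᵐ[μ] f :=
  AEEqFun.coeFn_mk f f.continuous.aestronglyMeasurable

/-- The polynomial functions, as elements of `L^∞`. -/
def polyLInf : ℂ[X] →ₐ[ℂ] LInf μ :=
  aeval (contLInf ⟨fun t => ((t : ℝ) : ℂ), by fun_prop⟩)

theorem coeFn_polyLInf (p : ℂ[X]) :
    ((polyLInf p : LInf μ) : Set.Icc (-2 : ℝ) 2 →ₘ[μ] ℂ) =ᵐ[μ] fun t => p.eval ((t : ℝ) : ℂ) := by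
  induction p using Polynomial.induction_on with
  | C a =>
    have h1 : (polyLInf (C a) : LInf μ) = a • 1 := by
      rw [polyLInf, aeval_C, Algebra.algebraMap_eq_smul_one]
    rw [h1]
    filter_upwards [AEEqFun.coeFn_smul a (1 : Set.Icc (-2 : ℝ) 2 →ₘ[μ] ℂ),
      AEEqFun.coeFn_one (μ := μ) (β := ℂ)] with t h2 h3
    refine h2.trans ?_
    rw [Pi.smul_apply, h3]
    simp
  | add p q hp hq =>
    rw [map_add]
    filter_upwards [AEEqFun.coeFn_add ((polyLInf p : LInf μ) : Set.Icc (-2 : ℝ) 2 →ₘ[μ] ℂ)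
      (polyLInf q : LInf μ), hp, hq] with t h1 h2 h3
    refine h1.trans ?_
    rw [Pi.add_apply, h2, h3, eval_add]
  | monomial k a hk =>
    have h1 : (polyLInf (C a * X ^ (k + 1)) : LInf μ) = polyLInf (C a * X ^ k) *
        contLInf ⟨fun t => ((t : ℝ) : ℂ), by fun_prop⟩ := by
      rw [pow_succ, ← mul_assoc, map_mul]
      congr 1
      rw [polyLInf, aeval_X]
    rw [h1]
    filter_upwards [AEEqFun.coeFn_mul ((polyLInf (C a * X ^ k) : LInf μ) :
      Set.Icc (-2 : ℝ) 2 →ₘ[μ] ℂ) (contLInf ⟨fun t => ((t : ℝ) : ℂ), by fun_prop⟩ : LInf μ), hk,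
      coeFn_contLInf (μ := μ) ⟨fun t => ((t : ℝ) : ℂ), by fun_prop⟩] with t h2 h3 h4
    refine h2.trans ?_
    rw [Pi.mul_apply, h3, h4]
    simp [pow_succ, mul_assoc]

theorem integral_polyLInf (p : ℂ[X]) :
    ∫ t, ((polyLInf p : LInf μ) : Set.Icc (-2 : ℝ) 2 →ₘ[μ] ℂ) t ∂μ =
      ∫ t, p.eval (((t : Set.Icc (-2 : ℝ) 2) : ℝ) : ℂ) ∂μ :=
  integral_congr_ae (coeFn_polyLInf p)

theorem star_polyLInf (p : ℂ[X]) :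
    star (polyLInf p : LInf μ) = polyLInf (p.map (starRingEnd ℂ)) := by
  refine Subtype.ext (AEEqFun.ext ?_)
  filter_upwards [AEEqFun.coeFn_star ((polyLInf p : LInf μ) : Set.Icc (-2 : ℝ) 2 →ₘ[μ] ℂ),
    coeFn_polyLInf (μ := μ) p, coeFn_polyLInf (μ := μ) (p.map (starRingEnd ℂ))] with t h1 h2 h3
  refine h1.trans ?_
  rw [Pi.star_apply, h2, h3]
  have h4 : ((t : ℝ) : ℂ) = starRingEnd ℂ ((t : ℝ) : ℂ) := (Complex.conj_ofReal _).symm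
  rw [h4, eval_map_apply, ← h4]
  rfl

theorem exists_polynomial_near_complex (f : C(Set.Icc (-2 : ℝ) 2, ℂ)) {ε : ℝ} (hε : 0 < ε) :
    ∃ p : ℂ[X], ∀ t : Set.Icc (-2 : ℝ) 2, ‖p.eval ((t : ℝ) : ℂ) - f t‖ ≤ ε := by
  obtain ⟨p, hp⟩ := exists_polynomial_near_continuousMap (-2) 2
    ⟨fun t => (f t).re, by fun_prop⟩ (ε / 2) (half_pos hε)
  obtain ⟨q, hq⟩ := exists_polynomial_near_continuousMap (-2) 2
    ⟨fun t => (f t).im, by fun_prop⟩ (ε / 2) (half_pos hε)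
  refine ⟨p.map Complex.ofRealHom + C Complex.I * q.map Complex.ofRealHom, fun t => ?_⟩
  have h1 := (ContinuousMap.norm_coe_le_norm _ t).trans hp.le
  have h2 := (ContinuousMap.norm_coe_le_norm _ t).trans hq.le
  simp only [ContinuousMap.sub_apply, ContinuousMap.coe_mk, toContinuousMapOn_apply,
    toContinuousMap_apply, Real.norm_eq_abs] at h1 h2
  have e : ∀ r : ℝ[X], (r.map Complex.ofRealHom).eval ((t : ℝ) : ℂ) = ((r.eval (t : ℝ) : ℝ) : ℂ) :=
    fun r => by
      have : ((t : ℝ) : ℂ) = Complex.ofRealHom (t : ℝ) := rfl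
      rw [this, eval_map_apply]; rfl
  refine (Complex.norm_le_abs_re_add_abs_im _).trans ?_
  rw [eval_add, eval_mul, eval_C, e, e]
  simp
  linarith

/-- Elements of `L^∞` are limits in `L²` of uniformly bounded polynomials. -/
theorem exists_bounded_polynomials (g : LInf μ) : ∃ (C : ℝ) (p : ℕ → ℂ[X]),
    (∀ m (t : Set.Icc (-2 : ℝ) 2), ‖(p m).eval ((t : ℝ) : ℂ)‖ ≤ C) ∧
      Tendsto (fun m => toL2 (polyLInf (p m) : LInf μ)) atTop (𝓝 (toL2 g)) := by
  obtain ⟨C₀, hC₀⟩ := g.2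
  set C : ℝ := max C₀ 0 with hCdef
  have hC0 : 0 ≤ C := le_max_right _ _
  have hC : ∀ᵐ t ∂μ, ‖(g : Set.Icc (-2 : ℝ) 2 →ₘ[μ] ℂ) t‖ ≤ C := by
    filter_upwards [hC₀] with t ht using ht.trans (le_max_left _ _)
  -- Clamping to [-C, C] moves no point away from the values of g, so continuous L² approximants may
  -- be truncated. It is applied to real and imaginary parts separately, whence the constants 2C and
  -- 2 below.
  let κ : ℝ → ℝ := fun s => max (-C) (min C s)
  have hκ : ∀ s, |κ s| ≤ C := fun s => abs_le.2 ⟨le_max_left _ _,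
    max_le (by linarith) (min_le_left _ _)⟩
  have hκ' : ∀ s r, |r| ≤ C → |κ s - r| ≤ |s - r| := fun s r hr => by
    have hr' : κ r = r := by
      change max (-C) (min C r) = r
      rw [min_eq_right (abs_le.1 hr).2, max_eq_right (abs_le.1 hr).1]
    conv_lhs => rw [← hr']
    refine (abs_max_sub_max_le_max _ _ _ _).trans ?_
    rw [sub_self, abs_zero, max_eq_right (abs_nonneg _)]
    refine (abs_min_sub_min_le_max _ _ _ _).trans ?_
    rw [sub_self, abs_zero, max_eq_right (abs_nonneg _)]
  have hκc : Continuous κ := by fun_prop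
  have step : ∀ ε : ℝ, 0 < ε → ε ≤ 1 → ∃ p : ℂ[X],
      (∀ t : Set.Icc (-2 : ℝ) 2, ‖p.eval ((t : ℝ) : ℂ)‖ ≤ 2 * C + 1) ∧
        ‖toL2 (polyLInf p : LInf μ) - toL2 g‖ ≤ 3 * ε := by
    intro ε hε hε1
    obtain ⟨f, hf⟩ := (ContinuousMap.toLp_denseRange ℂ μ ℂ (p := 2) (by simp)).exists_dist_lt
      (toL2 g) hε
    let f' : C(Set.Icc (-2 : ℝ) 2, ℂ) :=
      ⟨fun t => (κ (f t).re : ℂ) + (κ (f t).im : ℂ) * Complex.I, by fun_prop⟩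
    have hf' : ∀ t, ‖f' t‖ ≤ 2 * C := fun t => by
      refine (Complex.norm_le_abs_re_add_abs_im _).trans ?_
      have h1 := hκ (f t).re
      have h2 := hκ (f t).im
      simp [f']
      linarith
    obtain ⟨p, hp⟩ := exists_polynomial_near_complex f' hε
    refine ⟨p, fun t => ?_, ?_⟩
    · have := norm_le_norm_add_norm_sub' (p.eval ((t : ℝ) : ℂ)) (f' t)
      linarith [hf' t, hp t]
    · have h1 : ‖toL2 (polyLInf p : LInf μ) - toL2 (contLInf f')‖ ≤ ε := by
        have := Lp.norm_le_of_ae_bound (μ := μ) (p := 2)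
          (f := toL2 (polyLInf p : LInf μ) - toL2 (contLInf f')) hε.le ?_
        · simpa [measureUnivNNReal] using this
        · filter_upwards [Lp.coeFn_sub (toL2 (polyLInf p : LInf μ)) (toL2 (contLInf f')),
            coeFn_toL2 (polyLInf p : LInf μ), coeFn_toL2 (contLInf f' : LInf μ),
            coeFn_polyLInf (μ := μ) p, coeFn_contLInf (μ := μ) f'] with t a1 a2 a3 a4 a5
          rw [a1, Pi.sub_apply, a2, a3, a4, a5]
          exact hp t
      have h2 : ‖toL2 (contLInf f') - toL2 g‖ ≤ 2 * ‖toL2 g - f.toLp 2 μ ℂ‖ := by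
        refine Lp.norm_le_mul_norm_of_ae_le_mul ?_
        filter_upwards [Lp.coeFn_sub (toL2 (contLInf f' : LInf μ)) (toL2 g),
          Lp.coeFn_sub (toL2 g) (f.toLp 2 μ ℂ), coeFn_toL2 g, coeFn_toL2 (contLInf f' : LInf μ),
          coeFn_contLInf (μ := μ) f', f.coeFn_toLp (p := 2) (𝕜 := ℂ) μ, hC]
          with t a1 a2 a3 a4 a5 a6 a7
        rw [a1, a2, Pi.sub_apply, Pi.sub_apply, a3, a4, a5, a6]
        set w := (g : Set.Icc (-2 : ℝ) 2 →ₘ[μ] ℂ) t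
        have b1 := hκ' (f t).re w.re ((Complex.abs_re_le_norm w).trans a7)
        have b2 := hκ' (f t).im w.im ((Complex.abs_im_le_norm w).trans a7)
        have b3 := Complex.abs_re_le_norm (f t - w)
        have b4 := Complex.abs_im_le_norm (f t - w)
        rw [norm_sub_rev w]
        refine (Complex.norm_le_abs_re_add_abs_im _).trans ?_
        simp [f'] at b3 b4 ⊢
        linarith
      rw [dist_eq_norm] at hf
      have := norm_sub_le_norm_sub_add_norm_sub (toL2 (polyLInf p : LInf μ)) (toL2 (contLInf f'))
        (toL2 g)
      linarith
  have hpos : ∀ m : ℕ, 0 < 1 / ((m : ℝ) + 1) := fun m => Nat.one_div_pos_of_nat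
  choose p hp1 hp2 using fun m : ℕ => step (1 / ((m : ℝ) + 1)) (hpos m) (by
    rw [div_le_one (by positivity)]; linarith [Nat.cast_nonneg (α := ℝ) m])
  refine ⟨2 * C + 1, p, hp1, tendsto_iff_norm_sub_tendsto_zero.2 ?_⟩
  refine squeeze_zero (fun _ => norm_nonneg _) hp2 ?_
  simpa using tendsto_one_div_add_atTop_nhds_zero_nat.const_mul (3 : ℝ)

theorem denseRange_polynomial : DenseRange fun p : ℂ[X] => toL2 (polyLInf p : LInf μ) := by
  refine fun v => closure_minimal ?_ isClosed_closure
    ((ContinuousMap.toLp_denseRange ℂ μ ℂ (p := 2) (by simp)) v)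
  rintro _ ⟨f, rfl⟩
  have h1 : f.toLp 2 μ ℂ = toL2 (contLInf f) := by
    refine Lp.ext ?_
    exact (f.coeFn_toLp (p := 2) (𝕜 := ℂ) μ).trans
      ((coeFn_contLInf f).symm.trans (coeFn_toL2 _).symm)
  obtain ⟨C, p, -, hp⟩ := exists_bounded_polynomials (contLInf f : LInf μ)
  change f.toLp 2 μ ℂ ∈ _
  rw [h1]
  exact mem_closure_of_tendsto hp (Eventually.of_forall fun m => ⟨p m, rfl⟩)

end PolynomialApproximation

/-! ### The von Neumann algebra generated by a variable of given distribution -/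

open MeasureTheory Polynomial

section Distribution

variable {μ : Measure (Set.Icc (-2 : ℝ) 2)} [IsProbabilityMeasure μ]
  {H : Type u} [NormedAddCommGroup H] [InnerProductSpace ℂ H] [CompleteSpace H]

theorem norm_aeval_le_of_interval {A : Type*} [CStarAlgebra A] {Y : A} (hY : IsSelfAdjoint Y) (hn : ‖Y‖ ≤ 2)
    {p : ℂ[X]} {C : ℝ} (hp : ∀ t : Set.Icc (-2 : ℝ) 2, ‖p.eval ((t : ℝ) : ℂ)‖ ≤ C) :
    ‖aeval Y p‖ ≤ C := by
  have hC : 0 ≤ C := (norm_nonneg _).trans (hp ⟨0, by norm_num⟩)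
  rcases subsingleton_or_nontrivial A with hA | hA
  · rwa [Subsingleton.elim (aeval Y p) 0, norm_zero]
  rw [← cfc_polynomial p Y hY.isStarNormal]
  refine norm_cfc_le hC fun z hz => ?_
  have h1 := hY.mem_spectrum_eq_re hz
  have h2 : ‖z‖ ≤ 2 := (spectrum.norm_le_norm_of_mem hz).trans hn
  have h3 : |z.re| ≤ 2 := (Complex.abs_re_le_norm z).trans h2
  rw [h1]
  exact hp ⟨z.re, abs_le.1 h3⟩

theorem star_aeval {Y : H →L[ℂ] H} (hY : IsSelfAdjoint Y) (p : ℂ[X]) :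
    star (aeval Y p) = aeval Y (p.map (starRingEnd ℂ)) := by
  induction p using Polynomial.induction_on' with
  | add p q hp hq => rw [map_add, star_add, hp, hq, Polynomial.map_add, map_add]
  | monomial k a =>
    rw [map_monomial, aeval_monomial, aeval_monomial, star_mul, star_pow, hY.star_eq,
      ← algebraMap_star_comm]
    exact ((Algebra.commutes _ _)).symm

theorem aeval_mem_wStar (Y : H →L[ℂ] H) (p : ℂ[X]) : aeval Y p ∈ wStar {Y} :=
  adjoin_le_wStar {Y} (aeval_mem_adjoin Y p)

/-- The elements of `W*(Y)` commute. -/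
theorem wStar_singleton_comm {Y : H →L[ℂ] H} (hY : IsSelfAdjoint Y) {S T : H →L[ℂ] H}
    (hS : S ∈ wStar {Y}) (hT : T ∈ wStar {Y}) : S * T = T * S := by
  have h1 : Y * S = S * Y := by
    refine mem_wStar_iff.1 hS Y ?_ ?_
    · rintro _ rfl; rfl
    · rintro _ rfl; rw [hY.star_eq]
  refine mem_wStar_iff.1 hT S ?_ ?_
  · rintro _ rfl; exact h1
  · rintro _ rfl; rw [hY.star_eq, h1]

variable {Ω : H} {Y : H →L[ℂ] H} (hY : IsSelfAdjoint Y)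
  (hτ : ∀ p : ℂ[X], tr Ω (aeval Y p) = ∫ t, p.eval (((t : Set.Icc (-2 : ℝ) 2) : ℝ) : ℂ) ∂μ)

include hY hτ in
/-- The GNS space of a distribution embeds into any representation of it. -/
theorem exists_isometry_polynomial : ∃ V : Lp ℂ 2 μ →ₗᵢ[ℂ] H,
    ∀ p : ℂ[X], V (toL2 (polyLInf p)) = aeval Y p Ω := by
  have hn : ∀ p : ℂ[X], ‖aeval Y p Ω‖ = ‖toL2 (polyLInf p : LInf μ)‖ := fun p => by
    have h1 : ⟪aeval Y p Ω, aeval Y p Ω⟫_ℂ = ⟪toL2 (polyLInf p : LInf μ), toL2 (polyLInf p)⟫_ℂ := by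
      have h2 : ⟪toL2 (polyLInf p : LInf μ), toL2 (polyLInf p)⟫_ℂ =
          ∫ t, ((polyLInf (p.map (starRingEnd ℂ) * p) : LInf μ) :
            Set.Icc (-2 : ℝ) 2 →ₘ[μ] ℂ) t ∂μ := by
        rw [← inner_toL2_one, map_mul, ← mulOp_toL2, ← star_polyLInf, ← inner_mulOp_left,
          mulOp_toL2, mul_one]
      rw [h2, integral_polyLInf, ← hτ, map_mul, ← star_aeval hY, tr, mul_apply_eq_comp,
        ContinuousLinearMap.star_eq_adjoint, ContinuousLinearMap.adjoint_inner_right]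
    exact norm_eq_of_inner_self_eq h1
  let e : ℂ[X] →ₗ[ℂ] Lp ℂ 2 μ :=
    { toFun := fun p => toL2 (polyLInf p)
      map_add' := fun p q => by rw [map_add, toL2_add]
      map_smul' := fun c p => by rw [map_smul, toL2_smul, RingHom.id_apply] }
  let f : ℂ[X] →ₗ[ℂ] H :=
    { toFun := fun p => aeval Y p Ω
      map_add' := fun p q => by rw [map_add, add_apply]
      map_smul' := fun c p => by rw [map_smul]; rfl }
  have he : DenseRange e := denseRange_polynomial
  have hV : ∀ p, f.extendOfNorm e (e p) = f p :=
    LinearMap.extendOfNorm_eq he ⟨1, fun p => by rw [one_mul]; exact (hn p).le⟩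
  refine ⟨⟨f.extendOfNorm e, fun v => ?_⟩, hV⟩
  refine congrFun (he.equalizer (g := fun v => ‖f.extendOfNorm e v‖) (h := fun v => ‖v‖)
    (by fun_prop) (by fun_prop) (funext fun p => ?_)) v
  simp only [Function.comp_apply, hV]
  exact hn p

section Representation

variable {V : Lp ℂ 2 μ →ₗᵢ[ℂ] H} (hV : ∀ p : ℂ[X], V (toL2 (polyLInf p)) = aeval Y p Ω)
include hV

theorem isometry_one : V (toL2 1) = Ω := by
  have := hV 1
  rwa [map_one, map_one, one_apply_eq_self] at this

theorem aeval_isometry (p : ℂ[X]) (h : Lp ℂ 2 μ) : aeval Y p (V h) = V (mulOp (polyLInf p) h) := by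
  refine congrFun (denseRange_polynomial.equalizer (g := fun h => aeval Y p (V h))
    (h := fun h => V (mulOp (polyLInf p) h)) (by fun_prop) (by fun_prop) (funext fun q => ?_)) h
  simp only [Function.comp_apply]
  rw [hV, mulOp_toL2, ← map_mul, hV, map_mul, mul_apply_eq_comp]

include hY in
-- T commutes with polynomials in Y, so its value on Ω determines it on the vectors p(Y)Ω, which are
-- dense in the range of V.
theorem wStar_isometry {T : H →L[ℂ] H} (hT : T ∈ wStar {Y}) {g : LInf μ} (hg : T Ω = V (toL2 g))
    (h : Lp ℂ 2 μ) : T (V h) = V (mulOp g h) := by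
  refine congrFun (denseRange_polynomial.equalizer (g := fun h => T (V h))
    (h := fun h => V (mulOp g h)) (by fun_prop) (by fun_prop) (funext fun q => ?_)) h
  simp only [Function.comp_apply]
  have h1 := congrArg (fun S : H →L[ℂ] H => S Ω) (wStar_singleton_comm hY hT (aeval_mem_wStar Y q))
  simp only [mul_apply_eq_comp] at h1
  rw [hV, h1, hg, aeval_isometry hV, mulOp_toL2, mulOp_toL2, mul_comm]

include hY in
-- Bounded polynomials tend to g in L². The operators p_m(Y) are bounded too, and a weak operator
-- limit of them has the required value on Ω.
theorem exists_mem_wStar (hn : ‖Y‖ ≤ 2) (g : LInf μ) :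
    ∃ T ∈ wStar {Y}, T Ω = V (toL2 g) := by
  obtain ⟨C, p, hp, hlim⟩ := exists_bounded_polynomials g
  obtain ⟨T, hT⟩ := exists_weak_operator_limit (hyperfilter ℕ) (x := fun m => aeval Y (p m))
    fun m => norm_aeval_le_of_interval hY hn (hp m)
  refine ⟨T, vn_mem_of_weak_limit hT fun m => aeval_mem_wStar Y _, ext_inner_left ℂ fun z => ?_⟩
  refine tendsto_nhds_unique (hT z Ω) ?_
  have h1 : Tendsto (fun m => V (toL2 (polyLInf (p m)))) (hyperfilter ℕ) (𝓝 (V (toL2 g))) :=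
    ((V.continuous.tendsto _).comp hlim).mono_left Nat.hyperfilter_le_atTop
  simp only [hV] at h1
  exact tendsto_const_nhds.inner h1

include hY in
-- TΩ = V h for some h in L². By commutativity V(g h) = T V g for bounded g, so multiplying by h
-- costs at most ‖T‖ in L² norm, and h is bounded.
theorem exists_toL2_of_mem_wStar (hn : ‖Y‖ ≤ 2) {T : H →L[ℂ] H} (hT : T ∈ wStar {Y}) :
    ∃ g : LInf μ, T Ω = V (toL2 g) := by
  have h1 : T Ω ∈ Set.range V := by
    obtain ⟨a, ha, hlim⟩ := exists_seq_adjoin hT Ω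
    refine V.isometry.isClosedEmbedding.isClosed_range.mem_of_tendsto hlim
      (Eventually.of_forall fun m => ?_)
    obtain ⟨p, hp⟩ := exists_aeval_of_mem_adjoin hY (ha m)
    exact ⟨toL2 (polyLInf p), by rw [hV, hp]⟩
  obtain ⟨h, hh⟩ := h1
  obtain ⟨g, rfl⟩ := exists_toL2_eq (h := h) (ContinuousLinearMap.opNorm_nonneg T) fun g => by
    obtain ⟨S, hS, hSg⟩ := exists_mem_wStar hY hV hn g
    have h2 := congrArg (fun S : H →L[ℂ] H => S Ω) (wStar_singleton_comm hY hS hT)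
    simp only [mul_apply_eq_comp] at h2
    rw [← hh, wStar_isometry hY hV hS hSg, hSg] at h2
    rw [← V.norm_map, h2, ← V.norm_map (toL2 g)]
    exact T.le_opNorm _
  exact ⟨g, hh.symm⟩

end Representation

include hY hτ in
/-- If `Ω` is separating, then `W*(Y)` is `L^∞` of the distribution of `Y`. -/
theorem exists_starAlgEquiv_LInf (hn : ‖Y‖ ≤ 2) (hsep : ∀ x ∈ wStar {Y}, x Ω = 0 → x = 0) :
    ∃ e : LInf μ ≃⋆ₐ[ℂ] (wStar {Y}).toStarSubalgebra, ∀ g, tr Ω (e g : H →L[ℂ] H) =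
      ∫ t, (g : Set.Icc (-2 : ℝ) 2 →ₘ[μ] ℂ) t ∂μ := by
  obtain ⟨V, hV⟩ := exists_isometry_polynomial hY hτ
  -- As Ω is separating, all algebraic identities of the isomorphism can be checked on Ω.
  have huniq : ∀ S T : (wStar {Y}).toStarSubalgebra,
      (S : H →L[ℂ] H) Ω = (T : H →L[ℂ] H) Ω → S = T := fun S T h => by
    refine Subtype.ext (sub_eq_zero.1 (hsep _ (S - T).2 ?_))
    change (S : H →L[ℂ] H) Ω - (T : H →L[ℂ] H) Ω = 0
    rw [h, sub_self]
  choose Φ hΦm hΦ using fun g : LInf μ => exists_mem_wStar hY hV hn g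
  have hΦV := fun g h => wStar_isometry hY hV (hΦm g) (hΦ g) h
  let φ : LInf μ → (wStar {Y}).toStarSubalgebra := fun g => ⟨Φ g, hΦm g⟩
  have hstar : ∀ g, φ (star g) = star (φ g) := fun g => by
    obtain ⟨k, hk⟩ := exists_toL2_of_mem_wStar hY hV hn (star_mem (hΦm g))
    refine huniq _ _ ((hΦ _).trans ?_)
    change _ = star (Φ g) Ω
    rw [hk]
    congr 1
    refine ext_inner_left ℂ fun v => ?_
    refine congrFun (denseRange_polynomial.equalizer (g := fun v => ⟪v, toL2 (star g)⟫_ℂ)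
      (h := fun v => ⟪v, toL2 k⟫_ℂ) (by fun_prop) (by fun_prop) (funext fun q => ?_)) v
    simp only [Function.comp_apply]
    rw [← V.inner_map_map _ (toL2 k), ← hk, ContinuousLinearMap.star_eq_adjoint,
      ContinuousLinearMap.adjoint_inner_right, hΦV, ← isometry_one hV, V.inner_map_map,
      inner_mulOp_left, mulOp_toL2, mul_one]
  let ψ : LInf μ →⋆ₐ[ℂ] (wStar {Y}).toStarSubalgebra :=
    { toFun := φ
      map_one' := huniq _ _ ((hΦ 1).trans (isometry_one hV))
      map_mul' := fun g k => huniq _ _ (by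
        change Φ (g * k) Ω = Φ g (Φ k Ω)
        rw [hΦ, hΦ, hΦV, mulOp_toL2])
      map_zero' := huniq _ _ (by
        change Φ 0 Ω = 0
        have h1 := toL2_smul (0 : ℂ) (0 : LInf μ)
        rw [zero_smul, zero_smul] at h1
        rw [hΦ, h1, map_zero])
      map_add' := fun g k => huniq _ _ (by
        change Φ (g + k) Ω = Φ g Ω + Φ k Ω
        rw [hΦ, hΦ, hΦ, toL2_add, map_add])
      commutes' := fun c => huniq _ _ (by
        change Φ _ Ω = (algebraMap ℂ (H →L[ℂ] H) c) Ω
        rw [hΦ, Algebra.algebraMap_eq_smul_one, toL2_smul, map_smul, isometry_one hV,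
          Algebra.algebraMap_eq_smul_one]
        rfl)
      map_star' := hstar }
  have hinj : Function.Injective ψ := fun g k h => by
    have h1 : Φ g Ω = Φ k Ω := congrArg (fun S : (wStar {Y}).toStarSubalgebra =>
      (S : H →L[ℂ] H) Ω) h
    rw [hΦ, hΦ] at h1
    exact toL2_injective (V.injective h1)
  have hsurj : Function.Surjective ψ := fun T => by
    obtain ⟨g, hg⟩ := exists_toL2_of_mem_wStar hY hV hn T.2
    exact ⟨g, huniq _ _ ((hΦ g).trans hg.symm)⟩
  refine ⟨StarAlgEquiv.ofBijective ψ ⟨hinj, hsurj⟩, fun g => ?_⟩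
  change ⟪Ω, Φ g Ω⟫_ℂ = _
  rw [hΦ, ← isometry_one hV, V.inner_map_map, inner_toL2_one]

end Distribution

/-! ### Rotated tuples and splittings -/

section Rotation

/-- A unit vector extends to an orthonormal basis, whose members are the rows of U. -/
theorem exists_orthogonal_row {n : ℕ} (k : Fin n) {c : Fin n → ℝ} (hc : ∑ i, c i ^ 2 = 1) :
    ∃ U ∈ Matrix.orthogonalGroup (Fin n) ℝ, U k = c := by
  let v : Fin n → EuclideanSpace ℝ (Fin n) := fun _ => WithLp.toLp 2 c
  have hv : Orthonormal ℝ (({k} : Set (Fin n)).domRestrict v) := by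
    refine ⟨fun i => ?_, fun i j hij => absurd (Subsingleton.elim i j) hij⟩
    have h1 : ‖(WithLp.toLp 2 c : EuclideanSpace ℝ (Fin n))‖ = 1 := by
      rw [EuclideanSpace.norm_eq]
      simp [hc]
    exact h1
  obtain ⟨b, hb⟩ := hv.exists_orthonormalBasis_extension_of_card_eq (by simp)
  refine ⟨Matrix.of fun i j => b i j, ?_, ?_⟩
  · rw [Matrix.mem_orthogonalGroup_iff]
    ext i j
    have h1 := orthonormal_iff_ite.1 b.orthonormal i j
    rw [PiLp.inner_apply] at h1
    rw [Matrix.mul_apply, Matrix.one_apply, ← h1]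
    refine Finset.sum_congr rfl fun l _ => ?_
    simp [mul_comm]
  · funext j
    have := hb k rfl
    simp [this, v]

variable {H : Type u} [NormedAddCommGroup H] [InnerProductSpace ℂ H] [CompleteSpace H] {n : ℕ}

theorem sum_orthogonal_mul {U : Matrix (Fin n) (Fin n) ℝ} (hU : U ∈ Matrix.orthogonalGroup (Fin n) ℝ)
    (i j : Fin n) : ∑ l, U i l * U j l = if i = j then 1 else 0 := by
  have h1 := congrFun (congrFun ((Matrix.mem_orthogonalGroup_iff _ _).1 hU) i) j
  rw [Matrix.mul_apply, Matrix.one_apply] at h1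
  simpa using h1

theorem sum_smul_rotate {U : Matrix (Fin n) (Fin n) ℝ} (hU : U ∈ Matrix.orthogonalGroup (Fin n) ℝ)
    (X : Fin n → H →L[ℂ] H) (Ω : H) (j : Fin n) :
    ∑ i, (U i j : ℂ) • rotate U X Ω i = centered Ω (X j) := by
  have h1 : ∀ l, ∑ i, U i j * U i l = if j = l then 1 else 0 := fun l => by
    have h2 := congrFun (congrFun ((Matrix.mem_orthogonalGroup_iff' _ _).1 hU) j) l
    rw [Matrix.mul_apply, Matrix.one_apply] at h2
    simpa using h2
  simp only [rotate, Finset.smul_sum, smul_smul]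
  rw [Finset.sum_comm, Finset.sum_eq_single j]
  · rw [← Finset.sum_smul]
    have := h1 j
    rw [if_pos rfl] at this
    have h3 : (∑ i, (U i j : ℂ) * (U i j : ℂ)) = 1 := by exact_mod_cast this
    rw [h3, one_smul]
  · intro l _ hl
    rw [← Finset.sum_smul]
    have := h1 l
    rw [if_neg (Ne.symm hl)] at this
    have h3 : (∑ i, (U i j : ℂ) * (U i l : ℂ)) = 0 := by exact_mod_cast this
    rw [h3, zero_smul]
  · simp

theorem rotate_mem (U : Matrix (Fin n) (Fin n) ℝ) (X : Fin n → H →L[ℂ] H) (Ω : H) (i : Fin n) :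
    rotate U X Ω i ∈ wStar (Set.range X) :=
  sum_mem (S := (wStar (Set.range X)).toStarSubalgebra) fun j _ =>
    vn_smul_mem _ (vn_sub_mem (subset_wStar _ ⟨j, rfl⟩) (vn_smul_mem _ (vn_one_mem _)))

theorem wStar_range_rotate {U : Matrix (Fin n) (Fin n) ℝ}
    (hU : U ∈ Matrix.orthogonalGroup (Fin n) ℝ) (X : Fin n → H →L[ℂ] H) (Ω : H) :
    wStar (Set.range X) = wStar (Set.range (rotate U X Ω)) := by
  refine le_antisymm (wStar_le ?_) (wStar_le ?_)
  · rintro _ ⟨j, rfl⟩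
    have h1 : X j = ∑ i, (U i j : ℂ) • rotate U X Ω i + tr Ω (X j) • 1 := by
      rw [sum_smul_rotate hU, centered, sub_add_cancel]
    rw [h1]
    exact vn_add_mem (sum_mem (S := (wStar (Set.range (rotate U X Ω))).toStarSubalgebra)
      fun i _ => vn_smul_mem _ (subset_wStar _ ⟨i, rfl⟩)) (vn_smul_mem _ (vn_one_mem _))
  · rintro _ ⟨i, rfl⟩
    exact rotate_mem U X Ω i

theorem AreFree.mono {Ω : H} {A B A' B' : StarSubalgebra ℂ (H →L[ℂ] H)} (h : AreFree Ω A B)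
    (hA : A' ≤ A) (hB : B' ≤ B) : AreFree Ω A' B' := fun l hl hc hm =>
  h l hl hc fun p hp => ⟨by
    have h1 := (hm p hp).1
    rcases p with ⟨_ | _, x⟩
    · exact hB h1
    · exact hA h1, (hm p hp).2⟩

end Rotation

end FreeObata

end

/-! ### The theorem -/

open FreeObata

theorem theorem3 {H : Type u} [NormedAddCommGroup H] [InnerProductSpace ℂ H]
    [CompleteSpace H] {n : ℕ} [NeZero n]
    (X : Fin n → H →L[ℂ] H) (hX : ∀ i, IsSelfAdjoint (X i))
    (Ω : H) (hM : IsStandardForm (wStar (Set.range X)) Ω) (hfree : IsAlgFree X)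
    (ξ : Fin n → H) (Jac : Fin n → Fin n → Coarse H →L[ℂ] Coarse H)
    (hLip : IsLipschitzConjugate X Ω ξ Jac) (hCD : CurvatureDim 1 Jac)
    (f : H) (hf0 : f ≠ 0) (hfc : inner ℂ Ω f = 0)
    (hfsa : IsSelfAdjointVec (wStar (Set.range X)) Ω f)
    (hdom : ∀ i, f ∈ (diffQuot X Ω i).closure.domain)
    (hsat : ‖f‖ ^ 2 = ∑ i, ‖(diffQuot X Ω i).closure ⟨f, hdom i⟩‖ ^ 2) :
    ∃ U ∈ Matrix.orthogonalGroup (Fin n) ℝ,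
      let Y : Fin n → H →L[ℂ] H := rotate U X Ω
      let M : VonNeumannAlgebra H := wStar (Set.range X)
      let A : VonNeumannAlgebra H := wStar {Y 0}
      let N : VonNeumannAlgebra H := wStar (Y '' {i | i ≠ 0})
      let τN : N.toStarSubalgebra → ℂ := fun x => tr Ω (x : H →L[ℂ] H)
      f = (‖f‖ : ℂ) • Y 0 Ω ∧
      IsStandardSemicircular Ω (Y 0) ∧
      AreFree Ω (StarAlgebra.adjoin ℂ {Y 0}) (StarAlgebra.adjoin ℂ (Y '' {i | i ≠ 0})) ∧
      M = wStar (Set.range Y) ∧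
      IsoFreeProduct.{u, w} (fun x : A.toStarSubalgebra => tr Ω (x : H →L[ℂ] H)) τN M Ω
        A.toStarSubalgebra.subtype N.toStarSubalgebra.subtype ∧
      (∃ e : LInf semicircle ≃⋆ₐ[ℂ] A.toStarSubalgebra,
        (∀ g, tr Ω (e g : H →L[ℂ] H) = ∫ t, (g : Set.Icc (-2 : ℝ) 2 →ₘ[semicircle] ℂ) t ∂semicircle) ∧
        IsoFreeProduct.{u, w}
          (fun g : LInf semicircle => ∫ t, (g : Set.Icc (-2 : ℝ) 2 →ₘ[semicircle] ℂ) t ∂semicircle)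
          τN M Ω (A.toStarSubalgebra.subtype.comp (e : LInf semicircle →⋆ₐ[ℂ] A.toStarSubalgebra))
          N.toStarSubalgebra.subtype) ∧
      IsFreeComplement Ω A N M := by

  obtain ⟨J, hJM, hJf⟩ := hfsa
  have D₀ : ObataData X Ω ξ Jac J := ⟨hX, ⟨hM, hJM⟩, hfree, hLip, hCD⟩
  obtain ⟨S, D⟩ := D₀.exists_sliceData
  have hf : InDom X Ω f fun i => (diffQuot X Ω i).closure ⟨f, hdom i⟩ := fun i => by
    rw [← D₀.closure_graph]
    exact LinearPMap.mem_graph _ ⟨f, hdom i⟩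
  obtain ⟨c, hfX, hfξ, hc, hjac⟩ := D.exists_coeff hf hfc hJf hsat
  have hn : ‖f‖ ≠ 0 := norm_ne_zero_iff.2 hf0
  have hn' : (‖f‖ : ℂ) ≠ 0 := Complex.ofReal_ne_zero.2 hn
  -- The coefficient vector of f has Euclidean norm ‖f‖, so c / ‖f‖ can serve as the row of U with
  -- index 0, which plays the part of Y₁.
  have hc1 : ∑ i, (‖f‖⁻¹ * c i) ^ 2 = 1 := by
    simp only [mul_pow]
    rw [← Finset.mul_sum, hc, inv_pow, inv_mul_cancel₀ (pow_ne_zero 2 hn)]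
  obtain ⟨U, hU, hUc⟩ := exists_orthogonal_row (0 : Fin n) hc1
  have hscale : ∀ {E : Type u} [AddCommGroup E] [Module ℂ E] (v : Fin n → E),
      ∑ i, (U 0 i : ℂ) • v i = (‖f‖ : ℂ)⁻¹ • ∑ i, (c i : ℂ) • v i := fun v => by
    rw [hUc, Finset.smul_sum]
    refine Finset.sum_congr rfl fun i _ => ?_
    rw [smul_smul]
    push_cast
    rfl
  obtain ⟨ℓ, hℓ, hY⟩ := D.exists_isFreeCreation (U := U) (k := 0)
    (fun i hi => by rw [sum_orthogonal_mul hU, if_neg (Ne.symm hi)])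
    (by rw [hUc]; exact hc1)
    (by
      have h1 := hscale fun i => centered Ω (X i) Ω
      have h2 := hscale ξ
      rw [h1, h2, ← hfX, ← hfξ])
    (fun i => by
      rw [hscale, hjac i, smul_smul, hUc]
      push_cast
      rfl)
  have hΩ := hM.norm_one
  have hYf : f = (‖f‖ : ℂ) • rotate U X Ω 0 Ω := by
    have h1 : rotate U X Ω 0 Ω = ∑ i, (U 0 i : ℂ) • centered Ω (X i) Ω := by
      rw [rotate, sum_apply]; rfl
    rw [h1, hscale, ← hfX, smul_smul, mul_inv_cancel₀ hn', one_smul]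
  refine ⟨U, hU, ?_⟩
  intro Y M A N τN
  have hY0 : Y 0 = ℓ + star ℓ := hY
  have hsa : IsSelfAdjoint (Y 0) := by rw [hY0]; exact IsSelfAdjoint.add_star_self ℓ
  -- An isometry ℓ gives ‖ℓ + ℓ*‖ ≤ 2, so the spectrum of Y₁ lies in [-2, 2], as the identification
  -- with L^∞ requires.
  have hℓn : ‖ℓ‖ ≤ 1 := by
    refine ContinuousLinearMap.opNorm_le_bound _ zero_le_one fun v => ?_
    have h1 : ⟪ℓ v, ℓ v⟫_ℂ = ⟪v, v⟫_ℂ := by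
      rw [← ContinuousLinearMap.adjoint_inner_right, ← ContinuousLinearMap.star_eq_adjoint,
        hℓ.star_apply]
    rw [one_mul, norm_eq_of_inner_self_eq h1]
  have hYn : ‖Y 0‖ ≤ 2 := by
    rw [hY0]
    refine (norm_add_le _ _).trans ?_
    rw [norm_star]
    linarith
  have hAM : A ≤ M := wStar_le (Set.singleton_subset_iff.2 (rotate_mem U X Ω 0))
  have hNM : N ≤ M := wStar_le (by rintro _ ⟨i, -, rfl⟩; exact rotate_mem U X Ω i)
  have hfreeAlg : AreFree Ω (StarAlgebra.adjoin ℂ {Y 0}) (StarAlgebra.adjoin ℂ (Y '' {i | i ≠ 0})) := by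
    rw [hY0]
    exact hℓ.areFree hΩ
  have hfreeVN : AreFree Ω A.toStarSubalgebra N.toStarSubalgebra :=
    hM.areFree_wStar (fun x hx => hAM (subset_wStar _ hx)) (fun x hx => hNM (subset_wStar _ hx))
      hfreeAlg
  have hMY : M = wStar (Set.range Y) := wStar_range_rotate hU X Ω
  have hgen : wStar ((A : Set (H →L[ℂ] H)) ∪ (N : Set (H →L[ℂ] H))) = M := by
    rw [wStar_wStar, hMY, ← Set.image_singleton, ← Set.image_union, ← Set.image_univ]
    congr 2
    ext i
    simp [em]
  -- Faithfulness of the trace on M makes Ω separating for the subalgebra.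
  have hsep : ∀ x ∈ wStar {Y 0}, x Ω = 0 → x = 0 := fun x hx h0 => by
    refine hM.faithful x (hAM hx) ?_
    rw [tr, mul_apply_eq_comp, h0, map_zero, inner_zero_right]
  obtain ⟨e, he⟩ := exists_starAlgEquiv_LInf (μ := semicircle) (Ω := Ω) hsa
    (fun p => by rw [hY0]; exact hℓ.tr_aeval hΩ p) hYn hsep
  have hrA : Set.range A.toStarSubalgebra.subtype = (A : Set (H →L[ℂ] H)) := Subtype.range_coe
  have hrN : Set.range N.toStarSubalgebra.subtype = (N : Set (H →L[ℂ] H)) := Subtype.range_coe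
  have hrN' : N.toStarSubalgebra.subtype.range ≤ N.toStarSubalgebra := by
    rintro _ ⟨x, rfl⟩; exact x.2
  refine ⟨hYf, by rw [hY0]; exact hℓ.isStandardSemicircular hΩ, hfreeAlg, hMY,
    IsFreeProduct.isoFreeProduct ⟨hM, fun a => rfl, fun b => rfl, hfreeVN.mono ?_ hrN', ?_⟩,
    ⟨e, he, IsFreeProduct.isoFreeProduct ⟨hM, fun g => he g, fun b => rfl, hfreeVN.mono ?_ hrN', ?_⟩⟩,
    hAM, hNM, hfreeVN, hgen⟩
  · rintro _ ⟨x, rfl⟩; exact x.2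
  · rw [hrA, hrN]; exact hgen
  · rintro _ ⟨g, rfl⟩; exact (e g).2
  · have h1 : Set.range (A.toStarSubalgebra.subtype.comp
        (e : LInf semicircle →⋆ₐ[ℂ] A.toStarSubalgebra)) = (A : Set (H →L[ℂ] H)) := by
      ext x
      constructor
      · rintro ⟨g, rfl⟩; exact (e g).2
      · intro hx
        obtain ⟨g, hg⟩ := EquivLike.surjective e ⟨x, hx⟩
        exact ⟨g, congrArg Subtype.val hg⟩
    rw [h1, hrN]; exact hgen
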